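/- Let $d\ge 1$, $G=\mathrm{SL}(d+1,\mathbb R)$, $\Gamma=\mathrm{SL}(d+1,\mathbb Z)$ and $X=G/\Gamma$, where $g\Gamma$ is identified with the unimodular lattice $g\mathbb Z^{d+1}$. For $t>0$ and $\mathbf x\in\mathbb R^d$ (a row vector) put $$g_t=\begin{pmatrix}t^{-d/(d+1)}&0\\0&t^{1/(d+1)}I_d\end{pmatrix},\qquad u(\mathbf x)=\begin{pmatrix}1&\mathbf x\\0&I_d\end{pmatrix}.$$ **The measure.** Let $\Lambda$ be a finite totally ordered set and let $\mathcal F=\{h_i=\rho_iO_i+b_i\}_{i\in\Lambda}$, with $0<\rho_i<1$, $O_i\in\mathrm{SO}(d,\mathbb R)$, $b_i\in\mathbb R^d$, be an iterated function system on $\mathbb R^d$ which is irreducible (no non-empty finite collection of non-empty proper affine subspaces is invariant under all the $h_i$) and satisfies the open set condition (there is a non-empty open $U$ such that the sets $h_i(U)$ are pairwise disjoint subsets of $U$). Let $\mathcal K$ be its limit set, i.e. the non-empty compact set with $\mathcal K=\bigcup_i h_i(\mathcal K)$, let $s=\dim_H\mathcal K$, and let $\mu$ be the self-similar probability measure on $\mathcal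 K$ with weights $\rho_i^s$: $\mu=\sum_i\rho_i^s\,(h_i)_*\mu$. For a word $\omega\in\Lambda^k$ let $h_\omega=h_{\omega_1}\circ\dots\circ h_{\omega_k}$, $\rho_\omega=\prod_j\rho_{\omega_j}$, $\mathcal K_\omega=h_\omega(\mathcal K)$ and $\hat{\mathcal K}_\omega=\mathcal K_\omega\setminus\bigcup_{\alpha>\omega}\mathcal K_\alpha$, where $\alpha$ runs over the words of length $k$ that are larger than $\omega$ in the lexicographic order. For $\mathbf x\in\mathcal K$ and $k\in\mathbb N$ let $\rho(\mathbf x,k)=\rho_\omega$, where $\omega$ is the unique word of length $k$ with $\mathbf x\in\hat{\mathcal K}_\omega$. **The exponents.** For $1\le\ell\le d$ let $$\alpha_\ell(\mu)=\liminf_{\varepsilon\to0}\frac{\log\sup_{\mathcal L}\mu(\mathcal L^{(\varepsilon)})}{\log\varepsilon},$$ where $\mathcal L$ runs over the affine subspaces of $\mathbb R^d$ of dimension $d-\ell$ and $\mathcal L^{(\varepsilon)}$ is the open Euclidean $\varepsilon$-neighbourhood of $\mathcal L$. Put $$\varpi=\min_{1\le\ell\le d}\alpha_\ell(\mu)(d-\ell+1),\qquad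 \beta_\ell=\frac{d-\ell+1}{\varpi},\qquad \beta=\frac{\varpi}{d+1}=\min_{1\le\ell\le d}\frac{\alpha_\ell(\mu)(d-\ell+1)}{d+1}.$$ **The Margulis function.** A subgroup $L$ of a lattice $x\subset\mathbb R^{d+1}$ is primitive if $L=x\cap\mathrm{span}_{\mathbb R}(L)$. For $1\le\ell\le d$ and $x\in X$ let $\varphi_\ell(x)$ be the maximum of $\|v_1\wedge\dots\wedge v_\ell\|^{-1}$ over all linearly independent $v_1,\dots,v_\ell$ that generate a primitive subgroup of $x$; here $\|\cdot\|$ is the Euclidean norm on $\bigwedge^\ell\mathbb R^{d+1}$ for which the monomials in the standard basis vectors are orthonormal. For $\varepsilon>0$ and $0<\varrho<1$ put $$f_{\varepsilon,\varrho}(x)=2+\sum_{\ell=1}^d\varepsilon^\ell\,\varphi_\ell(x)^{\varrho/\beta_\ell}.$$ **The contraction hypothesis.** Let $f_k:X\to(0,\infty]$, $k\in\mathbb N$, be functions and let $0\le\gamma_0<\beta'$. One says that $\mu$ satisfies the $(\mathcal F,(f_k),\beta',\gamma_0)$-contraction hypothesis on $X$ if: (1) $\{f_k=\infty\}$ is independent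 of $k$ and $G$-invariant; (2) every $f_k$ is $\mathrm{SO}(d+1,\mathbb R)$-invariant, and for every bounded neighbourhood $\mathcal O$ of the identity in $G$ there is $C_{\mathcal O}\ge1$ with $C_{\mathcal O}^{-1}f_k(y)\le f_k(gy)\le C_{\mathcal O}f_k(y)$ for all $g\in\mathcal O$, $y\in X$, $k\in\mathbb N$; (3) there is $c\ge1$ such that for all $k\in\mathbb N$ and $\gamma_0\le\gamma\le\beta'$ there is $T>0$ such that for all $y\in X$ with $f_k(y)>T$ $$\int_{\mathcal K}\rho(\mathbf x,k)^{-\gamma}f_k(g_{\rho(\mathbf x,k)}u(\mathbf x)y)\,d\mu(\mathbf x)\le c\,f_k(y)\Big(\int_{\mathcal K}\rho(\mathbf x,k)\,d\mu(\mathbf x)\Big)^{\beta'-\gamma}.$$ **Theorem.** For every $k\in\mathbb N$ there are $b=b(k,\mu)\ge1$ and $0<\varepsilon_0=\varepsilon_0(k,\mu)<1$, depending only on $k$ and $\mu$, such that the following holds for every $0<\varrho<1$. (i) There is a constant $C_1>0$, depending only on $\varrho$ and $\mu$, such that for all $k\in\mathbb N$, all $x_0\in X$ and all $\gamma\in\mathbb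 R$ with $\varrho\beta-\frac{1-\varrho}{1+\varrho}\le\gamma\le\varrho\beta$, the function $\mathbf x\mapsto\rho(\mathbf x,k)^{-\gamma}f_{\varepsilon_0,\varrho}(g_{\rho(\mathbf x,k)}u(\mathbf x)x_0)$ is $\mu$-integrable and $$\int\rho(\mathbf x,k)^{-\gamma}f_{\varepsilon_0,\varrho}(g_{\rho(\mathbf x,k)}u(\mathbf x)x_0)\,d\mu(\mathbf x)\le C_1\Big(\int\rho(\mathbf x,k)\,d\mu(\mathbf x)\Big)^{\varrho\beta-\gamma}f_{\varepsilon_0,\varrho}(x_0)+b .$$ (ii) With $f_k=f_{\varepsilon_0(k,\mu),\varrho}$, the measure $\mu$ satisfies the $(\mathcal F,(f_k),\varrho\beta,\gamma_0)$-contraction hypothesis on $X$ with $\gamma_0=\max\{0,\varrho\beta-\frac{1-\varrho}{1+\varrho}\}$. -/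

import Mathlib

open MeasureTheory Filter Topology
open scoped ENNReal

noncomputable section

/-! ## Iterated function systems of contractive similarities -/

/-- A finite family `h_i = ρ_i O_i + b_i`, `i ∈ Λ`, of contractive similarities of `ℝ^d`, with
`0 < ρ_i < 1`, `O_i ∈ SO(d, ℝ)` and `b_i ∈ ℝ^d`. -/
structure SimilarityIFS (d : ℕ) (Λ : Type*) where
  ratio : Λ → ℝ
  ratio_pos : ∀ i, 0 < ratio i
  ratio_lt_one : ∀ i, ratio i < 1
  rot : Λ → Matrix.specialOrthogonalGroup (Fin d) ℝ
  trans : Λ → EuclideanSpace ℝ (Fin d)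

namespace SimilarityIFS

variable {d : ℕ} {Λ : Type*}

/-- The similarity `h_i`. -/
def sim (F : SimilarityIFS d Λ) (i : Λ) (x : EuclideanSpace ℝ (Fin d)) :
    EuclideanSpace ℝ (Fin d) :=
  F.ratio i • WithLp.toLp 2 ((F.rot i : Matrix (Fin d) (Fin d) ℝ).mulVec x.ofLp) + F.trans i

/-- `h_ω = h_{ω_1} ∘ ⋯ ∘ h_{ω_k}` for a word `ω` of length `k`. -/
def simWord (F : SimilarityIFS d Λ) :
    (k : ℕ) → (Fin k → Λ) → EuclideanSpace ℝ (Fin d) → EuclideanSpace ℝ (Fin d)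
  | 0, _ => id
  | k + 1, ω => F.sim (ω 0) ∘ F.simWord k (Fin.tail ω)

/-- `ρ_ω`, the product of the contraction ratios along a word. -/
def ratioWord (F : SimilarityIFS d Λ) {k : ℕ} (ω : Fin k → Λ) : ℝ := ∏ j, F.ratio (ω j)

/-- `K` is the limit set of `F`: the (unique) non-empty compact set with `K = ⋃ h_i(K)`. -/
def IsLimitSet (F : SimilarityIFS d Λ) (K : Set (EuclideanSpace ℝ (Fin d))) : Prop :=
  K.Nonempty ∧ IsCompact K ∧ K = ⋃ i, F.sim i '' K

/-- The open set condition. -/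
def OpenSetCondition (F : SimilarityIFS d Λ) : Prop :=
  ∃ U : Set (EuclideanSpace ℝ (Fin d)), IsOpen U ∧ U.Nonempty ∧
    (∀ i, F.sim i '' U ⊆ U) ∧ ∀ i j, i ≠ j → Disjoint (F.sim i '' U) (F.sim j '' U)

/-- No non-empty finite collection of (non-empty) proper affine subspaces of `ℝ^d` is invariant
by every map of `F`. -/
def IsIrreducible (F : SimilarityIFS d Λ) : Prop :=
  ¬ ∃ S : Set (AffineSubspace ℝ (EuclideanSpace ℝ (Fin d))), S.Finite ∧ S.Nonempty ∧
    (∀ L ∈ S, L ≠ ⊥ ∧ L ≠ ⊤) ∧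
    ∀ i, ∀ L ∈ S, ∃ L' ∈ S,
      F.sim i '' (L : Set (EuclideanSpace ℝ (Fin d))) = (L' : Set (EuclideanSpace ℝ (Fin d)))

/-- `μ` is self-similar for `F` and the weights `p`: `μ = ∑ p_i (h_i)_* μ`. -/
def IsSelfSimilar [Fintype Λ] (F : SimilarityIFS d Λ) (p : Λ → ℝ)
    (μ : Measure (EuclideanSpace ℝ (Fin d))) : Prop :=
  μ = ∑ i, ENNReal.ofReal (p i) • μ.map (F.sim i)

/-- `K̂_ω = K_ω \ ⋃_{α > ω} (K_ω ∩ K_α)`, where `K_ω = h_ω(K)` and words of a given length are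
ordered lexicographically. -/
def hatPiece [LinearOrder Λ] (F : SimilarityIFS d Λ) (K : Set (EuclideanSpace ℝ (Fin d)))
    {k : ℕ} (ω : Fin k → Λ) : Set (EuclideanSpace ℝ (Fin d)) :=
  (F.simWord k ω '' K) \
    ⋃ α : Fin k → Λ, ⋃ _ : toLex ω < toLex α, (F.simWord k ω '' K) ∩ (F.simWord k α '' K)

open Classical in
/-- The cocycle `ρ(x, k) = ρ_ω` for the word `ω` of length `k` with `x ∈ K̂_ω`; that word exists and
is unique for `x ∈ K` (see `existsUnique_hatPiece`). Outside `K` the value is irrelevant. -/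
def cocycle [LinearOrder Λ] (F : SimilarityIFS d Λ) (K : Set (EuclideanSpace ℝ (Fin d)))
    (k : ℕ) (x : EuclideanSpace ℝ (Fin d)) : ℝ :=
  if h : ∃ ω : Fin k → Λ, x ∈ F.hatPiece K ω then F.ratioWord h.choose else 1

theorem exists_word (F : SimilarityIFS d Λ) {K : Set (EuclideanSpace ℝ (Fin d))}
    (hK : F.IsLimitSet K) (k : ℕ) :
    ∀ x ∈ K, ∃ ω : Fin k → Λ, x ∈ F.simWord k ω '' K := by
  induction k with
  | zero => exact fun x hx => ⟨Fin.elim0, x, hx, rfl⟩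
  | succ k ih =>
    intro x hx
    rw [hK.2.2] at hx
    obtain ⟨i, y, hy, rfl⟩ := Set.mem_iUnion.1 hx
    obtain ⟨ω, z, hz, rfl⟩ := ih y hy
    exact ⟨Fin.cons i ω, z, hz, by simp [simWord]⟩

theorem existsUnique_hatPiece [Fintype Λ] [LinearOrder Λ] (F : SimilarityIFS d Λ)
    {K : Set (EuclideanSpace ℝ (Fin d))} (hK : F.IsLimitSet K) (k : ℕ)
    {x : EuclideanSpace ℝ (Fin d)} (hx : x ∈ K) : ∃! ω : Fin k → Λ, x ∈ F.hatPiece K ω := by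
  classical
  let S : Finset (Lex (Fin k → Λ)) :=
    (Finset.univ.filter fun ω : Fin k → Λ => x ∈ F.simWord k ω '' K).map toLex.toEmbedding
  have hS : S.Nonempty := by
    obtain ⟨ω, hω⟩ := F.exists_word hK k x hx
    exact ⟨toLex ω, by simpa [S] using hω⟩
  have hmem : ∀ α : Fin k → Λ, toLex α ∈ S ↔ x ∈ F.simWord k α '' K := by
    intro α; simp [S]
  obtain ⟨m, hm, hmax⟩ := S.exists_max_image id hS
  have hm' : x ∈ F.simWord k (ofLex m) '' K := (hmem (ofLex m)).1 hm
  refine ⟨ofLex m, ⟨hm', ?_⟩, ?_⟩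
  · simp only [Set.mem_iUnion, not_exists]
    intro α hα h
    exact absurd (hmax _ ((hmem α).2 h.2)) (not_le.2 hα)
  · intro ω hω
    have h1 : toLex ω ≤ m := hmax _ ((hmem ω).2 hω.1)
    rcases h1.lt_or_eq with h | h
    · refine absurd ?_ hω.2
      simp only [Set.mem_iUnion]
      exact ⟨ofLex m, h, hω.1, hm'⟩
    · exact h

end SimilarityIFS

/-- The exponent `α_ℓ(μ) = liminf_{ε → 0} log (sup_L μ(L^(ε))) / log ε`, where `L` runs over the
affine subspaces of `ℝ^d` of dimension `d - ℓ` and `L^(ε)` is the open `ε`-neighbourhood. -/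
def decayExponent {d : ℕ} (μ : Measure (EuclideanSpace ℝ (Fin d))) (ℓ : ℕ) : ℝ :=
  liminf (fun ε : ℝ =>
    Real.log (⨆ L : {L : AffineSubspace ℝ (EuclideanSpace ℝ (Fin d)) //
        L ≠ ⊥ ∧ Module.finrank ℝ L.direction = d - ℓ},
      μ.real (Metric.thickening ε (L.1 : Set (EuclideanSpace ℝ (Fin d))))) / Real.log ε) (𝓝[>] 0)

/-- `ϖ = min_{1 ≤ ℓ ≤ d} α_ℓ(μ) (d - ℓ + 1)`. -/
def varpi {d : ℕ} (μ : Measure (EuclideanSpace ℝ (Fin d))) : ℝ :=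
  ⨅ ℓ : Set.Icc 1 d, decayExponent μ ℓ * ((d : ℝ) - (ℓ : ℕ) + 1)

/-- `β_ℓ = (d - ℓ + 1) / ϖ`. -/
def betaExp {d : ℕ} (μ : Measure (EuclideanSpace ℝ (Fin d))) (ℓ : ℕ) : ℝ :=
  ((d : ℝ) - ℓ + 1) / varpi μ

/-- `β = min_{1 ≤ ℓ ≤ d} α_ℓ(μ) (d - ℓ + 1) / (d + 1)`. -/
def betaMin {d : ℕ} (μ : Measure (EuclideanSpace ℝ (Fin d))) : ℝ :=
  ⨅ ℓ : Set.Icc 1 d, decayExponent μ ℓ * ((d : ℝ) - (ℓ : ℕ) + 1) / ((d : ℝ) + 1)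

/-! ## The space of lattices -/

/-- `G = SL(d+1, ℝ)`; the coordinates of `ℝ^(d+1)` are indexed by `0, …, d`. -/
abbrev SLR (d : ℕ) : Type := Matrix.SpecialLinearGroup (Fin (d + 1)) ℝ

/-- `Γ = SL(d+1, ℤ)` as a subgroup of `G`. -/
abbrev SLZ (d : ℕ) : Subgroup (SLR d) :=
  (Matrix.SpecialLinearGroup.map (n := Fin (d + 1)) (Int.castRingHom ℝ)).range

/-- `X = G / Γ`, with the left action of `G`. -/
abbrev LatticeSpace (d : ℕ) : Type := SLR d ⧸ SLZ d

theorem det_diag_flow (d : ℕ) {t : ℝ} (ht : 0 < t) :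
    (Matrix.diagonal (Fin.cons (t ^ (-(d : ℝ) / ((d : ℝ) + 1)))
      (fun _ : Fin d => t ^ (1 / ((d : ℝ) + 1)))) : Matrix (Fin (d + 1)) (Fin (d + 1)) ℝ).det
      = 1 := by
  rw [Matrix.det_diagonal, Fin.prod_univ_succ]
  simp only [Fin.cons_zero, Fin.cons_succ, Finset.prod_const, Finset.card_univ, Fintype.card_fin]
  rw [← Real.rpow_natCast, ← Real.rpow_mul ht.le, ← Real.rpow_add ht]
  rw [show -(d : ℝ) / ((d : ℝ) + 1) + 1 / ((d : ℝ) + 1) * (d : ℝ) = 0 by ring, Real.rpow_zero]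

/-- `g_t = diag(t^(-d/(d+1)), t^(1/(d+1)), …, t^(1/(d+1)))` for `t > 0`
(and the irrelevant value `1` for `t ≤ 0`). -/
def gFlow (d : ℕ) (t : ℝ) : SLR d :=
  if ht : 0 < t then
    ⟨Matrix.diagonal (Fin.cons (t ^ (-(d : ℝ) / ((d : ℝ) + 1)))
      (fun _ : Fin d => t ^ (1 / ((d : ℝ) + 1)))), det_diag_flow d ht⟩
  else 1

/-- The matrix with rows `(1, x)` and `(0, I_d)`. -/
def uMat {d : ℕ} (x : EuclideanSpace ℝ (Fin d)) : Matrix (Fin (d + 1)) (Fin (d + 1)) ℝ :=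
  Matrix.of (Fin.cons (Fin.cons 1 x.ofLp) fun i => Fin.cons 0 (Pi.single i 1))

theorem det_uMat {d : ℕ} (x : EuclideanSpace ℝ (Fin d)) : (uMat x).det = 1 := by
  have h : (uMat x).BlockTriangular id := by
    intro i j hij
    refine Fin.cases ?_ (fun i => ?_) i hij
    · intro h; exact absurd h (Fin.not_lt_zero _)
    · refine Fin.cases ?_ (fun j => ?_) j
      · intro _; simp [uMat]
      · intro h
        have : j ≠ i := fun e => by subst e; exact lt_irrefl _ h
        simp [uMat, this]
  rw [Matrix.det_of_isUpperTriangular h]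
  refine Finset.prod_eq_one fun i _ => ?_
  refine Fin.cases ?_ (fun i => ?_) i <;> simp [uMat]

/-- `u(x) ∈ G`. -/
def uElt {d : ℕ} (x : EuclideanSpace ℝ (Fin d)) : SLR d := ⟨uMat x, det_uMat x⟩

/-- The homomorphism `ℤ^(d+1) → ℝ^(d+1)`, `z ↦ g z`. -/
def latticeHom {d : ℕ} (g : SLR d) : (Fin (d + 1) → ℤ) →+ EuclideanSpace ℝ (Fin (d + 1)) where
  toFun z := WithLp.toLp 2 ((g : Matrix (Fin (d + 1)) (Fin (d + 1)) ℝ).mulVec fun i => (z i : ℝ))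
  map_zero' := by
    ext i; simp [Matrix.mulVec, dotProduct]
  map_add' z w := by
    ext i; simp [Matrix.mulVec, dotProduct, mul_add, Finset.sum_add_distrib]

theorem latticeHom_mul_map {d : ℕ} (g : SLR d)
    (γ : Matrix.SpecialLinearGroup (Fin (d + 1)) ℤ) (z : Fin (d + 1) → ℤ) :
    latticeHom (g * Matrix.SpecialLinearGroup.map (Int.castRingHom ℝ) γ) z
      = latticeHom g ((γ : Matrix (Fin (d + 1)) (Fin (d + 1)) ℤ).mulVec z) := by
  simp only [latticeHom, AddMonoidHom.coe_mk, ZeroHom.coe_mk, Matrix.SpecialLinearGroup.coe_mul,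
    ← Matrix.mulVec_mulVec]
  congr 2
  ext i
  simp [Matrix.mulVec, dotProduct]

theorem latticeHom_range_le {d : ℕ} (g : SLR d)
    (γ : Matrix.SpecialLinearGroup (Fin (d + 1)) ℤ) :
    (latticeHom (g * Matrix.SpecialLinearGroup.map (Int.castRingHom ℝ) γ)).range
      ≤ (latticeHom g).range := by
  rintro _ ⟨z, rfl⟩
  exact ⟨_, (latticeHom_mul_map g γ z).symm⟩

/-- The unimodular lattice `g ℤ^(d+1)` attached to the point `g Γ` of `X`. -/
def latticeOf {d : ℕ} (x : LatticeSpace d) : AddSubgroup (EuclideanSpace ℝ (Fin (d + 1))) :=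
  Quotient.liftOn' x (fun g => (latticeHom g).range) (by
    intro g g' h
    obtain ⟨γ, hγ⟩ := QuotientGroup.leftRel_apply.1 h
    have h1 : g' = g * Matrix.SpecialLinearGroup.map (Int.castRingHom ℝ) γ := by
      rw [hγ]; group
    have h2 : g = g' * Matrix.SpecialLinearGroup.map (Int.castRingHom ℝ) γ⁻¹ := by
      rw [h1, map_inv]; group
    apply le_antisymm
    · rw [h2]; exact latticeHom_range_le g' γ⁻¹
    · rw [h1]; exact latticeHom_range_le g γ)

/-- A subgroup `L` of the lattice `Δ` is primitive if `L = Δ ∩ span_ℝ L`. -/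
def IsPrimitiveSubgroup {n : ℕ} (Δ L : AddSubgroup (EuclideanSpace ℝ (Fin n))) : Prop :=
  (L : Set (EuclideanSpace ℝ (Fin n)))
    = (Δ : Set (EuclideanSpace ℝ (Fin n))) ∩
      (Submodule.span ℝ (L : Set (EuclideanSpace ℝ (Fin n))) : Set (EuclideanSpace ℝ (Fin n)))

/-- `φ_ℓ(x)`: the maximum of `‖v_1 ∧ ⋯ ∧ v_ℓ‖⁻¹` over the bases `v_1, …, v_ℓ` of primitive
subgroups of rank `ℓ` of the lattice `x`; the norm is the one that makes the monomials
`e_{i_1} ∧ ⋯ ∧ e_{i_ℓ}` an orthonormal basis. -/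
def phi {d : ℕ} (ℓ : ℕ) (x : LatticeSpace d) : ℝ :=
  sSup {r : ℝ | ∃ v : Fin ℓ → EuclideanSpace ℝ (Fin (d + 1)), LinearIndependent ℝ v ∧
    IsPrimitiveSubgroup (latticeOf x) (AddSubgroup.closure (Set.range v)) ∧
    r = ‖exteriorPower.ιMulti ℝ ℓ v‖⁻¹}

/-- The Margulis function `f_{ε,ϱ} = 2 + ∑_{ℓ=1}^d ε^ℓ φ_ℓ^{ϱ/β_ℓ}`. -/
def margulisFun {d : ℕ} (μ : Measure (EuclideanSpace ℝ (Fin d))) (ε ϱ : ℝ)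
    (x : LatticeSpace d) : ℝ :=
  2 + ∑ ℓ ∈ Finset.Icc 1 d, ε ^ ℓ * phi ℓ x ^ (ϱ / betaExp μ ℓ)

/-! ## The contraction hypothesis -/

/-- The `(F, (f_k), β, γ₀)`-contraction hypothesis for a measure `μ` on the limit set `K` of `F`
and an action of `G = SL(d+1, ℝ)` on `X`. A set of matrices in `G` is bounded when its entries are
uniformly bounded. -/
def ContractionHypothesis {d : ℕ} {Λ : Type*} [LinearOrder Λ] {X : Type*} [MulAction (SLR d) X]
    (F : SimilarityIFS d Λ) (K : Set (EuclideanSpace ℝ (Fin d)))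
    (μ : Measure (EuclideanSpace ℝ (Fin d))) (f : ℕ → X → ℝ≥0∞) (β γ₀ : ℝ) : Prop :=
  (0 ≤ γ₀ ∧ γ₀ < β) ∧
  (∀ k y, 0 < f k y) ∧
  (∀ k k' y, f k y = ∞ ↔ f k' y = ∞) ∧
  (∀ k (g : SLR d) y, f k (g • y) = ∞ ↔ f k y = ∞) ∧
  (∀ k (g : SLR d) y,
    (g : Matrix (Fin (d + 1)) (Fin (d + 1)) ℝ) ∈ Matrix.specialOrthogonalGroup (Fin (d + 1)) ℝ →
      f k (g • y) = f k y) ∧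
  (∀ O ∈ 𝓝 (1 : SLR d), (∃ R : ℝ, ∀ g ∈ O, ∀ i j, |g i j| ≤ R) →
    ∃ C : ℝ, 1 ≤ C ∧ ∀ g ∈ O, ∀ y k,
      ENNReal.ofReal C⁻¹ * f k y ≤ f k (g • y) ∧ f k (g • y) ≤ ENNReal.ofReal C * f k y) ∧
  ∃ c : ℝ, 1 ≤ c ∧ ∀ k γ, γ₀ ≤ γ → γ ≤ β → ∃ T : ℝ, 0 < T ∧ ∀ y, ENNReal.ofReal T < f k y →
    ∫⁻ x in K, ENNReal.ofReal (F.cocycle K k x ^ (-γ)) *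
        f k ((gFlow d (F.cocycle K k x) * uElt x) • y) ∂μ
      ≤ ENNReal.ofReal c * f k y *
        ENNReal.ofReal ((∫ x in K, F.cocycle K k x ∂μ) ^ (β - γ))

end

/-!
The estimate is an averaged expansion statement for covolumes of primitive subgroups, combined with
the usual device of Eskin, Margulis and Mozes for passing from one subgroup to the supremum over all
of them.

*One subgroup.* Let `v` be a basis of a subgroup of rank `ℓ` and `V` its span. The covolume of
`g_t u(x) v` is at least a constant times `t ^ (-(d + 1 - ℓ) / (d + 1)) * ‖π_V (1, x)‖ * covol v`
(`covol_gFlow_uElt_ge`), where `π_V` is the orthogonal projection to `V`. The set of `x` for which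
`‖π_V (1, x)‖` is small lies near an affine subspace of dimension at most `d - ℓ`
(`exists_subset_thickening`), so negative moments of `‖π_V (1, x)‖` of any order below `α_ℓ(μ)` are
bounded uniformly in `V` (`SimilarityIFS.IsSelfSimilar.exists_lintegral_projection_le`). This needs
`α_ℓ(μ) > 0`, which follows from irreducibility: proper affine subspaces have measure zero, and
self-similarity turns this into a power bound for neighbourhoods
(`SimilarityIFS.IsSelfSimilar.decayExponent_pos`). As `ρ(x, k)` is not constant in `x`, Hölder's
inequality is used to separate it from the negative moment. The exponents `ϱ / β_ℓ` are such that
the powers of `ρ` combine to `ρ ^ (ϱ β - γ)` for every `ℓ`, and the restriction on `γ` is what keeps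
the required moment below `α_ℓ(μ)`
(`SimilarityIFS.IsSelfSimilar.exists_lintegral_covol_le`).

*All subgroups.* For fixed `k` the elements `g_{ρ(x, k)} u(x)` with `x` in the limit set are
uniformly bounded. Hence, if a primitive subgroup of rank `ℓ` has covolume much smaller than all
others of this rank, it alone determines `φ_ℓ` along the whole orbit piece. Otherwise there are two
distinct subgroups of comparable, almost minimal covolume, and submodularity of covolumes
(`IsPrimitiveBasis.exists_inf_sup`) bounds `φ_ℓ ^ 2` by `φ_{ℓ-i} * φ_{ℓ+i}` for some `i ≥ 1`
(`phi_dichotomy`). Because `β_{ℓ-i} + β_{ℓ+i} = 2 β_ℓ`, this bounds the `ℓ`-th term of the Margulis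
function by a weighted geometric mean of the terms of ranks `ℓ - i` and `ℓ + i`, times a positive
power of `ε`; for `ε` small in terms of `k` it is negligible against the whole function
(`margulisFun_term_le_of_phi_sq_le`).
-/

noncomputable section

/-! ### Volumes of parallelepipeds -/

section Covolume

open Matrix

variable {E : Type*} [NormedAddCommGroup E] [InnerProductSpace ℝ E]
variable {ι κ : Type*} [Fintype ι] [DecidableEq ι] [Fintype κ] [DecidableEq κ]

/-- The volume of the parallelepiped spanned by a finite family of vectors of a Euclidean space,
i.e. the square root of its Gram determinant. It is the norm of the wedge product of the family
(`norm_ιMulti`), and is defined for families indexed by an arbitrary finite type. -/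
def covol (v : ι → E) : ℝ := √ (gram ℝ v).det

theorem det_gram_nonneg (v : ι → E) : 0 ≤ (gram ℝ v).det :=
  (posSemidef_gram (𝕜 := ℝ) v).det_nonneg

theorem covol_nonneg (v : ι → E) : 0 ≤ covol v := Real.sqrt_nonneg _

theorem covol_sq (v : ι → E) : covol v ^ 2 = (gram ℝ v).det := Real.sq_sqrt (det_gram_nonneg v)

theorem norm_ιMulti [FiniteDimensional ℝ E] {n : ℕ} (v : Fin n → E) :
    ‖exteriorPower.ιMulti ℝ n v‖ = covol v := by
  rw [covol, ← exteriorPower.inner_ιMulti_self, real_inner_self_eq_norm_sq,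
    Real.sqrt_sq (norm_nonneg _)]

theorem covol_pos {v : ι → E} (hv : LinearIndependent ℝ v) : 0 < covol v :=
  Real.sqrt_pos.2 (lt_of_le_of_ne (det_gram_nonneg v)
    (det_gram_ne_zero_iff_linearIndependent.2 hv).symm)

theorem covol_comp_equiv (e : κ ≃ ι) (v : ι → E) : covol (v ∘ e) = covol v := by
  have : gram ℝ (v ∘ e) = (gram ℝ v).submatrix e e := by ext i j; simp [gram]
  rw [covol, this, det_submatrix_equiv_self, covol]

/-- Replacing a family by linear combinations of its members multiplies the volume by the
absolute value of the determinant. -/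
theorem covol_sum_smul (A : Matrix ι ι ℝ) (v : ι → E) :
    covol (fun i => ∑ j, A i j • v j) = |A.det| * covol v := by
  have : gram ℝ (fun i => ∑ j, A i j • v j) = A * gram ℝ v * Aᵀ := by
    ext i j
    simp only [gram_apply, mul_apply, transpose_apply, sum_inner, inner_sum,
      real_inner_smul_left, real_inner_smul_right, Finset.sum_mul]
    refine Finset.sum_congr rfl fun k _ => Finset.sum_congr rfl fun l _ => ?_
    rw [real_inner_comm]
    ring
  rw [covol, this, det_mul, det_mul, det_transpose,
    show A.det * (gram ℝ v).det * A.det = A.det ^ 2 * (gram ℝ v).det by ring,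
    Real.sqrt_mul (sq_nonneg _), Real.sqrt_sq_eq_abs, covol]

theorem covol_of_isEmpty [IsEmpty ι] (v : ι → E) : covol v = 1 := by
  simp [covol]

theorem covol_of_unique [Unique ι] (v : ι → E) : covol v = ‖v default‖ := by
  simp [covol, det_unique, gram_apply]

theorem covol_of_orthonormal {v : ι → E} (hv : Orthonormal ℝ v) : covol v = 1 := by
  simp [covol, gram_eq_one_iff_orthonormal.2 hv]

/-- If two families have the same span and the first is a basis of it, then every linear map
multiplies their volumes by the same factor. -/
theorem covol_map_mul_covol {E' : Type*} [NormedAddCommGroup E'] [InnerProductSpace ℝ E']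
    (T : E →ₗ[ℝ] E') {v w : ι → E} (h : ∀ i, v i ∈ Submodule.span ℝ (Set.range w)) :
    covol (T ∘ v) * covol w = covol (T ∘ w) * covol v := by
  choose A hA using fun i => (Submodule.mem_span_range_iff_exists_fun ℝ).1 (h i)
  have hv : v = fun i => ∑ j, A i j • w j := funext fun i => (hA i).symm
  have hTv : T ∘ v = fun i => ∑ j, A i j • (T ∘ w) j := by
    funext i; simp [hv]
  have h1 := covol_sum_smul (Matrix.of A) w
  have h2 := covol_sum_smul (Matrix.of A) (T ∘ w)
  simp only [of_apply] at h1 h2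
  rw [hTv, h2, hv, h1]; ring

variable [FiniteDimensional ℝ E]

/-- The volume of a concatenation is the volume of the first part times that of the projection of
the second part to the orthogonal complement of the first. -/
theorem covol_sumElim (u : ι → E) (w : κ → E) :
    covol (Sum.elim u w)
      = covol u * covol (fun j => (Submodule.span ℝ (Set.range u))ᗮ.starProjection (w j)) := by
  set V := Submodule.span ℝ (Set.range u) with hV
  have hp : ∀ j, V.starProjection (w j) ∈ Submodule.span ℝ (Set.range u) := fun j =>
    Submodule.starProjection_apply_mem _ _
  choose B hB using fun j => (Submodule.mem_span_range_iff_exists_fun ℝ).1 (hp j)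
  set z : κ → E := fun j => Vᗮ.starProjection (w j) with hz
  have h1 := covol_sum_smul (Matrix.fromBlocks 1 0 (Matrix.of B) 1) (Sum.elim u z)
  have h2 : (fun i => ∑ j, (Matrix.fromBlocks 1 0 (Matrix.of B) 1) i j • Sum.elim u z j)
      = Sum.elim u w := by
    funext i
    rcases i with i | j
    · simp [Fintype.sum_sum_type, Matrix.one_apply]
    · simp only [Fintype.sum_sum_type, fromBlocks_apply₂₁, of_apply, Sum.elim_inl,
        fromBlocks_apply₂₂, Sum.elim_inr, one_apply, ite_smul, one_smul, zero_smul,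
        Finset.sum_ite_eq, Finset.mem_univ, if_true, hB]
      exact Submodule.starProjection_add_starProjection_orthogonal (K := V) (w j)
  rw [h2, det_fromBlocks_zero₁₂] at h1
  have h3 : gram ℝ (Sum.elim u z) = fromBlocks (gram ℝ u) 0 0 (gram ℝ z) := by
    have hperp : ∀ i j, inner ℝ (u i) (z j) = 0 := fun i j =>
      (Submodule.mem_orthogonal _ _).1 (Submodule.starProjection_apply_mem Vᗮ (w j)) _
        (Submodule.subset_span ⟨i, rfl⟩)
    ext i j
    rcases i with i | i <;> rcases j with j | j
    · simp [gram_apply]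
    · simp [gram_apply, hperp]
    · simp [gram_apply, real_inner_comm, hperp]
    · simp [gram_apply]
  rw [h1, covol, h3, det_fromBlocks_zero₁₂, Real.sqrt_mul (det_gram_nonneg u)]
  simp [covol]

theorem covol_snoc {n : ℕ} (u : Fin n → E) (w : E) :
    covol (Fin.snoc u w : Fin (n + 1) → E)
      = covol u * ‖(Submodule.span ℝ (Set.range u))ᗮ.starProjection w‖ := by
  have h := covol_sumElim u (fun _ : Fin 1 => w)
  rw [covol_of_unique (ι := Fin 1)] at h
  rw [← h, ← covol_comp_equiv finSumFinEquiv]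
  congr 1
  funext i
  rcases i with i | i
  · simp [Fin.snoc]
  · fin_cases i
    simp [Fin.snoc]

/-- Distance to a subspace, as the norm of the projection to its orthogonal complement. -/
theorem norm_starProjection_orthogonal_le (V : Submodule ℝ E) (w : E) {y : E} (hy : y ∈ V) :
    ‖Vᗮ.starProjection w‖ ≤ ‖w - y‖ := by
  have : Vᗮ.starProjection w = Vᗮ.starProjection (w - y) := by
    rw [map_sub, (Submodule.starProjection_apply_eq_zero_iff _).2
      (Submodule.le_orthogonal_orthogonal V hy), sub_zero]
  rw [this]
  exact Submodule.norm_starProjection_apply_le _ _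

theorem covol_map_le {E' : Type*} [NormedAddCommGroup E'] [InnerProductSpace ℝ E']
    [FiniteDimensional ℝ E'] (T : E →ₗ[ℝ] E') {c : ℝ} (hc : 0 ≤ c) (hT : ∀ x, ‖T x‖ ≤ c * ‖x‖) :
    ∀ {n : ℕ} (v : Fin n → E), covol (T ∘ v) ≤ c ^ n * covol v := by
  intro n
  induction n with
  | zero => intro v; simp [covol_of_isEmpty]
  | succ n ih =>
    intro v
    obtain ⟨u, w, rfl⟩ : ∃ u w, v = (Fin.snoc u w : Fin (n + 1) → E) :=
      ⟨Fin.init v, v (Fin.last n), (Fin.snoc_init_self v).symm⟩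
    have h : T ∘ (Fin.snoc u w : Fin (n + 1) → E)
        = (Fin.snoc (T ∘ u) (T w) : Fin (n + 1) → E') := by
      funext i
      refine Fin.lastCases ?_ (fun i => ?_) i <;> simp
    rw [h, covol_snoc, covol_snoc]
    set V := Submodule.span ℝ (Set.range u)
    have h1 : ‖(Submodule.span ℝ (Set.range (T ∘ u)))ᗮ.starProjection (T w)‖
        ≤ c * ‖Vᗮ.starProjection w‖ := by
      have hmem : T (V.starProjection w) ∈ Submodule.span ℝ (Set.range (T ∘ u)) := by
        rw [Set.range_comp, ← Submodule.map_span]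
        exact Submodule.mem_map_of_mem (Submodule.starProjection_apply_mem _ _)
      refine (norm_starProjection_orthogonal_le _ _ hmem).trans ?_
      rw [← map_sub]
      refine (hT _).trans_eq ?_
      rw [Submodule.starProjection_orthogonal_val]
    calc _ ≤ (c ^ n * covol u) * (c * ‖Vᗮ.starProjection w‖) :=
          mul_le_mul (ih u) h1 (norm_nonneg _) (by have := covol_nonneg u; positivity)
      _ = _ := by ring

/-- The Hadamard–Fischer inequality for three families. -/
theorem covol_mul_covol_sumElim_le {l m n : ℕ} (u : Fin l → E) (v : Fin m → E) (w : Fin n → E) :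
    covol u * covol (Sum.elim (Sum.elim u v) w)
      ≤ covol (Sum.elim u v) * covol (Sum.elim u w) := by
  rw [covol_sumElim (Sum.elim u v) w, covol_sumElim u w]
  set V := Submodule.span ℝ (Set.range u)
  set W := Submodule.span ℝ (Set.range (Sum.elim u v))
  have hVW : V ≤ W := Submodule.span_mono (by
    rintro _ ⟨i, rfl⟩; exact ⟨Sum.inl i, rfl⟩)
  have h1 : (fun j => Wᗮ.starProjection (w j))
      = (Wᗮ.starProjection : E →ₗ[ℝ] E) ∘ fun j => Vᗮ.starProjection (w j) := by
    funext j
    have h2 := Submodule.starProjection_add_starProjection_orthogonal (K := V) (w j)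
    have h3 : Wᗮ.starProjection (V.starProjection (w j)) = 0 :=
      (Submodule.starProjection_apply_eq_zero_iff _).2
      (Submodule.le_orthogonal_orthogonal W (hVW (Submodule.starProjection_apply_mem _ _)))
    conv_lhs => rw [← h2, map_add, h3, zero_add]
    rfl
  have h4 := covol_map_le (Wᗮ.starProjection : E →ₗ[ℝ] E) zero_le_one
    (fun x => by simpa using Submodule.norm_starProjection_apply_le Wᗮ x)
    (fun j => Vᗮ.starProjection (w j))
  rw [← h1, one_pow, one_mul] at h4
  calc _ = (covol (Sum.elim u v) * covol u) * covol (fun j => Wᗮ.starProjection (w j)) := by ring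
    _ ≤ (covol (Sum.elim u v) * covol u) * covol (fun j => Vᗮ.starProjection (w j)) :=
        mul_le_mul_of_nonneg_left h4 (mul_nonneg (covol_nonneg _) (covol_nonneg _))
    _ = _ := by ring

end Covolume

/-! ### Lattices and the action of the special linear group -/

section Lattices

variable {d : ℕ}

/-- The linear action of `SL(d+1, ℝ)` on the Euclidean space `ℝ^(d+1)`. -/
def slAct (g : SLR d) : EuclideanSpace ℝ (Fin (d + 1)) →ₗ[ℝ] EuclideanSpace ℝ (Fin (d + 1)) :=
  Matrix.toEuclideanLin (g : Matrix (Fin (d + 1)) (Fin (d + 1)) ℝ)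

theorem slAct_apply (g : SLR d) (y : EuclideanSpace ℝ (Fin (d + 1))) :
    slAct g y = WithLp.toLp 2 ((g : Matrix (Fin (d + 1)) (Fin (d + 1)) ℝ).mulVec y.ofLp) := rfl

theorem slAct_mul (g h : SLR d) (y : EuclideanSpace ℝ (Fin (d + 1))) :
    slAct (g * h) y = slAct g (slAct h y) := by
  simp [slAct_apply, Matrix.mulVec_mulVec]

theorem slAct_one (y : EuclideanSpace ℝ (Fin (d + 1))) : slAct (1 : SLR d) y = y := by
  simp [slAct_apply]

theorem slAct_inv_slAct (g : SLR d) (y : EuclideanSpace ℝ (Fin (d + 1))) :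
    slAct g⁻¹ (slAct g y) = y := by
  rw [← slAct_mul, inv_mul_cancel, slAct_one]

theorem slAct_slAct_inv (g : SLR d) (y : EuclideanSpace ℝ (Fin (d + 1))) :
    slAct g (slAct g⁻¹ y) = y := by
  rw [← slAct_mul, mul_inv_cancel, slAct_one]

theorem slAct_injective (g : SLR d) : Function.Injective (slAct g) :=
  Function.LeftInverse.injective (slAct_inv_slAct g)

theorem linearIndependent_slAct_comp (g : SLR d) {ι : Type*}
    {v : ι → EuclideanSpace ℝ (Fin (d + 1))} (hv : LinearIndependent ℝ v) :
    LinearIndependent ℝ (slAct g ∘ v) :=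
  hv.map' _ (LinearMap.ker_eq_bot.2 (slAct_injective g))

theorem exists_norm_slAct_le (g : SLR d) : ∃ c : ℝ, 0 < c ∧ ∀ y, ‖slAct g y‖ ≤ c * ‖y‖ :=
  ⟨‖(slAct g).toContinuousLinearMap‖ + 1, by positivity, fun y =>
    ((slAct g).toContinuousLinearMap.le_opNorm y).trans (by
      gcongr; linarith)⟩

/-- The vector of `ℝ^(d+1)` with the given integer coordinates. -/
def intVec (z : Fin (d + 1) → ℤ) : EuclideanSpace ℝ (Fin (d + 1)) :=
  WithLp.toLp 2 fun i => (z i : ℝ)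

theorem latticeHom_eq_slAct (g : SLR d) (z : Fin (d + 1) → ℤ) :
    latticeHom g z = slAct g (intVec z) := rfl

theorem mem_latticeOf_mk {g : SLR d} {y : EuclideanSpace ℝ (Fin (d + 1))} :
    y ∈ latticeOf (QuotientGroup.mk g : LatticeSpace d) ↔ ∃ z, latticeHom g z = y := Iff.rfl

theorem mem_latticeOf_smul {h : SLR d} {x : LatticeSpace d} {y : EuclideanSpace ℝ (Fin (d + 1))} :
    slAct h y ∈ latticeOf (h • x) ↔ y ∈ latticeOf x := by
  induction x using QuotientGroup.induction_on with
  | H g =>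
    change slAct h y ∈ latticeOf (QuotientGroup.mk (h * g)) ↔ _
    rw [mem_latticeOf_mk, mem_latticeOf_mk]
    simp only [latticeHom_eq_slAct, slAct_mul, (slAct_injective h).eq_iff]

/-- Integer vectors that span a parallelepiped of positive volume span one of volume at least
one, since the square of the volume is an integer. -/
theorem one_le_covol_intVec {ι : Type*} [Fintype ι] [DecidableEq ι]
    {z : ι → Fin (d + 1) → ℤ} (hz : LinearIndependent ℝ (fun i => intVec (z i))) :
    1 ≤ covol (fun i => intVec (z i)) := by
  have h1 : Matrix.gram ℝ (fun i => intVec (z i))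
      = (Matrix.of z * (Matrix.of z).transpose).map (Int.castRingHom ℝ) := by
    ext i j
    simp [Matrix.gram_apply, intVec, Matrix.mul_apply, PiLp.inner_apply, mul_comm]
  have h2 := covol_pos hz
  have h3 := covol_sq (fun i => intVec (z i))
  rw [h1, ← RingHom.mapMatrix_apply, ← RingHom.map_det] at h3
  set D := (Matrix.of z * (Matrix.of z).transpose).det
  have h4 : (0 : ℝ) < (D : ℝ) := by
    have : (0 : ℝ) < covol (fun i => intVec (z i)) ^ 2 := by positivity
    simpa [h3] using this
  have h5 : (1 : ℝ) ≤ (D : ℝ) := by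
    have : (1 : ℤ) ≤ D := by exact_mod_cast h4
    exact_mod_cast this
  have h6 : (D : ℝ) = covol (fun i => intVec (z i)) ^ 2 := by rw [h3]; rfl
  nlinarith

/-- If one linearly independent family consists of integer combinations of another, its volume is
at least as large. -/
theorem covol_le_of_mem_closure {E : Type*} [NormedAddCommGroup E] [InnerProductSpace ℝ E]
    {ι κ : Type*} [Fintype ι] [DecidableEq ι] [Fintype κ] [DecidableEq κ] (e : ι ≃ κ)
    {u : κ → E} {v : ι → E} (hv : LinearIndependent ℝ v)
    (h : ∀ i, v i ∈ AddSubgroup.closure (Set.range u)) : covol u ≤ covol v := by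
  have h' : ∀ i, ∃ c : ι → ℤ, ∑ j, c j • (u ∘ e) j = v i := by
    intro i
    have := h i
    rw [← e.surjective.range_comp u, ← Submodule.span_int_eq_addSubgroupClosure,
      Submodule.mem_toAddSubgroup] at this
    exact (Submodule.mem_span_range_iff_exists_fun ℤ).1 this
  choose A hA using h'
  have h1 := covol_sum_smul ((Matrix.of A).map (Int.castRingHom ℝ)) (u ∘ e)
  have h2 : (fun i => ∑ j, ((Matrix.of A).map (Int.castRingHom ℝ)) i j • (u ∘ e) j) = v := by
    funext i
    rw [← hA i]
    refine Finset.sum_congr rfl fun j _ => ?_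
    simp [Int.cast_smul_eq_zsmul]
  rw [h2, covol_comp_equiv, ← RingHom.mapMatrix_apply, ← RingHom.map_det] at h1
  have h3 := covol_pos hv
  have h4 : (Matrix.of A).det ≠ 0 := by
    intro h0; rw [h1, h0] at h3; simp at h3
  have h5 : (1 : ℝ) ≤ |(Int.castRingHom ℝ) (Matrix.of A).det| := by
    have := Int.one_le_abs h4
    simpa using (by exact_mod_cast this : (1 : ℝ) ≤ |((Matrix.of A).det : ℝ)|)
  rw [h1]
  exact le_mul_of_one_le_left (covol_nonneg u) h5

/-- Vectors of a lattice that are independent over `ℤ` are independent over `ℝ`. -/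
theorem linearIndependent_real_of_int {x : LatticeSpace d} {ι : Type*}
    {v : ι → EuclideanSpace ℝ (Fin (d + 1))} (hmem : ∀ i, v i ∈ latticeOf x)
    (hv : LinearIndependent ℤ v) : LinearIndependent ℝ v := by
  induction x using QuotientGroup.induction_on with
  | H g =>
    choose z hz using fun i => mem_latticeOf_mk.1 (hmem i)
    have h1 : LinearIndependent ℤ z := by
      apply LinearIndependent.of_comp (latticeHom g).toIntLinearMap
      convert hv using 1
      funext i; exact hz i
    have h2 := (linearIndependent_algebraMap_comp_iff (R := ℤ) (S := ℝ)).2 h1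
    have h3 := (h2.map' (WithLp.linearEquiv 2 ℝ (Fin (d + 1) → ℝ)).symm.toLinearMap
      (LinearEquiv.ker _))
    have h4 := linearIndependent_slAct_comp g h3
    convert h4 using 1
    funext i; exact (hz i).symm

theorem exists_pos_le_covol (x : LatticeSpace d) (ℓ : ℕ) : ∃ c : ℝ, 0 < c ∧
    ∀ v : Fin ℓ → EuclideanSpace ℝ (Fin (d + 1)), LinearIndependent ℝ v →
      (∀ i, v i ∈ latticeOf x) → c ≤ covol v := by
  induction x using QuotientGroup.induction_on with
  | H g =>
    obtain ⟨c, hc, hbd⟩ := exists_norm_slAct_le g⁻¹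
    refine ⟨(c ^ ℓ)⁻¹, by positivity, fun v hv hmem => ?_⟩
    choose z hz using fun i => mem_latticeOf_mk.1 (hmem i)
    have h1 : slAct g⁻¹ ∘ v = fun i => intVec (z i) := by
      funext i
      rw [Function.comp, ← hz i, latticeHom_eq_slAct, slAct_inv_slAct]
    have h2 := covol_map_le (slAct g⁻¹) hc.le hbd v
    have h3 := one_le_covol_intVec (z := z) (h1 ▸ linearIndependent_slAct_comp g⁻¹ hv)
    rw [h1] at h2
    rw [inv_le_iff_one_le_mul₀' (by positivity)]
    exact h3.trans h2

/-- Full-rank families of vectors of a unimodular lattice have volume at least one. -/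
theorem one_le_covol_of_full_rank {x : LatticeSpace d}
    {v : Fin (d + 1) → EuclideanSpace ℝ (Fin (d + 1))} (hv : LinearIndependent ℝ v)
    (hmem : ∀ i, v i ∈ latticeOf x) : 1 ≤ covol v := by
  induction x using QuotientGroup.induction_on with
  | H g =>
    set e := fun i : Fin (d + 1) => EuclideanSpace.single i (1 : ℝ) with he
    have h0 : covol (slAct g ∘ e) = 1 := by
      have h1 := covol_sum_smul (g : Matrix (Fin (d + 1)) (Fin (d + 1)) ℝ).transpose e
      have h2 : (fun i => ∑ j, (g : Matrix (Fin (d + 1)) (Fin (d + 1)) ℝ).transpose i j • e j)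
          = slAct g ∘ e := by
        funext i
        ext k
        simp [he, slAct_apply, Finset.sum_apply, Pi.single_apply]
      rw [h2, Matrix.det_transpose, g.det_coe, covol_of_orthonormal
        (EuclideanSpace.orthonormal_single (𝕜 := ℝ) (ι := Fin (d + 1)))] at h1
      simpa using h1
    rw [← h0]
    refine covol_le_of_mem_closure (Equiv.refl _) hv fun i => ?_
    obtain ⟨z, hz⟩ := mem_latticeOf_mk.1 (hmem i)
    have h3 : v i = ∑ j, z j • (slAct g ∘ e) j := by
      rw [← hz, latticeHom_eq_slAct]
      have : intVec z = ∑ j, z j • e j := by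
        ext k; simp [he, intVec, Finset.sum_apply, Pi.single_apply]
      rw [this, map_sum]
      refine Finset.sum_congr rfl fun j _ => ?_
      rw [map_zsmul]; rfl
    rw [h3]
    exact AddSubgroup.sum_mem _ fun j _ => AddSubgroup.zsmul_mem _
      (AddSubgroup.subset_closure (Set.mem_range_self j)) _

end Lattices

/-! ### Primitive subgroups and the function `phi` -/

section Lattices

variable {d : ℕ}

theorem closure_range_eq_span_int {E : Type*} [AddCommGroup E] {ι : Type*} (v : ι → E) :
    (AddSubgroup.closure (Set.range v) : Set E) = Submodule.span ℤ (Set.range v) := by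
  rw [← Submodule.span_int_eq_addSubgroupClosure]; rfl

theorem span_real_closure {E : Type*} [AddCommGroup E] [Module ℝ E] (s : Set E) :
    Submodule.span ℝ (AddSubgroup.closure s : Set E) = Submodule.span ℝ s := by
  refine le_antisymm (Submodule.span_le.2 ?_) (Submodule.span_mono AddSubgroup.subset_closure)
  exact (AddSubgroup.closure_le (K := (Submodule.span ℝ s).toAddSubgroup)).2 Submodule.subset_span

/-- Adapted lattice bases: for subspaces `A ≤ B`, the group `Δ ∩ A` has a basis that can be
completed to a basis of `Δ ∩ B`, because the quotient is torsion free. -/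
theorem exists_adapted_basis (x : LatticeSpace d)
    {A B : Submodule ℝ (EuclideanSpace ℝ (Fin (d + 1)))} (hAB : A ≤ B) :
    ∃ (m n : ℕ) (u : Fin m → EuclideanSpace ℝ (Fin (d + 1)))
      (v : Fin n → EuclideanSpace ℝ (Fin (d + 1))),
      LinearIndependent ℝ (Sum.elim u v) ∧
      (Submodule.span ℤ (Set.range u) : Set (EuclideanSpace ℝ (Fin (d + 1))))
        = (latticeOf x : Set (EuclideanSpace ℝ (Fin (d + 1)))) ∩ A ∧
      (Submodule.span ℤ (Set.range (Sum.elim u v)) : Set (EuclideanSpace ℝ (Fin (d + 1))))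
        = (latticeOf x : Set (EuclideanSpace ℝ (Fin (d + 1)))) ∩ B := by
  induction x using QuotientGroup.induction_on with
  | H g =>
    set φ : (Fin (d + 1) → ℤ) →ₗ[ℤ] EuclideanSpace ℝ (Fin (d + 1)) :=
      (latticeHom g).toIntLinearMap with hφ
    have hφinj : Function.Injective φ := by
      intro z z' h
      have h1 : slAct g (intVec z) = slAct g (intVec z') := h
      have h2 := slAct_injective g h1
      funext i
      have := congrArg (fun y : EuclideanSpace ℝ (Fin (d + 1)) => y i) h2
      simpa [intVec] using this
    set NB : Submodule ℤ (Fin (d + 1) → ℤ) := (B.restrictScalars ℤ).comap φ with hNB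
    set NA : Submodule ℤ (Fin (d + 1) → ℤ) := (A.restrictScalars ℤ).comap φ with hNA
    set NA' : Submodule ℤ NB := NA.comap NB.subtype with hNA'
    have htf : Module.IsTorsionFree ℤ (NB ⧸ NA') := by
      refine Module.IsTorsionFree.of_smul_eq_zero fun n q hq => ?_
      induction q using Submodule.Quotient.induction_on with
      | H b =>
        rw [← Submodule.Quotient.mk_smul, Submodule.Quotient.mk_eq_zero] at hq
        rw [Submodule.Quotient.mk_eq_zero]
        by_cases hn : n = 0
        · exact Or.inl hn
        right
        have h1 : φ ((n • b : NB) : Fin (d + 1) → ℤ) ∈ A := hq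
        have h2 : (n : ℝ) • φ (b : Fin (d + 1) → ℤ) ∈ A := by
          rw [Int.cast_smul_eq_zsmul, ← map_zsmul]
          exact h1
        have h3 := (A.smul_mem_iff (by exact_mod_cast hn : (n : ℝ) ≠ 0)).1 h2
        exact h3
    have hfree : Module.Free ℤ (NB ⧸ NA') := inferInstance
    let bA := Module.finBasis ℤ NA'
    let bQ := Module.finBasis ℤ (NB ⧸ NA')
    let b := bA.sumQuot bQ
    set w : _ → EuclideanSpace ℝ (Fin (d + 1)) := fun i => φ (b i : NB) with hw
    have hwli : LinearIndependent ℤ w := by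
      have := b.linearIndependent.map' (φ ∘ₗ NB.subtype)
        (LinearMap.ker_eq_bot.2 (hφinj.comp Subtype.val_injective))
      exact this
    have hmem : ∀ i, w i ∈ latticeOf (QuotientGroup.mk g : LatticeSpace d) := fun i =>
      mem_latticeOf_mk.2 ⟨_, rfl⟩
    have hsum : Sum.elim (w ∘ Sum.inl) (w ∘ Sum.inr) = w := Sum.elim_comp_inl_inr w
    refine ⟨_, _, w ∘ Sum.inl, w ∘ Sum.inr, ?_, ?_, ?_⟩
    · rw [hsum]; exact linearIndependent_real_of_int hmem hwli
    · have h1 : w ∘ Sum.inl = (φ ∘ₗ NB.subtype ∘ₗ NA'.subtype) ∘ bA := by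
        funext i; simp [hw, b]
      rw [h1, Set.range_comp, ← Submodule.map_span, bA.span_eq]
      ext y
      simp only [Submodule.map_top, SetLike.mem_coe, LinearMap.mem_range, Set.mem_inter_iff]
      constructor
      · rintro ⟨z, rfl⟩
        exact ⟨mem_latticeOf_mk.2 ⟨_, rfl⟩, z.2⟩
      · rintro ⟨hy, hyA⟩
        obtain ⟨z, rfl⟩ := mem_latticeOf_mk.1 hy
        exact ⟨⟨⟨z, hAB hyA⟩, hyA⟩, rfl⟩
    · rw [hsum]
      have h1 : w = (φ ∘ₗ NB.subtype) ∘ b := rfl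
      rw [h1, Set.range_comp, ← Submodule.map_span, b.span_eq]
      ext y
      simp only [Submodule.map_top, SetLike.mem_coe, LinearMap.mem_range, Set.mem_inter_iff]
      constructor
      · rintro ⟨z, rfl⟩
        exact ⟨mem_latticeOf_mk.2 ⟨_, rfl⟩, z.2⟩
      · rintro ⟨hy, hyB⟩
        obtain ⟨z, rfl⟩ := mem_latticeOf_mk.1 hy
        exact ⟨⟨z, hyB⟩, rfl⟩

/-- `v` is a basis of a primitive subgroup of the lattice `x`. -/
def IsPrimitiveBasis (x : LatticeSpace d) {ℓ : ℕ}
    (v : Fin ℓ → EuclideanSpace ℝ (Fin (d + 1))) : Prop :=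
  LinearIndependent ℝ v ∧ IsPrimitiveSubgroup (latticeOf x) (AddSubgroup.closure (Set.range v))

theorem isPrimitiveBasis_iff {x : LatticeSpace d} {ℓ : ℕ}
    {v : Fin ℓ → EuclideanSpace ℝ (Fin (d + 1))} :
    IsPrimitiveBasis x v ↔ LinearIndependent ℝ v ∧
      (Submodule.span ℤ (Set.range v) : Set (EuclideanSpace ℝ (Fin (d + 1))))
        = (latticeOf x : Set (EuclideanSpace ℝ (Fin (d + 1))))
          ∩ Submodule.span ℝ (Set.range v) := by
  rw [IsPrimitiveBasis, IsPrimitiveSubgroup, span_real_closure, closure_range_eq_span_int]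

theorem IsPrimitiveBasis.mem {x : LatticeSpace d} {ℓ : ℕ}
    {v : Fin ℓ → EuclideanSpace ℝ (Fin (d + 1))} (h : IsPrimitiveBasis x v) (i : Fin ℓ) :
    v i ∈ latticeOf x := by
  have h1 : v i ∈ (Submodule.span ℤ (Set.range v) : Set (EuclideanSpace ℝ (Fin (d + 1)))) :=
    Submodule.subset_span ⟨i, rfl⟩
  rw [(isPrimitiveBasis_iff.1 h).2] at h1
  exact h1.1

theorem IsPrimitiveBasis.of_slAct {x : LatticeSpace d} {h : SLR d} {ℓ : ℕ}
    {v : Fin ℓ → EuclideanSpace ℝ (Fin (d + 1))} (hv : IsPrimitiveBasis (h • x) v) :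
    IsPrimitiveBasis x (slAct h⁻¹ ∘ v) := by
  rw [isPrimitiveBasis_iff] at hv ⊢
  refine ⟨linearIndependent_slAct_comp _ hv.1, ?_⟩
  have key : ∀ y, (slAct h y ∈ (Submodule.span ℤ (Set.range v) : Set _) ↔
      y ∈ (Submodule.span ℤ (Set.range (slAct h⁻¹ ∘ v)) : Set _)) ∧
      (slAct h y ∈ (Submodule.span ℝ (Set.range v)) ↔
      y ∈ (Submodule.span ℝ (Set.range (slAct h⁻¹ ∘ v)))) := by
    intro y
    constructor
    · have : Submodule.span ℤ (Set.range (slAct h⁻¹ ∘ v))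
          = (Submodule.span ℤ (Set.range v)).map ((slAct h⁻¹).restrictScalars ℤ) := by
        rw [Submodule.map_span, Set.range_comp]; rfl
      rw [this]
      constructor
      · intro hy
        exact ⟨_, hy, slAct_inv_slAct h y⟩
      · rintro ⟨z, hz, rfl⟩
        simpa [slAct_slAct_inv] using hz
    · rw [Set.range_comp, ← Submodule.map_span]
      constructor
      · intro hy
        exact ⟨_, hy, slAct_inv_slAct h y⟩
      · rintro ⟨z, hz, rfl⟩
        simpa [slAct_slAct_inv] using hz
  ext y
  rw [← (key y).1, hv.2, Set.mem_inter_iff, Set.mem_inter_iff, SetLike.mem_coe, SetLike.mem_coe,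
    mem_latticeOf_smul, SetLike.mem_coe, SetLike.mem_coe, (key y).2]

theorem phi_eq (ℓ : ℕ) (x : LatticeSpace d) :
    phi ℓ x = sSup {r : ℝ | ∃ v : Fin ℓ → EuclideanSpace ℝ (Fin (d + 1)),
      IsPrimitiveBasis x v ∧ r = (covol v)⁻¹} := by
  simp only [phi, IsPrimitiveBasis, norm_ιMulti, and_assoc]

theorem phi_nonneg (ℓ : ℕ) (x : LatticeSpace d) : 0 ≤ phi ℓ x := by
  rw [phi_eq]
  refine Real.sSup_nonneg ?_
  rintro _ ⟨v, -, rfl⟩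
  exact inv_nonneg.2 (covol_nonneg v)

theorem phi_le {ℓ : ℕ} {x : LatticeSpace d} {B : ℝ} (hB : 0 ≤ B)
    (h : ∀ v : Fin ℓ → EuclideanSpace ℝ (Fin (d + 1)), IsPrimitiveBasis x v → (covol v)⁻¹ ≤ B) :
    phi ℓ x ≤ B := by
  rw [phi_eq]
  refine Real.sSup_le ?_ hB
  rintro _ ⟨v, hv, rfl⟩
  exact h v hv

/-- Independent families in the lattice, even when they do not generate primitive subgroups, are
controlled by `phi`: saturating the subgroup decreases the volume. -/
theorem inv_covol_le_phi {ℓ : ℕ} {x : LatticeSpace d}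
    {v : Fin ℓ → EuclideanSpace ℝ (Fin (d + 1))} (hv : LinearIndependent ℝ v)
    (hmem : ∀ i, v i ∈ latticeOf x) : (covol v)⁻¹ ≤ phi ℓ x := by
  set V := Submodule.span ℝ (Set.range v) with hV
  obtain ⟨m, n, u, w, hli, hu, -⟩ := exists_adapted_basis x (le_refl V)
  have hui : LinearIndependent ℝ u := hli.comp Sum.inl Sum.inl_injective
  have hvu : ∀ i, v i ∈ (Submodule.span ℤ (Set.range u) : Set _) := fun i => by
    rw [hu]; exact ⟨hmem i, Submodule.subset_span ⟨i, rfl⟩⟩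
  have hspan : Submodule.span ℝ (Set.range u) = V := by
    apply le_antisymm
    · refine Submodule.span_le.2 fun y hy => ?_
      have : y ∈ (Submodule.span ℤ (Set.range u) : Set _) := Submodule.subset_span hy
      rw [hu] at this
      exact this.2
    · refine Submodule.span_le.2 ?_
      rintro _ ⟨i, rfl⟩
      exact Submodule.span_subset_span ℤ ℝ _ (hvu i)
  have hmℓ : m = ℓ := by
    have h1 := finrank_span_eq_card hui
    rw [hspan, finrank_span_eq_card hv] at h1
    simpa using h1.symm
  subst hmℓ
  have hprim : IsPrimitiveBasis x u := isPrimitiveBasis_iff.2 ⟨hui, by rw [hu, hspan]⟩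
  have h2 : covol u ≤ covol v := covol_le_of_mem_closure (Equiv.refl _) hv fun i => by
    rw [← SetLike.mem_coe, closure_range_eq_span_int]; exact hvu i
  refine (inv_anti₀ (covol_pos hui) h2).trans ?_
  rw [phi_eq]
  obtain ⟨c, hc, hbd⟩ := exists_pos_le_covol x m
  refine le_csSup ⟨c⁻¹, ?_⟩ ⟨u, hprim, rfl⟩
  rintro _ ⟨v', hv', rfl⟩
  exact inv_anti₀ hc (hbd v' hv'.1 hv'.mem)

theorem phi_smul_le (ℓ : ℕ) (x : LatticeSpace d) {h : SLR d} {c : ℝ} (hc : 0 ≤ c)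
    (hbd : ∀ y, ‖slAct h⁻¹ y‖ ≤ c * ‖y‖) : phi ℓ (h • x) ≤ c ^ ℓ * phi ℓ x := by
  refine phi_le (mul_nonneg (pow_nonneg hc _) (phi_nonneg _ _)) fun v hv => ?_
  have hv' := hv.of_slAct
  have h1 := covol_map_le (slAct h⁻¹) hc hbd v
  have h2 := inv_covol_le_phi hv'.1 hv'.mem
  have h3 := covol_pos hv.1
  have h4 := covol_pos hv'.1
  calc (covol v)⁻¹ ≤ c ^ ℓ * (covol (slAct h⁻¹ ∘ v))⁻¹ := by
        rw [← div_eq_mul_inv, le_div_iff₀ h4, inv_mul_le_iff₀ h3, mul_comm]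
        exact h1
    _ ≤ _ := mul_le_mul_of_nonneg_left h2 (pow_nonneg hc _)

end Lattices

/-! ### Submodularity of covolumes -/

section Submodularity

variable {d : ℕ}

/-- A given basis `u` of `Δ ∩ A` can be completed to a basis of a primitive subgroup whose span
contains `A`, without changing the volume. -/
theorem IsPrimitiveBasis.exists_completion {x : LatticeSpace d} {ℓ m : ℕ}
    {v : Fin ℓ → EuclideanSpace ℝ (Fin (d + 1))} (hv : IsPrimitiveBasis x v)
    {A : Submodule ℝ (EuclideanSpace ℝ (Fin (d + 1)))}
    (hA : A ≤ Submodule.span ℝ (Set.range v)) {u : Fin m → EuclideanSpace ℝ (Fin (d + 1))}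
    (hui : LinearIndependent ℝ u)
    (hu : (Submodule.span ℤ (Set.range u) : Set (EuclideanSpace ℝ (Fin (d + 1))))
        = (latticeOf x : Set (EuclideanSpace ℝ (Fin (d + 1)))) ∩ A) :
    m ≤ ℓ ∧ ∃ w : Fin (ℓ - m) → EuclideanSpace ℝ (Fin (d + 1)),
      LinearIndependent ℝ (Sum.elim u w) ∧
      Submodule.span ℤ (Set.range (Sum.elim u w)) = Submodule.span ℤ (Set.range v) ∧
      covol (Sum.elim u w) ≤ covol v := by
  obtain ⟨m', n, u', w, hli, hu', huw'⟩ := exists_adapted_basis x hA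
  have huu : Submodule.span ℤ (Set.range u) = Submodule.span ℤ (Set.range u') :=
    SetLike.coe_injective (hu.trans hu'.symm)
  have huuR : Submodule.span ℝ (Set.range u) = Submodule.span ℝ (Set.range u') := by
    rw [← Submodule.span_span_of_tower ℤ ℝ (Set.range u), huu, Submodule.span_span_of_tower]
  obtain ⟨hl, hr, hdis⟩ := linearIndependent_sum.1 hli
  have hli2 : LinearIndependent ℝ (Sum.elim u w) := by
    rw [linearIndependent_sum]
    refine ⟨hui, hr, ?_⟩
    simp only [Sum.elim_comp_inl, Sum.elim_comp_inr] at hdis ⊢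
    rwa [huuR]
  have hsp : Submodule.span ℤ (Set.range (Sum.elim u w)) = Submodule.span ℤ (Set.range v) := by
    have h1 : Submodule.span ℤ (Set.range (Sum.elim u w))
        = Submodule.span ℤ (Set.range (Sum.elim u' w)) := by
      rw [Set.Sum.elim_range, Set.Sum.elim_range, Submodule.span_union, Submodule.span_union, huu]
    rw [h1]
    exact SetLike.coe_injective (huw'.trans (isPrimitiveBasis_iff.1 hv).2.symm)
  have hspR : Submodule.span ℝ (Set.range (Sum.elim u w)) = Submodule.span ℝ (Set.range v) := by
    rw [← Submodule.span_span_of_tower ℤ ℝ (Set.range (Sum.elim u w)), hsp,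
      Submodule.span_span_of_tower]
  have hcard : m + n = ℓ := by
    have h1 := finrank_span_eq_card hli2
    rw [hspR, finrank_span_eq_card hv.1] at h1
    simpa using h1.symm
  obtain rfl : n = ℓ - m := by omega
  refine ⟨by omega, w, hli2, hsp, ?_⟩
  refine covol_le_of_mem_closure ((finCongr hcard.symm).trans finSumFinEquiv.symm) hv.1 fun i => ?_
  rw [← SetLike.mem_coe, closure_range_eq_span_int, hsp]
  exact Submodule.subset_span ⟨i, rfl⟩

/-- Submodularity of covolumes: two distinct primitive subgroups of rank `ℓ` give rise, through
their intersection and their sum, to families of ranks `ℓ - i` and `ℓ + i` in the lattice with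
`i ≥ 1`, whose volumes have a product at most that of the original ones. -/
theorem IsPrimitiveBasis.exists_inf_sup {x : LatticeSpace d} {ℓ : ℕ}
    {v w : Fin ℓ → EuclideanSpace ℝ (Fin (d + 1))} (hv : IsPrimitiveBasis x v)
    (hw : IsPrimitiveBasis x w)
    (hne : Submodule.span ℤ (Set.range v) ≠ Submodule.span ℤ (Set.range w)) :
    ∃ i, 1 ≤ i ∧ i ≤ ℓ ∧ ℓ + i ≤ d + 1 ∧
      ∃ (a : Fin (ℓ - i) → EuclideanSpace ℝ (Fin (d + 1)))
        (b : Fin (ℓ + i) → EuclideanSpace ℝ (Fin (d + 1))),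
        LinearIndependent ℝ a ∧ LinearIndependent ℝ b ∧ (∀ j, a j ∈ latticeOf x) ∧
        (∀ j, b j ∈ latticeOf x) ∧ covol a * covol b ≤ covol v * covol w := by
  set V := Submodule.span ℝ (Set.range v)
  set W := Submodule.span ℝ (Set.range w)
  obtain ⟨m, _, u, _, hli0, hu, -⟩ := exists_adapted_basis x (le_refl (V ⊓ W))
  have hui : LinearIndependent ℝ u := hli0.comp Sum.inl Sum.inl_injective
  obtain ⟨hm, v', hv'i, hv's, hv'c⟩ := hv.exists_completion inf_le_left hui hu
  obtain ⟨-, w', hw'i, hw's, hw'c⟩ := hw.exists_completion inf_le_right hui hu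
  have hmℓ : m < ℓ := by
    refine lt_of_le_of_ne hm fun h => hne ?_
    subst h
    have : IsEmpty (Fin (m - m)) := by rw [Nat.sub_self]; infer_instance
    rw [← hv's, ← hw's, Set.Sum.elim_range, Set.Sum.elim_range, Set.range_eq_empty v',
      Set.range_eq_empty w']
  have hVmem : ∀ y ∈ Submodule.span ℤ (Set.range v), y ∈ latticeOf x ∧ y ∈ V := fun y hy => by
    have : y ∈ (Submodule.span ℤ (Set.range v) : Set _) := hy
    rwa [(isPrimitiveBasis_iff.1 hv).2] at this
  have hWmem : ∀ y ∈ Submodule.span ℤ (Set.range w), y ∈ latticeOf x ∧ y ∈ W := fun y hy => by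
    have : y ∈ (Submodule.span ℤ (Set.range w) : Set _) := hy
    rwa [(isPrimitiveBasis_iff.1 hw).2] at this
  have humem : ∀ j, u j ∈ latticeOf x := fun j => by
    have : u j ∈ (Submodule.span ℤ (Set.range u) : Set _) := Submodule.subset_span ⟨j, rfl⟩
    rw [hu] at this
    exact this.1
  have hv'mem : ∀ j, v' j ∈ latticeOf x := fun j =>
    (hVmem _ (hv's ▸ Submodule.subset_span ⟨Sum.inr j, rfl⟩)).1
  have hw'mem : ∀ j, w' j ∈ latticeOf x := fun j =>
    (hWmem _ (hw's ▸ Submodule.subset_span ⟨Sum.inr j, rfl⟩)).1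
  have hbi : LinearIndependent ℝ (Sum.elim (Sum.elim u v') w') := by
    refine linearIndependent_real_of_int (x := x) ?_ ?_
    · rintro ((j | j) | j)
      exacts [humem j, hv'mem j, hw'mem j]
    · rw [linearIndependent_sum]
      simp only [Sum.elim_comp_inl, Sum.elim_comp_inr]
      have hwZ := hw'i.restrict_scalars' ℤ
      obtain ⟨h1, h2, h3⟩ := linearIndependent_sum.1 hwZ
      simp only [Sum.elim_comp_inl, Sum.elim_comp_inr] at h1 h2 h3
      refine ⟨hv'i.restrict_scalars' ℤ, h2, ?_⟩
      rw [Submodule.disjoint_def] at h3 ⊢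
      intro y hy1 hy2
      refine h3 y ?_ hy2
      rw [hv's] at hy1
      have hyW := hWmem y (by
        rw [← hw's, Set.Sum.elim_range, Submodule.span_union]
        exact Submodule.mem_sup_right hy2)
      have : y ∈ (latticeOf x : Set (EuclideanSpace ℝ (Fin (d + 1)))) ∩ (V ⊓ W : Submodule ℝ _) :=
        ⟨hyW.1, (hVmem y hy1).2, hyW.2⟩
      rw [← hu] at this
      exact this
  have hcard : ℓ + (ℓ - m) ≤ d + 1 := by
    have := hbi.fintype_card_le_finrank
    simp at this
    omega
  obtain ⟨e1⟩ : Nonempty (Fin (ℓ - (ℓ - m)) ≃ Fin m) := ⟨finCongr (by omega)⟩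
  obtain ⟨e2⟩ : Nonempty (Fin (ℓ + (ℓ - m)) ≃ (Fin m ⊕ Fin (ℓ - m)) ⊕ Fin (ℓ - m)) :=
    ⟨Fintype.equivOfCardEq (by simp; omega)⟩
  refine ⟨ℓ - m, by omega, by omega, hcard, u ∘ e1, Sum.elim (Sum.elim u v') w' ∘ e2,
    hui.comp _ e1.injective, hbi.comp _ e2.injective, fun j => humem _, fun j => ?_, ?_⟩
  · simp only [Function.comp]
    rcases e2 j with (j | j) | j
    exacts [humem j, hv'mem j, hw'mem j]
  · rw [covol_comp_equiv, covol_comp_equiv]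
    exact (covol_mul_covol_sumElim_le u v' w').trans
      (mul_le_mul hv'c hw'c (covol_nonneg _) (covol_nonneg _))

end Submodularity

/-! ### Self-similar measures of affine subspaces and slabs -/

namespace SimilarityIFS

variable {d : ℕ} {Λ : Type*}

/-- The rotation part of `h_i` as a linear isometry. -/
def rotIso (F : SimilarityIFS d Λ) (i : Λ) :
    EuclideanSpace ℝ (Fin d) ≃ₗᵢ[ℝ] EuclideanSpace ℝ (Fin d) :=
  LinearIsometry.toLinearIsometryEquiv
    ⟨Matrix.toEuclideanLin (F.rot i : Matrix (Fin d) (Fin d) ℝ), fun x => by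
      have h1 : (F.rot i : Matrix (Fin d) (Fin d) ℝ).transpose
          * (F.rot i : Matrix (Fin d) (Fin d) ℝ) = 1 :=
        (Matrix.mem_orthogonalGroup_iff' (Fin d) ℝ).1
          (Matrix.mem_specialOrthogonalGroup_iff.1 (F.rot i).2).1
      have h2 : inner ℝ (Matrix.toEuclideanLin (F.rot i : Matrix (Fin d) (Fin d) ℝ) x)
          (Matrix.toEuclideanLin (F.rot i : Matrix (Fin d) (Fin d) ℝ) x) = inner ℝ x x := by
        simp only [Matrix.toLpLin_apply, EuclideanSpace.inner_eq_star_dotProduct,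
          star_trivial]
        rw [Matrix.dotProduct_mulVec, Matrix.vecMul_mulVec, h1, Matrix.vecMul_one]
      rw [real_inner_self_eq_norm_sq, real_inner_self_eq_norm_sq] at h2
      exact (sq_eq_sq₀ (norm_nonneg _) (norm_nonneg _)).1 h2⟩ rfl

theorem sim_eq (F : SimilarityIFS d Λ) (i : Λ) (x : EuclideanSpace ℝ (Fin d)) :
    F.sim i x = F.ratio i • F.rotIso i x + F.trans i := rfl

/-- The similarity `h_i` as an affine equivalence. -/
def simAffine (F : SimilarityIFS d Λ) (i : Λ) :
    EuclideanSpace ℝ (Fin d) ≃ᵃ[ℝ] EuclideanSpace ℝ (Fin d) :=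
  (((F.rotIso i).toLinearEquiv.trans
    (LinearEquiv.smulOfNeZero ℝ _ (F.ratio i) (F.ratio_pos i).ne')).toAffineEquiv).trans
    (AffineEquiv.constVAdd ℝ _ (F.trans i))

theorem coe_simAffine (F : SimilarityIFS d Λ) (i : Λ) : ⇑(F.simAffine i) = F.sim i := by
  funext x
  rw [sim_eq, add_comm]
  rfl

theorem dist_sim (F : SimilarityIFS d Λ) (i : Λ) (x y : EuclideanSpace ℝ (Fin d)) :
    dist (F.sim i x) (F.sim i y) = F.ratio i * dist x y := by
  rw [sim_eq, sim_eq, dist_add_right, dist_smul₀, LinearIsometryEquiv.dist_map, Real.norm_eq_abs,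
    abs_of_pos (F.ratio_pos i)]

theorem continuous_sim (F : SimilarityIFS d Λ) (i : Λ) : Continuous (F.sim i) :=
  ((F.rotIso i).continuous.const_smul (F.ratio i)).add (continuous_const (y := F.trans i))

theorem inner_sim (F : SimilarityIFS d Λ) (i : Λ) (n x : EuclideanSpace ℝ (Fin d)) :
    inner ℝ n (F.sim i x)
      = F.ratio i * inner ℝ ((F.rotIso i).symm n) x + inner ℝ n (F.trans i) := by
  rw [sim_eq, inner_add_right, real_inner_smul_right, ← LinearIsometryEquiv.inner_map_map
    (F.rotIso i) ((F.rotIso i).symm n), LinearIsometryEquiv.apply_symm_apply]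

theorem dist_simWord (F : SimilarityIFS d Λ) {k : ℕ} (ω : Fin k → Λ)
    (x y : EuclideanSpace ℝ (Fin d)) :
    dist (F.simWord k ω x) (F.simWord k ω y) = F.ratioWord ω * dist x y := by
  induction k with
  | zero => simp [simWord, ratioWord]
  | succ k ih =>
    simp only [simWord, Function.comp, dist_sim, ih, ratioWord, Fin.prod_univ_succ, Fin.tail,
      mul_assoc]

theorem continuous_simWord (F : SimilarityIFS d Λ) {k : ℕ} (ω : Fin k → Λ) :
    Continuous (F.simWord k ω) := by
  induction k with
  | zero => exact continuous_id
  | succ k ih => exact (F.continuous_sim _).comp (ih _)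

theorem ratioWord_pos (F : SimilarityIFS d Λ) {k : ℕ} (ω : Fin k → Λ) : 0 < F.ratioWord ω :=
  Finset.prod_pos fun _ _ => F.ratio_pos _

theorem ratioWord_le_one (F : SimilarityIFS d Λ) {k : ℕ} (ω : Fin k → Λ) : F.ratioWord ω ≤ 1 :=
  Finset.prod_le_one (fun _ _ => (F.ratio_pos _).le) fun _ _ => (F.ratio_lt_one _).le

theorem exists_inner_simWord (F : SimilarityIFS d Λ) {k : ℕ} (ω : Fin k → Λ)
    (n : EuclideanSpace ℝ (Fin d)) (c : ℝ) :
    ∃ (n' : EuclideanSpace ℝ (Fin d)) (c' : ℝ), ‖n'‖ = ‖n‖ ∧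
      ∀ x, inner ℝ n (F.simWord k ω x) - c = F.ratioWord ω * (inner ℝ n' x - c') := by
  induction k generalizing n c with
  | zero => exact ⟨n, c, rfl, fun x => by simp [simWord, ratioWord]⟩
  | succ k ih =>
    obtain ⟨n', c', hn, h⟩ := ih (Fin.tail ω) ((F.rotIso (ω 0)).symm n)
      ((c - inner ℝ n (F.trans (ω 0))) / F.ratio (ω 0))
    refine ⟨n', c', by rw [hn, LinearIsometryEquiv.norm_map], fun x => ?_⟩
    have h0 := (F.ratio_pos (ω 0)).ne'
    have h1 := h x
    have h2 : F.ratioWord ω = F.ratio (ω 0) * F.ratioWord (Fin.tail ω) := by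
      simp [ratioWord, Fin.prod_univ_succ, Fin.tail]
    rw [h2, mul_assoc, ← h1, simWord, Function.comp, inner_sim]
    field_simp
    ring

theorem simWord_mapsTo (F : SimilarityIFS d Λ) {K : Set (EuclideanSpace ℝ (Fin d))}
    (hK : F.IsLimitSet K) {k : ℕ} (ω : Fin k → Λ) : Set.MapsTo (F.simWord k ω) K K := by
  induction k with
  | zero => exact Set.mapsTo_id K
  | succ k ih =>
    refine Set.MapsTo.comp (t := K) ?_ (ih _)
    intro x hx
    rw [hK.2.2]
    exact Set.mem_iUnion.2 ⟨ω 0, x, hx, rfl⟩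

section SelfSimilar

variable [Fintype Λ] {F : SimilarityIFS d Λ} {p : Λ → ℝ}
  {μ : Measure (EuclideanSpace ℝ (Fin d))}

theorem IsSelfSimilar.measure_eq (h : F.IsSelfSimilar p μ) {S : Set (EuclideanSpace ℝ (Fin d))}
    (hS : MeasurableSet S) : μ S = ∑ i, ENNReal.ofReal (p i) * μ (F.sim i ⁻¹' S) := by
  conv_lhs => rw [h]
  rw [Measure.finsetSum_apply]
  refine Finset.sum_congr rfl fun i _ => ?_
  rw [Measure.smul_apply, Measure.map_apply (F.continuous_sim i).measurable hS, smul_eq_mul]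

theorem IsSelfSimilar.sum_eq_one [IsProbabilityMeasure μ] (h : F.IsSelfSimilar p μ) :
    ∑ i, ENNReal.ofReal (p i) = 1 := by
  have := h.measure_eq MeasurableSet.univ
  simpa using this.symm

theorem IsSelfSimilar.measure_eq_sum_words (h : F.IsSelfSimilar p μ) (k : ℕ)
    {S : Set (EuclideanSpace ℝ (Fin d))} (hS : MeasurableSet S) :
    μ S = ∑ ω : Fin k → Λ, (∏ j, ENNReal.ofReal (p (ω j))) * μ (F.simWord k ω ⁻¹' S) := by
  induction k generalizing S with
  | zero => simp [simWord]
  | succ k ih =>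
    rw [h.measure_eq hS, ← (Fin.consEquiv fun _ : Fin (k + 1) => Λ).sum_comp,
      Fintype.sum_prod_type]
    refine Finset.sum_congr rfl fun i _ => ?_
    rw [ih ((F.continuous_sim i).measurable hS), Finset.mul_sum]
    refine Finset.sum_congr rfl fun ω _ => ?_
    rw [Fin.prod_univ_succ, ← mul_assoc]
    simp only [Fin.consEquiv, Equiv.coe_fn_mk, Fin.cons_zero, Fin.cons_succ, simWord,
      Fin.tail_cons, Set.preimage_comp]

theorem IsSelfSimilar.prod_mul_measure_preimage_le (h : F.IsSelfSimilar p μ) {k : ℕ}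
    (ω : Fin k → Λ) {S : Set (EuclideanSpace ℝ (Fin d))} (hS : MeasurableSet S) :
    (∏ j, ENNReal.ofReal (p (ω j))) * μ (F.simWord k ω ⁻¹' S) ≤ μ S := by
  rw [h.measure_eq_sum_words k hS]
  exact Finset.single_le_sum
    (f := fun ω : Fin k → Λ => (∏ j, ENNReal.ofReal (p (ω j))) * μ (F.simWord k ω ⁻¹' S))
    (fun _ _ => zero_le) (Finset.mem_univ ω)

variable [IsProbabilityMeasure μ]

/-- A self-similar measure of an irreducible system gives no mass to proper affine subspaces. In
the smallest dimension in which this could fail, the subspaces of maximal mass form a finite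
family, and self-similarity makes `h_i⁻¹` permute it. -/
theorem IsSelfSimilar.measure_affineSubspace_eq_zero (hp : ∀ i, 0 < p i)
    (h : F.IsSelfSimilar p μ) (hirr : F.IsIrreducible) :
    ∀ L : AffineSubspace ℝ (EuclideanSpace ℝ (Fin d)), L ≠ ⊤ →
      μ (L : Set (EuclideanSpace ℝ (Fin d))) = 0 := by
  suffices H : ∀ m : ℕ, ∀ L : AffineSubspace ℝ (EuclideanSpace ℝ (Fin d)), L ≠ ⊤ →
      Module.finrank ℝ L.direction = m → μ (L : Set (EuclideanSpace ℝ (Fin d))) = 0 from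
    fun L hL => H _ L hL rfl
  intro m
  induction m using Nat.strong_induction_on with
  | _ m ih =>
    by_contra! hcon
    obtain ⟨L₀, hL₀, hdim₀, hμ₀⟩ := hcon
    set T : Set (AffineSubspace ℝ (EuclideanSpace ℝ (Fin d))) :=
      {L | L ≠ ⊥ ∧ L ≠ ⊤ ∧ Module.finrank ℝ L.direction = m} with hT
    have hmeas : ∀ L : AffineSubspace ℝ (EuclideanSpace ℝ (Fin d)),
        MeasurableSet (L : Set (EuclideanSpace ℝ (Fin d))) := fun L =>
      L.closed_of_finiteDimensional.measurableSet
    have hbot : ∀ L : AffineSubspace ℝ (EuclideanSpace ℝ (Fin d)),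
        μ (L : Set (EuclideanSpace ℝ (Fin d))) ≠ 0 → L ≠ ⊥ := by
      rintro L hL rfl
      exact hL (by simp)
    -- two distinct subspaces of dimension `m` meet in one of smaller dimension, which is null
    have hdisj : Pairwise (Function.onFun (AEDisjoint μ)
        fun L : T => ((L : AffineSubspace ℝ (EuclideanSpace ℝ (Fin d))) : Set _)) := by
      rintro ⟨L, hL⟩ ⟨L', hL'⟩ hne
      change μ (_ ∩ _) = 0
      rw [← AffineSubspace.coe_inf]
      by_cases hb : L ⊓ L' = ⊥
      · change μ ((L ⊓ L' : AffineSubspace ℝ _) : Set (EuclideanSpace ℝ (Fin d))) = 0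
        rw [hb]; simp
      have hne' : ((L ⊓ L' : AffineSubspace ℝ _) : Set (EuclideanSpace ℝ (Fin d))).Nonempty :=
        (AffineSubspace.nonempty_iff_ne_bot _).2 hb
      have hlt : Module.finrank ℝ (L ⊓ L').direction < m := by
        refine lt_of_le_of_ne (hL.2.2 ▸ Submodule.finrank_mono
          (AffineSubspace.direction_le inf_le_left)) fun heq => hne ?_
        have e1 : L ⊓ L' = L := AffineSubspace.eq_of_direction_eq_of_nonempty_of_le
          (Submodule.eq_of_le_of_finrank_eq (AffineSubspace.direction_le inf_le_left)
            (heq.trans hL.2.2.symm)) hne' inf_le_left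
        have e2 : L ⊓ L' = L' := AffineSubspace.eq_of_direction_eq_of_nonempty_of_le
          (Submodule.eq_of_le_of_finrank_eq (AffineSubspace.direction_le inf_le_right)
            (heq.trans hL'.2.2.symm)) hne' inf_le_right
        exact Subtype.ext (e1.symm.trans e2)
      refine ih _ hlt _ (fun htop => ?_) rfl
      exact hL.2.1 (top_le_iff.1 (htop ▸ inf_le_left))
    have hfin : {L ∈ T | μ (L₀ : Set (EuclideanSpace ℝ (Fin d)))
        ≤ μ (L : Set (EuclideanSpace ℝ (Fin d)))}.Finite := by
      have := Measure.finite_const_le_meas_of_disjoint_iUnion₀ μ (pos_iff_ne_zero.2 hμ₀)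
        (As := fun L : T => ((L : AffineSubspace ℝ (EuclideanSpace ℝ (Fin d))) : Set _))
        (fun L => (hmeas _).nullMeasurableSet) hdisj (measure_ne_top _ _)
      refine (this.image Subtype.val).subset ?_
      rintro L ⟨hLT, hL⟩
      exact ⟨⟨L, hLT⟩, hL, rfl⟩
    have hL₀T : L₀ ∈ T := ⟨hbot _ hμ₀, hL₀, hdim₀⟩
    obtain ⟨L₁, ⟨hL₁T, hL₁⟩, hmax⟩ := Set.exists_max_image _
      (fun L : AffineSubspace ℝ (EuclideanSpace ℝ (Fin d)) => μ (L : Set _)) hfin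
      ⟨L₀, hL₀T, le_rfl⟩
    have hmax' : ∀ L ∈ T, μ (L : Set (EuclideanSpace ℝ (Fin d)))
        ≤ μ (L₁ : Set (EuclideanSpace ℝ (Fin d))) := by
      intro L hL
      by_cases hle : μ (L₀ : Set (EuclideanSpace ℝ (Fin d))) ≤ μ (L : Set _)
      · exact hmax L ⟨hL, hle⟩
      · exact (not_le.1 hle).le.trans hL₁
    set S : Set (AffineSubspace ℝ (EuclideanSpace ℝ (Fin d))) :=
      {L ∈ T | μ (L : Set (EuclideanSpace ℝ (Fin d))) = μ (L₁ : Set _)} with hS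
    have hSfin : S.Finite := hfin.subset fun L hL => ⟨hL.1, hL₁.trans hL.2.ge⟩
    have hcoe : ∀ i (L : AffineSubspace ℝ (EuclideanSpace ℝ (Fin d))),
        ((L.map (F.simAffine i).symm.toAffineMap : AffineSubspace ℝ _) : Set _)
          = F.sim i ⁻¹' (L : Set (EuclideanSpace ℝ (Fin d))) := by
      intro i L
      rw [AffineSubspace.coe_map, ← F.coe_simAffine i]
      exact (F.simAffine i).symm.toEquiv.image_eq_preimage_symm _
    have hTmap : ∀ i, ∀ L ∈ T, L.map (F.simAffine i).symm.toAffineMap ∈ T := by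
      rintro i L ⟨h1, h2, h3⟩
      refine ⟨?_, fun htop => h2 ?_, ?_⟩
      · rw [← AffineSubspace.nonempty_iff_ne_bot, hcoe, ← F.coe_simAffine i]
        exact ((AffineSubspace.nonempty_iff_ne_bot _).2 h1).preimage (F.simAffine i).surjective
      · have h4 := hcoe i L
        rw [htop, AffineSubspace.top_coe, ← F.coe_simAffine i, eq_comm,
          Set.preimage_eq_univ_iff, (F.simAffine i).surjective.range_eq, Set.univ_subset_iff] at h4
        exact SetLike.coe_injective (by simpa using h4)
      · rw [AffineSubspace.map_direction, ← h3]
        exact LinearEquiv.finrank_map_eq (F.simAffine i).symm.linear L.direction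
    have hSmap : ∀ i, Set.MapsTo
        (fun L => L.map (F.simAffine i).symm.toAffineMap) S S := by
      rintro i L ⟨hLT, hLμ⟩
      refine ⟨hTmap i L hLT, ?_⟩
      have h1 := h.measure_eq (hmeas L)
      have h2 : ∀ j, μ (F.sim j ⁻¹' (L : Set _)) ≤ μ (L₁ : Set (EuclideanSpace ℝ (Fin d))) :=
        fun j => by rw [← hcoe j L]; exact hmax' _ (hTmap j L hLT)
      change μ ((L.map (F.simAffine i).symm.toAffineMap : AffineSubspace ℝ _) : Set _) = _
      rw [hcoe]
      refine le_antisymm (h2 i) ?_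
      -- the mass of `L` is an average of the masses of its preimages, none of which exceeds it
      by_contra! hlt
      have h3 : ∑ j, ENNReal.ofReal (p j) * μ (F.sim j ⁻¹' (L : Set _))
          < ∑ j, ENNReal.ofReal (p j) * μ (L₁ : Set (EuclideanSpace ℝ (Fin d))) := by
        classical
        rw [← Finset.add_sum_erase _ _ (Finset.mem_univ i),
          ← Finset.add_sum_erase _ (fun j => ENNReal.ofReal (p j) * μ (L₁ : Set _))
            (Finset.mem_univ i)]
        refine ENNReal.add_lt_add_of_lt_of_le ?_
          ((ENNReal.mul_lt_mul_iff_right (by simpa using hp i) ENNReal.ofReal_ne_top).2 hlt)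
          (Finset.sum_le_sum fun j _ => mul_le_mul_right (h2 j) _)
        exact ENNReal.sum_ne_top.2 fun j _ =>
          ENNReal.mul_ne_top ENNReal.ofReal_ne_top (measure_ne_top _ _)
      rw [← h1, ← Finset.sum_mul, h.sum_eq_one, one_mul, hLμ] at h3
      exact lt_irrefl _ h3
    refine hirr ⟨S, hSfin, ⟨L₁, hL₁T, rfl⟩, fun L hL => ⟨hL.1.1, hL.1.2.1⟩, fun i L hL => ?_⟩
    have hsurj := ((hSfin.injOn_iff_bijOn_of_mapsTo (hSmap i)).1 fun A _ B _ hAB => by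
      have h1 := congrArg (fun L : AffineSubspace ℝ (EuclideanSpace ℝ (Fin d)) =>
        (L : Set (EuclideanSpace ℝ (Fin d)))) hAB
      simp only [hcoe] at h1
      rw [← F.coe_simAffine i] at h1
      exact SetLike.coe_injective
        ((Set.preimage_injective.2 (F.simAffine i).surjective) h1)).surjOn
    obtain ⟨L', hL', rfl⟩ := hsurj hL
    refine ⟨L', hL', ?_⟩
    rw [hcoe, ← F.coe_simAffine i]
    exact Set.image_preimage_eq _ (F.simAffine i).surjective

end SelfSimilar

end SimilarityIFS

section Slabs

variable {d : ℕ}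

/-- The closed slab of half-width `ε` around the affine hyperplane `⟪n, x⟫ = c`. -/
def slab (n : EuclideanSpace ℝ (Fin d)) (c ε : ℝ) : Set (EuclideanSpace ℝ (Fin d)) :=
  {x | |inner ℝ n x - c| ≤ ε}

theorem isClosed_slab (n : EuclideanSpace ℝ (Fin d)) (c ε : ℝ) : IsClosed (slab n c ε) :=
  isClosed_le (by fun_prop) continuous_const

theorem slab_subset_slab (n : EuclideanSpace ℝ (Fin d)) (c : ℝ) {ε ε' : ℝ} (h : ε ≤ ε') :
    slab n c ε ⊆ slab n c ε' := fun _ hx => le_trans hx h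

/-- The largest mass of a slab of half-width `ε`. -/
def slabMass (μ : Measure (EuclideanSpace ℝ (Fin d))) (ε : ℝ) : ℝ≥0∞ :=
  ⨆ n : Metric.sphere (0 : EuclideanSpace ℝ (Fin d)) 1, ⨆ c : ℝ, μ (slab n c ε)

theorem measure_slab_le (μ : Measure (EuclideanSpace ℝ (Fin d))) {n : EuclideanSpace ℝ (Fin d)}
    (hn : ‖n‖ = 1) (c ε : ℝ) : μ (slab n c ε) ≤ slabMass μ ε :=
  le_iSup₂_of_le (⟨n, by simpa using hn⟩ : Metric.sphere (0 : EuclideanSpace ℝ (Fin d)) 1) c le_rfl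

theorem slabMass_mono (μ : Measure (EuclideanSpace ℝ (Fin d))) : Monotone (slabMass μ) :=
  fun _ _ h => iSup₂_mono fun _ _ => measure_mono (slab_subset_slab _ _ h)

theorem exists_affineSubspace_eq_slab_zero {n : EuclideanSpace ℝ (Fin d)} (hn : ‖n‖ = 1) (c : ℝ) :
    ∃ L : AffineSubspace ℝ (EuclideanSpace ℝ (Fin d)), L ≠ ⊤ ∧
      (L : Set (EuclideanSpace ℝ (Fin d))) = slab n c 0 := by
  have hnn : inner ℝ n n = (1 : ℝ) := by rw [real_inner_self_eq_norm_sq, hn]; norm_num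
  have hmem : ∀ x, x ∈ AffineSubspace.mk' (c • n) (Submodule.span ℝ {n})ᗮ ↔ inner ℝ n x = c := by
    intro x
    rw [AffineSubspace.mem_mk', Submodule.mem_orthogonal_singleton_iff_inner_right, vsub_eq_sub,
      inner_sub_right, real_inner_smul_right, hnn, mul_one, sub_eq_zero]
  refine ⟨AffineSubspace.mk' (c • n) (Submodule.span ℝ {n})ᗮ, fun htop => ?_, ?_⟩
  · have h1 : (c + 1) • n ∈ AffineSubspace.mk' (c • n) (Submodule.span ℝ {n})ᗮ := by
      rw [htop]; exact AffineSubspace.mem_top _ _ _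
    rw [hmem, real_inner_smul_right, hnn] at h1
    linarith
  · ext x
    rw [SetLike.mem_coe, hmem, slab, Set.mem_ofPred_eq, abs_nonpos_iff, sub_eq_zero]

/-- If `μ` has bounded support and does not charge hyperplanes, then by compactness thin slabs
have uniformly small mass. -/
theorem exists_slabMass_le {μ : Measure (EuclideanSpace ℝ (Fin d))} [IsProbabilityMeasure μ]
    {K : Set (EuclideanSpace ℝ (Fin d))} {R : ℝ} (hR : ∀ x ∈ K, ‖x‖ ≤ R) (hμK : μ Kᶜ = 0)
    (hL : ∀ L : AffineSubspace ℝ (EuclideanSpace ℝ (Fin d)), L ≠ ⊤ →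
      μ (L : Set (EuclideanSpace ℝ (Fin d))) = 0) {δ : ℝ≥0∞} (hδ : 0 < δ) :
    ∃ ε : ℝ, 0 < ε ∧ slabMass μ ε ≤ δ := by
  by_contra! hcon
  have hex : ∀ j : ℕ, ∃ (n : EuclideanSpace ℝ (Fin d)) (c : ℝ), ‖n‖ = 1 ∧
      δ < μ (slab n c (1 / ((j : ℝ) + 1))) := by
    intro j
    have := hcon (1 / ((j : ℝ) + 1)) (by positivity)
    rw [slabMass, lt_iSup_iff] at this
    obtain ⟨n, hn⟩ := this
    obtain ⟨c, hc⟩ := lt_iSup_iff.1 hn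
    exact ⟨n, c, by simp, hc⟩
  choose n c hn hnc using hex
  have hK0 : ∀ S : Set (EuclideanSpace ℝ (Fin d)), μ S = μ (S ∩ K) := fun S =>
    (measure_inter_conull hμK).symm
  have hcbd : ∀ j, c j ∈ Set.Icc (-(R + 1)) (R + 1) := by
    intro j
    have h1 : μ (slab (n j) (c j) (1 / ((j : ℝ) + 1)) ∩ K) ≠ 0 := by
      rw [← hK0]; exact (hδ.trans (hnc j)).ne'
    obtain ⟨x, hx, hxK⟩ := nonempty_of_measure_ne_zero h1
    have h2 : |inner ℝ (n j) x - c j| ≤ 1 / ((j : ℝ) + 1) := hx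
    have h3 : |inner ℝ (n j) x| ≤ R := (abs_real_inner_le_norm _ _).trans (by
      rw [hn j, one_mul]; exact hR x hxK)
    have h4 : (1 : ℝ) / ((j : ℝ) + 1) ≤ 1 := by
      rw [div_le_one (by positivity)]; linarith [(Nat.cast_nonneg j : (0 : ℝ) ≤ j)]
    rw [abs_le] at h2 h3
    constructor <;> linarith
  -- a limit of slabs of mass at least `δ` is a hyperplane of mass at least `δ`
  obtain ⟨⟨n₀, c₀⟩, hmem, ψ, hψ, hlim⟩ :=
    ((isCompact_sphere (0 : EuclideanSpace ℝ (Fin d)) 1).prod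
      (isCompact_Icc (a := -(R + 1)) (b := R + 1))).tendsto_subseq
      (x := fun j => (n j, c j)) fun j => ⟨by simp [hn j], hcbd j⟩
  have hn₀ : ‖n₀‖ = 1 := by simpa using hmem.1
  have hlim1 : Tendsto (fun j => n (ψ j)) atTop (𝓝 n₀) := (continuous_fst.tendsto _).comp hlim
  have hlim2 : Tendsto (fun j => c (ψ j)) atTop (𝓝 c₀) := (continuous_snd.tendsto _).comp hlim
  have hslab : ∀ η : ℝ, 0 < η → δ ≤ μ (slab n₀ c₀ η) := by
    intro η hη
    have h1 : Tendsto (fun j => ‖n (ψ j) - n₀‖ * R + |c (ψ j) - c₀| + 1 / ((ψ j : ℝ) + 1)) atTop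
        (𝓝 0) := by
      have e1 : Tendsto (fun j => ‖n (ψ j) - n₀‖ * R) atTop (𝓝 0) := by
        simpa using ((tendsto_iff_norm_sub_tendsto_zero.1 hlim1).mul_const R)
      have e2 : Tendsto (fun j => |c (ψ j) - c₀|) atTop (𝓝 0) := by
        simpa using (tendsto_iff_norm_sub_tendsto_zero.1 hlim2)
      have e3 : Tendsto (fun j => 1 / ((ψ j : ℝ) + 1)) atTop (𝓝 0) :=
        tendsto_one_div_add_atTop_nhds_zero_nat.comp hψ.tendsto_atTop
      simpa using (e1.add e2).add e3
    obtain ⟨j, hj⟩ := (h1.eventually (gt_mem_nhds hη)).exists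
    refine (hnc (ψ j)).le.trans ?_
    rw [hK0]
    refine measure_mono ?_
    rintro x ⟨hx, hxK⟩
    have h2 : |inner ℝ (n (ψ j)) x - c (ψ j)| ≤ 1 / ((ψ j : ℝ) + 1) := hx
    have h3 : |inner ℝ (n (ψ j) - n₀) x| ≤ ‖n (ψ j) - n₀‖ * R :=
      (abs_real_inner_le_norm _ _).trans (by gcongr; exact hR x hxK)
    rw [inner_sub_left] at h3
    change |inner ℝ n₀ x - c₀| ≤ η
    have h4 := abs_le.1 h2
    have h5 := abs_le.1 h3
    have h6 := abs_le.1 (le_refl |c (ψ j) - c₀|)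
    rw [abs_le]
    constructor <;> linarith
  have hinter : slab n₀ c₀ 0 = ⋂ k : ℕ, slab n₀ c₀ (1 / ((k : ℝ) + 1)) := by
    ext x
    simp only [slab, Set.mem_iInter, Set.mem_ofPred_eq]
    constructor
    · intro h k; exact h.trans (by positivity)
    · intro h; exact ge_of_tendsto' tendsto_one_div_add_atTop_nhds_zero_nat h
  obtain ⟨L, hLtop, hLeq⟩ := exists_affineSubspace_eq_slab_zero hn₀ c₀
  have h0 := hL L hLtop
  rw [hLeq, hinter] at h0
  have htend := tendsto_measure_iInter_atTop (μ := μ)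
    (s := fun k : ℕ => slab n₀ c₀ (1 / ((k : ℝ) + 1)))
    (fun k => (isClosed_slab _ _ _).measurableSet.nullMeasurableSet)
    (fun a b hab => slab_subset_slab _ _ (by
      apply one_div_le_one_div_of_le (by positivity)
      have : (a : ℝ) ≤ b := by exact_mod_cast hab
      linarith)) ⟨0, measure_ne_top _ _⟩
  rw [h0] at htend
  have := ge_of_tendsto' htend fun k => hslab _ (by positivity)
  exact (hδ.trans_le this).ne' rfl

end Slabs

namespace SimilarityIFS

variable {d : ℕ} {Λ : Type*} [Fintype Λ] {F : SimilarityIFS d Λ} {p : Λ → ℝ}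
  {μ : Measure (EuclideanSpace ℝ (Fin d))} [IsProbabilityMeasure μ]
  {K : Set (EuclideanSpace ℝ (Fin d))}

/-- A slab is cut by the pieces of level `k` that it meets: the mass in each of these pieces is
that of a rescaled slab, and the pieces themselves lie in a slab that is slightly thicker. -/
theorem IsSelfSimilar.slabMass_le_mul (h : F.IsSelfSimilar p μ) (hμK : μ Kᶜ = 0) {D : ℝ}
    (hD : ∀ x ∈ K, ∀ y ∈ K, dist x y ≤ D) {k : ℕ} {a b : ℝ} (ha : 0 < a)
    (hab : ∀ ω : Fin k → Λ, a ≤ F.ratioWord ω ∧ F.ratioWord ω ≤ b) (ε : ℝ) :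
    slabMass μ ε ≤ slabMass μ (ε / a) * slabMass μ (ε + b * D) := by
  refine iSup₂_le fun ⟨n, hn⟩ c => ?_
  have hn1 : ‖n‖ = 1 := by simpa using hn
  have hterm : ∀ ω : Fin k → Λ, μ (F.simWord k ω ⁻¹' slab n c ε)
      ≤ slabMass μ (ε / a) * μ (F.simWord k ω ⁻¹' slab n c (ε + b * D)) := by
    intro ω
    obtain ⟨n', c', hn', hω⟩ := F.exists_inner_simWord ω n c
    by_cases hne : ∃ x ∈ K, F.simWord k ω x ∈ slab n c ε
    · obtain ⟨x, hxK, hx⟩ := hne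
      have h1 : μ (F.simWord k ω ⁻¹' slab n c (ε + b * D)) = 1 := by
        rw [← prob_compl_eq_zero_iff
          ((F.continuous_simWord ω).measurable (isClosed_slab _ _ _).measurableSet)]
        refine measure_mono_null ?_ hμK
        intro y hy hyK
        refine hy ?_
        have e1 : |inner ℝ n (F.simWord k ω x) - c| ≤ ε := hx
        have e2 : |inner ℝ n (F.simWord k ω y - F.simWord k ω x)| ≤ b * D := by
          refine (abs_real_inner_le_norm _ _).trans ?_
          rw [hn1, one_mul, ← dist_eq_norm, dist_simWord]
          exact mul_le_mul (hab ω).2 (hD y hyK x hxK) dist_nonneg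
            (ha.le.trans ((hab ω).1.trans (hab ω).2))
        rw [inner_sub_right] at e2
        change |inner ℝ n (F.simWord k ω y) - c| ≤ ε + b * D
        rw [abs_le] at e1 e2 ⊢
        constructor <;> linarith
      rw [h1, mul_one]
      refine le_trans (measure_mono ?_) (measure_slab_le μ (hn'.trans hn1) c' (ε / a))
      intro y hy
      have e1 : |inner ℝ n (F.simWord k ω y) - c| ≤ ε := hy
      rw [hω y, abs_mul, abs_of_pos (F.ratioWord_pos ω)] at e1
      change |inner ℝ n' y - c'| ≤ ε / a
      rw [le_div_iff₀ ha, mul_comm]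
      exact (mul_le_mul_of_nonneg_right (hab ω).1 (abs_nonneg _)).trans e1
    · have h0 : μ (F.simWord k ω ⁻¹' slab n c ε) = 0 :=
        measure_mono_null (fun x hx hxK => hne ⟨x, hxK, hx⟩) hμK
      rw [h0]; exact zero_le
  rw [h.measure_eq_sum_words k (isClosed_slab _ _ _).measurableSet]
  calc ∑ ω : Fin k → Λ, (∏ j, ENNReal.ofReal (p (ω j))) * μ (F.simWord k ω ⁻¹' slab n c ε)
      ≤ ∑ ω : Fin k → Λ, slabMass μ (ε / a) * ((∏ j, ENNReal.ofReal (p (ω j)))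
          * μ (F.simWord k ω ⁻¹' slab n c (ε + b * D))) := by
        refine Finset.sum_le_sum fun ω _ => ?_
        rw [mul_left_comm]
        exact mul_le_mul_right (hterm ω) _
    _ = slabMass μ (ε / a) * μ (slab n c (ε + b * D)) := by
        rw [← Finset.mul_sum, ← h.measure_eq_sum_words k (isClosed_slab _ _ _).measurableSet]
    _ ≤ _ := mul_le_mul_right (measure_slab_le μ hn1 _ _) _

/-- Slabs around hyperplanes have masses that decay like a power of their width. -/
theorem IsSelfSimilar.exists_slabMass_le_rpow (hp : ∀ i, 0 < p i) (h : F.IsSelfSimilar p μ)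
    (hirr : F.IsIrreducible) (hK : F.IsLimitSet K) (hμK : μ Kᶜ = 0) :
    ∃ C α ε₁ : ℝ, 0 < C ∧ 0 < α ∧ 0 < ε₁ ∧ ∀ ε, 0 < ε → ε ≤ ε₁ →
      slabMass μ ε ≤ ENNReal.ofReal (C * ε ^ α) := by
  obtain ⟨R, hR⟩ := hK.2.1.isBounded.exists_norm_le
  have hΛ : Nonempty Λ := by
    obtain ⟨x, hx⟩ := hK.1
    rw [hK.2.2] at hx
    exact ⟨(Set.mem_iUnion.1 hx).choose⟩
  obtain ⟨i₀, hi₀⟩ := Finite.exists_min F.ratio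
  obtain ⟨i₁, hi₁⟩ := Finite.exists_max F.ratio
  set D : ℝ := 2 * |R| + 1 with hDdef
  have hDpos : 0 < D := by positivity
  have hD : ∀ x ∈ K, ∀ y ∈ K, dist x y ≤ D := fun x hx y hy => by
    rw [dist_eq_norm]
    have h1 := hR x hx
    have h2 := hR y hy
    have h3 := norm_sub_le x y
    have h4 := le_abs_self R
    linarith
  obtain ⟨ε', hε', hM⟩ := exists_slabMass_le hR hμK
    (h.measure_affineSubspace_eq_zero hp hirr) (δ := 2⁻¹) (by norm_num)
  -- the level is so deep that the thickened slab in `slabMass_le_mul` has mass at most `1 / 2`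
  obtain ⟨k, hk⟩ : ∃ k : ℕ, F.ratio i₁ ^ k * D * 2 < ε' ∧ 1 ≤ k := by
    have h1 : Tendsto (fun k : ℕ => F.ratio i₁ ^ k * D * 2) atTop (𝓝 0) := by
      simpa using ((tendsto_pow_atTop_nhds_zero_of_lt_one (F.ratio_pos i₁).le
        (F.ratio_lt_one i₁)).mul_const D).mul_const 2
    exact ((h1.eventually (gt_mem_nhds hε')).and (eventually_ge_atTop 1)).exists
  set q := F.ratio i₀ ^ k with hq
  set b := F.ratio i₁ ^ k with hb
  have hq0 : 0 < q := pow_pos (F.ratio_pos i₀) k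
  have hq1 : q < 1 := pow_lt_one₀ (F.ratio_pos i₀).le (F.ratio_lt_one i₀) (by omega)
  have hb0 : 0 < b := pow_pos (F.ratio_pos i₁) k
  have hab : ∀ ω : Fin k → Λ, q ≤ F.ratioWord ω ∧ F.ratioWord ω ≤ b := by
    intro ω
    have e1 : ∏ _j : Fin k, F.ratio i₀ = q := by simp [hq]
    have e2 : ∏ _j : Fin k, F.ratio i₁ = b := by simp [hb]
    rw [← e1, ← e2]
    exact ⟨Finset.prod_le_prod (fun _ _ => (F.ratio_pos _).le) fun _ _ => hi₀ _,
      Finset.prod_le_prod (fun _ _ => (F.ratio_pos _).le) fun _ _ => hi₁ _⟩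
  set ε₁ := b * D with hε₁
  have hε₁0 : 0 < ε₁ := by positivity
  have hstep : ∀ ε, ε ≤ ε₁ → slabMass μ ε ≤ slabMass μ (ε / q) * 2⁻¹ := by
    intro ε h1
    refine (h.slabMass_le_mul hμK hD hq0 hab ε).trans (mul_le_mul_right ?_ _)
    refine (slabMass_mono μ ?_).trans hM
    linarith [hk.1]
  have hgeom : ∀ m : ℕ, slabMass μ (ε₁ * q ^ m) ≤ (2⁻¹ : ℝ≥0∞) ^ m := by
    intro m
    induction m with
    | zero =>
      rw [pow_zero, pow_zero]
      exact iSup₂_le fun _ _ => prob_le_one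
    | succ m ih =>
      have h1 := hstep (ε₁ * q ^ (m + 1))
        (mul_le_of_le_one_right hε₁0.le (pow_le_one₀ hq0.le hq1.le))
      rw [show ε₁ * q ^ (m + 1) / q = ε₁ * q ^ m by
        rw [pow_succ]; field_simp] at h1
      rw [pow_succ (2⁻¹ : ℝ≥0∞)]
      exact h1.trans (mul_le_mul_left ih _)
  set α := Real.log 2⁻¹ / Real.log q with hα
  have hlq : Real.log q < 0 := Real.log_neg hq0 hq1
  have hl2 : Real.log 2⁻¹ < 0 := Real.log_neg (by norm_num) (by norm_num)
  have hα0 : 0 < α := div_pos_of_neg_of_neg hl2 hlq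
  have hqα : q ^ α = 2⁻¹ := by
    rw [Real.rpow_def_of_pos hq0, hα, mul_div_cancel₀ _ hlq.ne, Real.exp_log (by norm_num)]
  refine ⟨2 * ε₁⁻¹ ^ α, α, ε₁, by positivity, hα0, hε₁0, fun ε h0 h1 => ?_⟩
  obtain ⟨m, hm1, hm2⟩ := exists_nat_pow_near_of_lt_one (x := ε / ε₁) (by positivity)
    ((div_le_one hε₁0).2 h1) hq0 hq1
  have h2 : ε ≤ ε₁ * q ^ m := by rw [← div_le_iff₀' hε₁0]; exact hm2
  refine (slabMass_mono μ h2).trans ((hgeom m).trans ?_)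
  have h3 : (2⁻¹ : ℝ) ^ (m + 1) ≤ (ε / ε₁) ^ α := by
    rw [← hqα, ← Real.rpow_natCast, ← Real.rpow_mul hq0.le, mul_comm, Real.rpow_mul hq0.le,
      Real.rpow_natCast]
    exact Real.rpow_le_rpow (by positivity) hm1.le hα0.le
  have h4 : (2⁻¹ : ℝ≥0∞) ^ m = ENNReal.ofReal ((2⁻¹ : ℝ) ^ m) := by
    rw [ENNReal.ofReal_pow (by norm_num), ENNReal.ofReal_inv_of_pos (by norm_num)]
    simp
  rw [h4]
  refine ENNReal.ofReal_le_ofReal ?_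
  rw [div_eq_mul_inv, Real.mul_rpow h0.le (by positivity)] at h3
  rw [pow_succ] at h3
  linarith

end SimilarityIFS

section Decay

variable {d : ℕ}

theorem exists_submodule_finrank_eq {m : ℕ} (hm : m ≤ d) :
    ∃ V : Submodule ℝ (EuclideanSpace ℝ (Fin d)), Module.finrank ℝ V = m := by
  have h := (EuclideanSpace.orthonormal_single (𝕜 := ℝ) (ι := Fin d)).linearIndependent.comp
    (Fin.castLE hm) (Fin.castLE_injective hm)
  exact ⟨_, (finrank_span_eq_card h).trans (Fintype.card_fin m)⟩

/-- A neighbourhood of a proper affine subspace is contained in a slab. -/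
theorem exists_thickening_subset_slab {L : AffineSubspace ℝ (EuclideanSpace ℝ (Fin d))}
    (hL : L ≠ ⊥) (hdim : Module.finrank ℝ L.direction < d) :
    ∃ (n : EuclideanSpace ℝ (Fin d)) (c : ℝ), ‖n‖ = 1 ∧
      ∀ ε, Metric.thickening ε (L : Set (EuclideanSpace ℝ (Fin d))) ⊆ slab n c ε := by
  obtain ⟨p, hp⟩ := (AffineSubspace.nonempty_iff_ne_bot L).2 hL
  have hne : L.directionᗮ ≠ ⊥ := by
    intro h
    rw [Submodule.orthogonal_eq_bot_iff] at h
    rw [h, finrank_top, finrank_euclideanSpace_fin] at hdim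
    exact lt_irrefl _ hdim
  obtain ⟨m, hm, hm0⟩ := Submodule.exists_mem_ne_zero_of_ne_bot hne
  set n := (‖m‖⁻¹ : ℝ) • m with hn
  have hnperp : n ∈ L.directionᗮ := Submodule.smul_mem _ _ hm
  have hn1 : ‖n‖ = 1 := norm_smul_inv_norm (𝕜 := ℝ) hm0
  refine ⟨n, inner ℝ n p, hn1, fun ε y hy => ?_⟩
  obtain ⟨z, hz, hyz⟩ := Metric.mem_thickening_iff.1 hy
  have h1 : inner ℝ n (z - p) = (0 : ℝ) :=
    (Submodule.mem_orthogonal' _ _).1 hnperp _ (AffineSubspace.vsub_mem_direction hz hp)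
  have h2 : inner ℝ n y - inner ℝ n p = inner ℝ n (y - z) := by
    rw [inner_sub_right] at h1 ⊢; linarith
  change |inner ℝ n y - inner ℝ n p| ≤ ε
  rw [h2]
  refine (abs_real_inner_le_norm _ _).trans ?_
  rw [hn1, one_mul, ← dist_eq_norm]
  exact hyz.le

/-- The largest mass of an `ε`-neighbourhood of an affine subspace of dimension `d - ℓ`. -/
def tubeMass (μ : Measure (EuclideanSpace ℝ (Fin d))) (ℓ : ℕ) (ε : ℝ) : ℝ :=
  ⨆ L : {L : AffineSubspace ℝ (EuclideanSpace ℝ (Fin d)) //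
        L ≠ ⊥ ∧ Module.finrank ℝ L.direction = d - ℓ},
      μ.real (Metric.thickening ε (L.1 : Set (EuclideanSpace ℝ (Fin d))))

theorem decayExponent_eq (μ : Measure (EuclideanSpace ℝ (Fin d))) (ℓ : ℕ) :
    decayExponent μ ℓ = liminf (fun ε => Real.log (tubeMass μ ℓ ε) / Real.log ε) (𝓝[>] 0) := rfl

theorem measure_thickening_le_tubeMass (μ : Measure (EuclideanSpace ℝ (Fin d)))
    [IsProbabilityMeasure μ] {ℓ : ℕ} (ε : ℝ) {L : AffineSubspace ℝ (EuclideanSpace ℝ (Fin d))}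
    (hL : L ≠ ⊥) (hdim : Module.finrank ℝ L.direction = d - ℓ) :
    μ.real (Metric.thickening ε (L : Set (EuclideanSpace ℝ (Fin d)))) ≤ tubeMass μ ℓ ε :=
  le_ciSup (f := fun L : {L : AffineSubspace ℝ (EuclideanSpace ℝ (Fin d)) //
        L ≠ ⊥ ∧ Module.finrank ℝ L.direction = d - ℓ} =>
      μ.real (Metric.thickening ε (L.1 : Set (EuclideanSpace ℝ (Fin d)))))
    ⟨1, by rintro _ ⟨L, rfl⟩; exact measureReal_le_one⟩ ⟨L, hL, hdim⟩

theorem tendsto_log_nhdsGT_zero_atBot : Tendsto Real.log (𝓝[>] 0) atBot :=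
  Real.tendsto_log_nhdsNE_zero.mono_left (nhdsWithin_mono _ fun _ hx => ne_of_gt hx)

theorem tendsto_const_div_log_nhdsGT_zero (c : ℝ) :
    Tendsto (fun ε => c / Real.log ε) (𝓝[>] 0) (𝓝 0) :=
  tendsto_log_nhdsGT_zero_atBot.const_div_atBot c

end Decay

namespace SimilarityIFS

variable {d : ℕ} {Λ : Type*} [Fintype Λ] {F : SimilarityIFS d Λ} {p : Λ → ℝ}
  {μ : Measure (EuclideanSpace ℝ (Fin d))} [IsProbabilityMeasure μ]
  {K : Set (EuclideanSpace ℝ (Fin d))}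

/-- Neighbourhoods of suitable subspaces contain small pieces of the limit set, so their masses
are bounded below by a power of the width. -/
theorem IsSelfSimilar.exists_rpow_le_tubeMass (hp : ∀ i, 0 < p i) (h : F.IsSelfSimilar p μ)
    (hK : F.IsLimitSet K) (hμK : μ Kᶜ = 0) (ℓ : ℕ) :
    ∃ c t ε₁ : ℝ, 0 < c ∧ 0 < ε₁ ∧ ∀ ε, 0 < ε → ε < ε₁ → c * ε ^ t ≤ tubeMass μ ℓ ε := by
  obtain ⟨R, hR⟩ := hK.2.1.isBounded.exists_norm_le
  obtain ⟨x₀, hx₀⟩ := hK.1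
  obtain ⟨i, -⟩ : ∃ i : Λ, True := by
    have := hx₀
    rw [hK.2.2] at this
    exact ⟨(Set.mem_iUnion.1 this).choose, trivial⟩
  set D : ℝ := 2 * |R| + 1 with hDdef
  have hDpos : 0 < D := by positivity
  have hD : ∀ x ∈ K, ∀ y ∈ K, dist x y < D := fun x hx y hy => by
    rw [dist_eq_norm]
    have h1 := hR x hx
    have h2 := hR y hy
    have h3 := norm_sub_le x y
    have h4 := le_abs_self R
    linarith
  obtain ⟨V, hV⟩ := exists_submodule_finrank_eq (Nat.sub_le d ℓ)
  set r := F.ratio i with hr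
  have hr0 : 0 < r := F.ratio_pos i
  have hr1 : r < 1 := F.ratio_lt_one i
  have hpi1 : p i ≤ 1 := by
    have h1 := h.sum_eq_one
    have h2 : ENNReal.ofReal (p i) ≤ 1 := by
      rw [← h1]
      exact Finset.single_le_sum (f := fun i => ENNReal.ofReal (p i)) (fun _ _ => zero_le)
        (Finset.mem_univ i)
    simpa using h2
  set t := Real.log (p i) / Real.log r with ht
  have hlr : Real.log r < 0 := Real.log_neg hr0 hr1
  have ht0 : 0 ≤ t := div_nonneg_of_nonpos (Real.log_nonpos (hp i).le hpi1) hlr.le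
  have hrt : r ^ t = p i := by
    rw [Real.rpow_def_of_pos hr0, ht, mul_div_cancel₀ _ hlr.ne, Real.exp_log (hp i)]
  refine ⟨p i * D⁻¹ ^ t, t, D, mul_pos (hp i) (by positivity), hDpos, fun ε hε0 hε1 => ?_⟩
  obtain ⟨m, hm1, hm2⟩ := exists_nat_pow_near_of_lt_one (x := ε / D) (by positivity)
    ((div_le_one hDpos).2 hε1.le) hr0 hr1
  -- the constant word gives a piece of diameter less than `ε`
  obtain ⟨ω, hρω, hpω⟩ : ∃ ω : Fin (m + 1) → Λ, F.ratioWord ω = r ^ (m + 1) ∧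
      ∏ j, ENNReal.ofReal (p (ω j)) = ENNReal.ofReal (p i ^ (m + 1)) :=
    ⟨fun _ => i, by simp [ratioWord, hr], by simp [ENNReal.ofReal_pow (hp i).le]⟩
  obtain ⟨L, hLmem, hLdim⟩ : ∃ L : AffineSubspace ℝ (EuclideanSpace ℝ (Fin d)),
      F.simWord (m + 1) ω x₀ ∈ L ∧ Module.finrank ℝ L.direction = d - ℓ :=
    ⟨AffineSubspace.mk' (F.simWord (m + 1) ω x₀) V, AffineSubspace.self_mem_mk' _ _,
      by rw [AffineSubspace.direction_mk', hV]⟩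
  have hLbot : L ≠ ⊥ := (AffineSubspace.nonempty_iff_ne_bot L).1 ⟨_, hLmem⟩
  refine le_trans ?_ (measure_thickening_le_tubeMass μ ε hLbot hLdim)
  have hmeas : MeasurableSet (Metric.thickening ε (L : Set (EuclideanSpace ℝ (Fin d)))) :=
    Metric.isOpen_thickening.measurableSet
  have h1 : μ (F.simWord (m + 1) ω ⁻¹'
      Metric.thickening ε (L : Set (EuclideanSpace ℝ (Fin d)))) = 1 := by
    rw [← prob_compl_eq_zero_iff ((F.continuous_simWord ω).measurable hmeas)]
    refine measure_mono_null ?_ hμK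
    intro y hy hyK
    refine hy (Set.mem_preimage.2 (Metric.mem_thickening_iff.2 ⟨_, hLmem, ?_⟩))
    rw [dist_simWord, hρω]
    rw [lt_div_iff₀ hDpos] at hm1
    exact (mul_le_mul_of_nonneg_left (hD y hyK x₀ hx₀).le (by positivity)).trans_lt hm1
  have h2 : ENNReal.ofReal (p i ^ (m + 1))
      ≤ μ (Metric.thickening ε (L : Set (EuclideanSpace ℝ (Fin d)))) := by
    refine le_trans ?_ (h.prod_mul_measure_preimage_le ω hmeas)
    rw [h1, hpω, mul_one]
  have h3 : p i ^ (m + 1)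
      ≤ μ.real (Metric.thickening ε (L : Set (EuclideanSpace ℝ (Fin d)))) :=
    (ENNReal.ofReal_le_iff_le_toReal (measure_ne_top _ _)).1 h2
  refine le_trans ?_ h3
  have h4 : (ε / D) ^ t ≤ p i ^ m := by
    rw [← hrt, ← Real.rpow_natCast, ← Real.rpow_mul hr0.le, mul_comm t, Real.rpow_mul hr0.le,
      Real.rpow_natCast]
    exact Real.rpow_le_rpow (by positivity) hm2 ht0
  rw [div_eq_mul_inv, Real.mul_rpow hε0.le (by positivity)] at h4
  rw [pow_succ]
  have := hp i
  nlinarith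

theorem IsSelfSimilar.eventually_log_tubeMass (hp : ∀ i, 0 < p i) (h : F.IsSelfSimilar p μ)
    (hirr : F.IsIrreducible) (hK : F.IsLimitSet K) (hμK : μ Kᶜ = 0) {ℓ : ℕ} (hℓ : 1 ≤ ℓ)
    (hℓd : ℓ ≤ d) :
    ∃ α B : ℝ, 0 < α ∧ ∀ᶠ ε in 𝓝[>] (0 : ℝ), 0 < tubeMass μ ℓ ε ∧
      α ≤ Real.log (tubeMass μ ℓ ε) / Real.log ε ∧
      Real.log (tubeMass μ ℓ ε) / Real.log ε ≤ B := by
  obtain ⟨C, α, ε₁, hC, hα, hε₁, hub⟩ := h.exists_slabMass_le_rpow hp hirr hK hμK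
  obtain ⟨c, t, ε₂, hc, hε₂, hlb⟩ := h.exists_rpow_le_tubeMass hp hK hμK ℓ
  refine ⟨α / 2, t + 1, by positivity, ?_⟩
  have e1 : ∀ᶠ ε in 𝓝[>] (0 : ℝ), ε < min 1 (min ε₁ ε₂) :=
    nhdsWithin_le_nhds (gt_mem_nhds (by positivity))
  have e2 := (tendsto_const_div_log_nhdsGT_zero (Real.log C)).eventually
    (lt_mem_nhds (show -(α / 2) < 0 by linarith))
  have e3 := (tendsto_const_div_log_nhdsGT_zero (Real.log c)).eventually
    (gt_mem_nhds (show (0 : ℝ) < 1 by norm_num))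
  filter_upwards [e1, e2, e3, self_mem_nhdsWithin] with ε h1 h2 h3 h0
  have hε0 : 0 < ε := h0
  have hlt1 : ε < 1 := h1.trans_le (min_le_left _ _)
  have hlt2 : ε < ε₁ := h1.trans_le ((min_le_right _ _).trans (min_le_left _ _))
  have hlt3 : ε < ε₂ := h1.trans_le ((min_le_right _ _).trans (min_le_right _ _))
  have hlog : Real.log ε < 0 := Real.log_neg hε0 hlt1
  have hl := hlb ε hε0 hlt3
  have hcε : 0 < c * ε ^ t := by positivity
  have hpos : 0 < tubeMass μ ℓ ε := hcε.trans_le hl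
  have hu : tubeMass μ ℓ ε ≤ C * ε ^ α := by
    refine Real.iSup_le (fun L => ?_) (by positivity)
    obtain ⟨n, c', hn, hsub⟩ := exists_thickening_subset_slab L.2.1 (by rw [L.2.2]; omega)
    have := ((measure_mono (hsub ε)).trans (measure_slab_le μ hn c' ε)).trans (hub ε hε0 hlt2.le)
    exact ENNReal.toReal_le_of_le_ofReal (by positivity) this
  refine ⟨hpos, ?_, ?_⟩
  · have h4 := Real.log_le_log hpos hu
    rw [Real.log_mul hC.ne' (by positivity), Real.log_rpow hε0] at h4
    rw [le_div_iff_of_neg hlog]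
    rw [lt_div_iff_of_neg hlog] at h2
    linarith
  · have h4 := Real.log_le_log hcε hl
    rw [Real.log_mul hc.ne' (by positivity), Real.log_rpow hε0] at h4
    rw [div_le_iff_of_neg hlog]
    rw [div_lt_iff_of_neg hlog] at h3
    linarith

/-- The two-sided bound of `eventually_log_tubeMass` shows that the lower limit defining `α_ℓ(μ)`
is a genuine one. -/
theorem IsSelfSimilar.decayExponent_pos (hp : ∀ i, 0 < p i) (h : F.IsSelfSimilar p μ)
    (hirr : F.IsIrreducible) (hK : F.IsLimitSet K) (hμK : μ Kᶜ = 0) {ℓ : ℕ} (hℓ : 1 ≤ ℓ)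
    (hℓd : ℓ ≤ d) : 0 < decayExponent μ ℓ := by
  obtain ⟨α, B, hα, hev⟩ := h.eventually_log_tubeMass hp hirr hK hμK hℓ hℓd
  have hbdd : IsBoundedUnder (· ≤ ·) (𝓝[>] (0 : ℝ))
      (fun ε => Real.log (tubeMass μ ℓ ε) / Real.log ε) := ⟨B, by
    rw [eventually_map]; exact hev.mono fun ε hε => hε.2.2⟩
  exact hα.trans_le (le_liminf_of_le hbdd.isCoboundedUnder_ge (hev.mono fun ε hε => hε.2.1))

theorem IsSelfSimilar.exists_measure_thickening_le_rpow (hp : ∀ i, 0 < p i)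
    (h : F.IsSelfSimilar p μ) (hirr : F.IsIrreducible) (hK : F.IsLimitSet K) (hμK : μ Kᶜ = 0)
    {ℓ : ℕ} (hℓ : 1 ≤ ℓ) (hℓd : ℓ ≤ d) {a : ℝ} (ha : a < decayExponent μ ℓ) :
    ∃ ε₁ : ℝ, 0 < ε₁ ∧ ∀ ε, 0 < ε → ε < ε₁ →
      ∀ L : AffineSubspace ℝ (EuclideanSpace ℝ (Fin d)), L ≠ ⊥ →
        Module.finrank ℝ L.direction = d - ℓ →
        μ (Metric.thickening ε (L : Set (EuclideanSpace ℝ (Fin d)))) ≤ ENNReal.ofReal (ε ^ a) := by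
  obtain ⟨α, B, hα, hev⟩ := h.eventually_log_tubeMass hp hirr hK hμK hℓ hℓd
  have hbdd : IsBoundedUnder (· ≥ ·) (𝓝[>] (0 : ℝ))
      (fun ε => Real.log (tubeMass μ ℓ ε) / Real.log ε) := ⟨α, by
    rw [eventually_map]; exact hev.mono fun ε hε => hε.2.1⟩
  rw [decayExponent_eq] at ha
  have h1 := eventually_lt_of_lt_liminf ha hbdd
  have h2 : ∀ᶠ ε in 𝓝[>] (0 : ℝ), ε < 1 := nhdsWithin_le_nhds (gt_mem_nhds one_pos)
  obtain ⟨ε₁, hε₁, hall⟩ := mem_nhdsGT_iff_exists_Ioo_subset.1 ((h1.and hev).and h2)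
  refine ⟨ε₁, hε₁, fun ε h0 hlt L hL hdim => ?_⟩
  obtain ⟨⟨h3, h4, -⟩, h5⟩ := hall ⟨h0, hlt⟩
  have hlog : Real.log ε < 0 := Real.log_neg h0 h5
  rw [lt_div_iff_of_neg hlog, ← Real.log_rpow h0] at h3
  have h6 := (Real.log_lt_log_iff h4 (by positivity)).1 h3
  have h7 := (measure_thickening_le_tubeMass μ ε hL hdim).trans h6.le
  rw [← ENNReal.ofReal_toReal (measure_ne_top μ _)]
  exact ENNReal.ofReal_le_ofReal h7

end SimilarityIFS

/-! ### Expansion of covolumes under the flow -/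

section Flow

variable {d : ℕ}

/-- The covector `(1, x)`; its pairing with `y` is the first coordinate of `u(x) y`. -/
def affLift (x : EuclideanSpace ℝ (Fin d)) : EuclideanSpace ℝ (Fin (d + 1)) :=
  WithLp.toLp 2 (Fin.cons 1 x.ofLp)

/-- The linear embedding `x ↦ (0, x)`. -/
def linLift : EuclideanSpace ℝ (Fin d) →ₗ[ℝ] EuclideanSpace ℝ (Fin (d + 1)) where
  toFun x := WithLp.toLp 2 (Fin.cons 0 x.ofLp)
  map_add' x y := by
    ext i; refine Fin.cases ?_ (fun i => ?_) i <;> simp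
  map_smul' c x := by
    ext i; refine Fin.cases ?_ (fun i => ?_) i <;> simp

@[simp] theorem affLift_zero (x : EuclideanSpace ℝ (Fin d)) : affLift x 0 = 1 := rfl

@[simp] theorem affLift_succ (x : EuclideanSpace ℝ (Fin d)) (i : Fin d) :
    affLift x i.succ = x i := rfl

@[simp] theorem linLift_zero (x : EuclideanSpace ℝ (Fin d)) : linLift x 0 = 0 := rfl

@[simp] theorem linLift_succ (x : EuclideanSpace ℝ (Fin d)) (i : Fin d) :
    linLift x i.succ = x i := rfl

theorem norm_linLift (x : EuclideanSpace ℝ (Fin d)) : ‖linLift x‖ = ‖x‖ := by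
  simp [EuclideanSpace.norm_eq, Fin.sum_univ_succ]

theorem affLift_eq (x : EuclideanSpace ℝ (Fin d)) :
    affLift x = EuclideanSpace.single 0 1 + linLift x := by
  ext i; refine Fin.cases ?_ (fun i => ?_) i <;> simp

theorem affLift_sub (x y : EuclideanSpace ℝ (Fin d)) :
    affLift x - affLift y = linLift (x - y) := by
  rw [affLift_eq, affLift_eq, map_sub]; abel

theorem norm_affLift_le (x : EuclideanSpace ℝ (Fin d)) : ‖affLift x‖ ≤ 1 + ‖x‖ := by
  rw [affLift_eq]
  refine (norm_add_le _ _).trans ?_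
  rw [norm_linLift, PiLp.norm_single, norm_one]

theorem continuous_affLift : Continuous (affLift (d := d)) := by
  have : (affLift (d := d))
      = fun x => EuclideanSpace.single 0 1 + linLift.toContinuousLinearMap x := by
    funext x; exact affLift_eq x
  rw [this]
  fun_prop

theorem slAct_uElt (x : EuclideanSpace ℝ (Fin d)) (y : EuclideanSpace ℝ (Fin (d + 1))) :
    slAct (uElt x) y = y + inner ℝ (linLift x) y • EuclideanSpace.single 0 (1 : ℝ) := by
  ext i
  refine Fin.cases ?_ (fun i => ?_) i
  · rw [slAct_apply]
    change (uMat x).mulVec y.ofLp 0 = _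
    simp [uMat, Matrix.mulVec, dotProduct, Fin.sum_univ_succ, PiLp.inner_apply, mul_comm]
  · rw [slAct_apply]
    change (uMat x).mulVec y.ofLp i.succ = _
    simp [uMat, Matrix.mulVec, dotProduct, Fin.sum_univ_succ, Pi.single_apply]

theorem slAct_uElt_zero (x : EuclideanSpace ℝ (Fin d)) (y : EuclideanSpace ℝ (Fin (d + 1))) :
    slAct (uElt x) y 0 = inner ℝ (affLift x) y := by
  rw [slAct_uElt, affLift_eq, inner_add_left, EuclideanSpace.inner_single_left]
  simp

theorem uElt_inv (x : EuclideanSpace ℝ (Fin d)) (y : EuclideanSpace ℝ (Fin (d + 1))) :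
    slAct (uElt x)⁻¹ y = slAct (uElt (-x)) y := by
  have h : slAct (uElt x) (slAct (uElt (-x)) y) = y := by
    rw [slAct_uElt, slAct_uElt, inner_add_right, inner_smul_right,
      EuclideanSpace.inner_single_right]
    simp
  conv_lhs => rw [← h, slAct_inv_slAct]

theorem norm_slAct_uElt_le (x : EuclideanSpace ℝ (Fin d)) (y : EuclideanSpace ℝ (Fin (d + 1))) :
    ‖slAct (uElt x) y‖ ≤ (1 + ‖x‖) * ‖y‖ := by
  rw [slAct_uElt, add_mul, one_mul]
  refine (norm_add_le _ _).trans (add_le_add le_rfl ?_)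
  rw [norm_smul, PiLp.norm_single, norm_one, mul_one, ← norm_linLift x]
  exact norm_inner_le_norm _ _

theorem norm_slAct_uElt_inv_le (x : EuclideanSpace ℝ (Fin d))
    (y : EuclideanSpace ℝ (Fin (d + 1))) : ‖slAct (uElt x)⁻¹ y‖ ≤ (1 + ‖x‖) * ‖y‖ := by
  rw [uElt_inv, ← norm_neg x]
  exact norm_slAct_uElt_le _ _

theorem gFlow_of_pos {t : ℝ} (ht : 0 < t) :
    gFlow d t = ⟨Matrix.diagonal (Fin.cons (t ^ (-(d : ℝ) / ((d : ℝ) + 1)))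
      (fun _ : Fin d => t ^ (1 / ((d : ℝ) + 1)))), det_diag_flow d ht⟩ := dif_pos ht

theorem slAct_gFlow_zero {t : ℝ} (ht : 0 < t) (y : EuclideanSpace ℝ (Fin (d + 1))) :
    slAct (gFlow d t) y 0 = t ^ (-(d : ℝ) / ((d : ℝ) + 1)) * y 0 := by
  rw [slAct_apply, gFlow_of_pos ht]
  change (Matrix.diagonal _).mulVec y.ofLp _ = _
  rw [Matrix.mulVec_diagonal]
  rfl

theorem slAct_gFlow_succ {t : ℝ} (ht : 0 < t) (y : EuclideanSpace ℝ (Fin (d + 1))) (i : Fin d) :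
    slAct (gFlow d t) y i.succ = t ^ (1 / ((d : ℝ) + 1)) * y i.succ := by
  rw [slAct_apply, gFlow_of_pos ht]
  change (Matrix.diagonal _).mulVec y.ofLp _ = _
  rw [Matrix.mulVec_diagonal]
  rfl

theorem gFlow_inv {t : ℝ} (ht : 0 < t) (y : EuclideanSpace ℝ (Fin (d + 1))) :
    slAct (gFlow d t)⁻¹ y = slAct (gFlow d t⁻¹) y := by
  have h : slAct (gFlow d t) (slAct (gFlow d t⁻¹) y) = y := by
    ext i
    refine Fin.cases ?_ (fun i => ?_) i
    · rw [slAct_gFlow_zero ht, slAct_gFlow_zero (inv_pos.2 ht), ← mul_assoc,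
        ← Real.mul_rpow ht.le (inv_pos.2 ht).le, mul_inv_cancel₀ ht.ne', Real.one_rpow, one_mul]
    · rw [slAct_gFlow_succ ht, slAct_gFlow_succ (inv_pos.2 ht), ← mul_assoc,
        ← Real.mul_rpow ht.le (inv_pos.2 ht).le, mul_inv_cancel₀ ht.ne', Real.one_rpow, one_mul]
  conv_lhs => rw [← h, slAct_inv_slAct]

theorem norm_le_of_coord_le {n : ℕ} {c : ℝ} (hc : 0 ≤ c) {y z : EuclideanSpace ℝ (Fin n)}
    (h : ∀ i, |z i| ≤ c * |y i|) : ‖z‖ ≤ c * ‖y‖ := by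
  rw [EuclideanSpace.norm_eq, EuclideanSpace.norm_eq, ← Real.sqrt_sq hc,
    ← Real.sqrt_mul (sq_nonneg c),
    Finset.mul_sum]
  refine Real.sqrt_le_sqrt (Finset.sum_le_sum fun i _ => ?_)
  rw [Real.norm_eq_abs, Real.norm_eq_abs, ← mul_pow]
  exact pow_le_pow_left₀ (abs_nonneg _) (h i) 2

theorem norm_slAct_gFlow_le {t c : ℝ} (ht : 0 < t) (h0 : t ^ (-(d : ℝ) / ((d : ℝ) + 1)) ≤ c)
    (h1 : t ^ (1 / ((d : ℝ) + 1)) ≤ c) (y : EuclideanSpace ℝ (Fin (d + 1))) :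
    ‖slAct (gFlow d t) y‖ ≤ c * ‖y‖ := by
  refine norm_le_of_coord_le ((Real.rpow_pos_of_pos ht _).le.trans h0) fun i => ?_
  refine Fin.cases ?_ (fun i => ?_) i
  · rw [slAct_gFlow_zero ht, abs_mul, abs_of_pos (Real.rpow_pos_of_pos ht _)]
    exact mul_le_mul_of_nonneg_right h0 (abs_nonneg _)
  · rw [slAct_gFlow_succ ht, abs_mul, abs_of_pos (Real.rpow_pos_of_pos ht _)]
    exact mul_le_mul_of_nonneg_right h1 (abs_nonneg _)

theorem norm_slAct_gFlow_le_inv {t : ℝ} (ht : 0 < t) (ht1 : t ≤ 1)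
    (y : EuclideanSpace ℝ (Fin (d + 1))) :
    ‖slAct (gFlow d t) y‖ ≤ t⁻¹ * ‖y‖ ∧ ‖slAct (gFlow d t)⁻¹ y‖ ≤ t⁻¹ * ‖y‖ := by
  have hd : (0 : ℝ) < (d : ℝ) + 1 := by positivity
  have e1 : (d : ℝ) / ((d : ℝ) + 1) ≤ 1 := by rw [div_le_one hd]; linarith
  have e2 : 1 / ((d : ℝ) + 1) ≤ 1 := by
    rw [div_le_one hd]; linarith [(Nat.cast_nonneg d : (0 : ℝ) ≤ d)]
  have e3 : (0 : ℝ) ≤ (d : ℝ) / ((d : ℝ) + 1) := by positivity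
  have e4 : (0 : ℝ) ≤ 1 / ((d : ℝ) + 1) := by positivity
  rw [gFlow_inv ht, show t⁻¹ * ‖y‖ = t ^ (-1 : ℝ) * ‖y‖ by rw [Real.rpow_neg_one]]
  refine ⟨norm_slAct_gFlow_le ht ?_ ?_ y, norm_slAct_gFlow_le (inv_pos.2 ht) ?_ ?_ y⟩
  · exact Real.rpow_le_rpow_of_exponent_ge ht ht1 (by rw [neg_div]; linarith)
  · exact Real.rpow_le_rpow_of_exponent_ge ht ht1 (by linarith)
  · rw [Real.inv_rpow ht.le, ← Real.rpow_neg ht.le]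
    exact Real.rpow_le_rpow_of_exponent_ge ht ht1 (by rw [neg_div]; linarith)
  · rw [Real.inv_rpow ht.le, ← Real.rpow_neg ht.le]
    exact Real.rpow_le_rpow_of_exponent_ge ht ht1 (by linarith)

/-- The expansion of the parallelepiped spanned by `v` under `g_t u(x)`, in terms of the length of
the projection of `(1, x)` to the span of `v`. -/
theorem covol_gFlow_uElt_ge {m : ℕ} {t : ℝ} (ht : 0 < t) (x : EuclideanSpace ℝ (Fin d))
    {v : Fin (m + 1) → EuclideanSpace ℝ (Fin (d + 1))} (hv : LinearIndependent ℝ v) :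
    ((1 + ‖x‖) ^ m)⁻¹ * t ^ (((m : ℝ) - d) / ((d : ℝ) + 1))
        * ‖(Submodule.span ℝ (Set.range v)).starProjection (affLift x)‖ * covol v
      ≤ covol (slAct (gFlow d t * uElt x) ∘ v) := by
  set V := Submodule.span ℝ (Set.range v) with hV
  set p := V.starProjection (affLift x) with hp
  by_cases hp0 : p = 0
  · rw [hp0, norm_zero, mul_zero, zero_mul]; exact covol_nonneg _
  have hppos : 0 < ‖p‖ := norm_pos_iff.2 hp0
  have hpV : p ∈ V := Submodule.starProjection_apply_mem _ _
  have hinner : ∀ y ∈ V, inner ℝ (affLift x) y = inner ℝ p y := by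
    intro y hy
    rw [hp, Submodule.inner_starProjection_left_eq_right, Submodule.starProjection_eq_self_iff.2 hy]
  -- an orthonormal basis of the orthogonal complement of `p` in `V`
  set V' : Submodule ℝ (EuclideanSpace ℝ (Fin (d + 1))) := (Submodule.span ℝ {p})ᗮ ⊓ V with hV'
  have hdim : Module.finrank ℝ V' = m := by
    have h1 := Submodule.finrank_add_inf_finrank_orthogonal
      (K₁ := Submodule.span ℝ {p}) (K₂ := V) (by
        rw [Submodule.span_singleton_le_iff_mem]; exact hpV)
    rw [finrank_span_singleton hp0, finrank_span_eq_card hv, Fintype.card_fin] at h1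
    rw [hV']
    omega
  obtain ⟨b⟩ : Nonempty (OrthonormalBasis (Fin m) ℝ V') :=
    ⟨(stdOrthonormalBasis ℝ V').reindex (finCongr hdim)⟩
  set q : Fin m → EuclideanSpace ℝ (Fin (d + 1)) := fun i => (b i : EuclideanSpace ℝ (Fin (d + 1)))
    with hq
  have hqV' : ∀ i, q i ∈ V' := fun i => (b i).2
  have hqo : Orthonormal ℝ q := by
    have := b.orthonormal.comp_linearIsometry V'.subtypeₗᵢ
    exact this
  have hqp : ∀ i, inner ℝ p (q i) = (0 : ℝ) := fun i =>
    Submodule.mem_orthogonal_singleton_iff_inner_right.1 (hqV' i).1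
  have hqspan : ∀ y ∈ V', y ∈ Submodule.span ℝ (Set.range q) := by
    intro y hy
    have h1 : (⟨y, hy⟩ : V') = ∑ i, b.repr ⟨y, hy⟩ i • b i := (b.sum_repr _).symm
    have h2 : y = ∑ i, b.repr ⟨y, hy⟩ i • q i := by
      simpa [hq] using congrArg Subtype.val h1
    rw [h2]
    exact Submodule.sum_mem _ fun i _ => Submodule.smul_mem _ _ (Submodule.subset_span ⟨i, rfl⟩)
  set w : Fin (m + 1) → EuclideanSpace ℝ (Fin (d + 1)) := Fin.snoc q p with hw
  have hwq : Submodule.span ℝ (Set.range q) ≤ Submodule.span ℝ (Set.range w) :=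
    Submodule.span_mono (by rintro _ ⟨i, rfl⟩; exact ⟨i.castSucc, by simp [hw]⟩)
  have hwp : p ∈ Submodule.span ℝ (Set.range w) :=
    Submodule.subset_span ⟨Fin.last m, by simp [hw]⟩
  have hVw : ∀ i, v i ∈ Submodule.span ℝ (Set.range w) := by
    intro i
    have hvi : v i ∈ V := Submodule.subset_span ⟨i, rfl⟩
    set c : ℝ := inner ℝ p (v i) / ‖p‖ ^ 2
    have h1 : v i - c • p ∈ V' := by
      refine ⟨?_, V.sub_mem hvi (V.smul_mem _ hpV)⟩
      rw [SetLike.mem_coe, Submodule.mem_orthogonal_singleton_iff_inner_right, inner_sub_right,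
        real_inner_smul_right, real_inner_self_eq_norm_sq, div_mul_cancel₀ _ (by positivity),
        sub_self]
    have h2 := Submodule.add_mem _ (hwq (hqspan _ h1)) (Submodule.smul_mem _ c hwp)
    simpa using h2
  have hcovw : covol w = ‖p‖ := by
    rw [hw, covol_snoc, covol_of_orthonormal hqo, one_mul,
      Submodule.starProjection_eq_self_iff.2]
    rw [Submodule.mem_orthogonal]
    intro y hy
    induction hy using Submodule.span_induction with
    | mem y hy => obtain ⟨i, rfl⟩ := hy; rw [real_inner_comm]; exact hqp i
    | zero => simp
    | add y z _ _ h1 h2 => rw [inner_add_left, h1, h2, add_zero]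
    | smul c y _ h1 => rw [real_inner_smul_left, h1, mul_zero]
  set T := slAct (gFlow d t * uElt x) with hT
  have hT0 : ∀ y ∈ V, T y 0 = t ^ (-(d : ℝ) / ((d : ℝ) + 1)) * inner ℝ p y := by
    intro y hy
    rw [hT, slAct_mul, slAct_gFlow_zero ht, slAct_uElt_zero, hinner y hy]
  -- on the complement of `p` the map `g_t` contracts by a scalar
  have hTq : ∀ i, T (q i) = t ^ (1 / ((d : ℝ) + 1)) • slAct (uElt x) (q i) := by
    intro i
    ext j
    have h0 : slAct (uElt x) (q i) 0 = 0 := by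
      rw [slAct_uElt_zero, hinner _ (hqV' i).2, hqp]
    refine Fin.cases ?_ (fun j => ?_) j
    · rw [hT0 _ (hqV' i).2, hqp, PiLp.smul_apply, h0]; simp
    · rw [hT, slAct_mul, slAct_gFlow_succ ht]; rfl
  set s := t ^ (1 / ((d : ℝ) + 1)) with hs
  have hspos : 0 < s := Real.rpow_pos_of_pos ht _
  have hcovq : (((1 + ‖x‖) * s⁻¹) ^ m)⁻¹ ≤ covol (T ∘ q) := by
    have h1 := covol_map_le (s⁻¹ • slAct (uElt x)⁻¹) (c := (1 + ‖x‖) * s⁻¹) (by positivity)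
      (fun y => by
        rw [LinearMap.smul_apply, norm_smul, Real.norm_eq_abs, abs_of_pos (by positivity),
          mul_comm (1 + ‖x‖), mul_assoc]
        exact mul_le_mul_of_nonneg_left (norm_slAct_uElt_inv_le x y) (by positivity)) (T ∘ q)
    have h2 : (s⁻¹ • slAct (uElt x)⁻¹ : _ →ₗ[ℝ] _) ∘ (T ∘ q) = q := by
      funext i
      simp only [Function.comp, hTq, LinearMap.smul_apply, map_smul, slAct_inv_slAct, smul_smul]
      rw [mul_inv_cancel₀ hspos.ne', one_smul]
    rw [h2, covol_of_orthonormal hqo] at h1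
    rw [inv_le_iff_one_le_mul₀' (by positivity)]
    exact h1
  have hTw : T ∘ w = (Fin.snoc (T ∘ q) (T p) : Fin (m + 1) → _) := by
    funext i
    refine Fin.lastCases ?_ (fun i => ?_) i <;> simp [hw]
  -- the first coordinate of `T p` is transverse to the span of `T ∘ q`
  have hcovTw : covol (T ∘ q) * (t ^ (-(d : ℝ) / ((d : ℝ) + 1)) * ‖p‖ ^ 2) ≤ covol (T ∘ w) := by
    rw [hTw, covol_snoc]
    refine mul_le_mul_of_nonneg_left ?_ (covol_nonneg _)
    set W := Submodule.span ℝ (Set.range (T ∘ q))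
    have he : (EuclideanSpace.single 0 (1 : ℝ) : EuclideanSpace ℝ (Fin (d + 1))) ∈ Wᗮ := by
      rw [Submodule.mem_orthogonal]
      intro y hy
      induction hy using Submodule.span_induction with
      | mem y hy =>
        obtain ⟨i, rfl⟩ := hy
        rw [EuclideanSpace.inner_single_right]
        simp [hT0 _ (hqV' i).2, hqp]
      | zero => simp
      | add y z _ _ h1 h2 => rw [inner_add_left, h1, h2, add_zero]
      | smul c y _ h1 => rw [real_inner_smul_left, h1, mul_zero]
    have h1 : inner ℝ (EuclideanSpace.single 0 (1 : ℝ)) (Wᗮ.starProjection (T p)) = T p 0 := by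
      rw [← Submodule.inner_starProjection_left_eq_right,
        Submodule.starProjection_eq_self_iff.2 he, EuclideanSpace.inner_single_left]
      simp
    rw [hT0 p hpV, real_inner_self_eq_norm_sq] at h1
    rw [← h1]
    refine (real_inner_le_norm _ _).trans ?_
    rw [PiLp.norm_single, norm_one, one_mul]
  have hmain := covol_map_mul_covol T hVw
  rw [hcovw] at hmain
  have hpow : s ^ m * t ^ (-(d : ℝ) / ((d : ℝ) + 1)) = t ^ (((m : ℝ) - d) / ((d : ℝ) + 1)) := by
    rw [hs, ← Real.rpow_natCast, ← Real.rpow_mul ht.le, ← Real.rpow_add ht]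
    congr 1
    field_simp
    ring
  have hfin : ((1 + ‖x‖) ^ m)⁻¹ * t ^ (((m : ℝ) - d) / ((d : ℝ) + 1)) * ‖p‖ ^ 2
      ≤ covol (T ∘ w) := by
    refine le_trans (le_of_eq ?_)
      (le_trans (mul_le_mul_of_nonneg_right hcovq (by positivity)) hcovTw)
    rw [← hpow, mul_pow, mul_inv, inv_pow, inv_inv]
    ring
  have h5 := mul_le_mul_of_nonneg_right hfin (covol_nonneg v)
  rw [← hmain] at h5
  refine le_of_mul_le_mul_right (le_trans (le_of_eq ?_) h5) hppos
  ring

end Flow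

/-! ### Negative moments of projections -/

section NegativeMoments

/-- Polynomial decay of the distribution function near zero bounds negative moments, by a dyadic
decomposition. The bound depends on the constants only. -/
theorem exists_lintegral_rpow_neg_le {α : Type*} [MeasurableSpace α] {C a θ t₀ : ℝ} (hC : 0 ≤ C)
    (hθ : 0 < θ) (hθa : θ < a) (ht₀ : 0 < t₀) :
    ∃ B : ℝ, 0 < B ∧ ∀ (μ : Measure α) [IsProbabilityMeasure μ] (f : α → ℝ), Measurable f →
      (∀ x, 0 ≤ f x) → (∀ t, 0 < t → t ≤ t₀ → μ {x | f x ≤ t} ≤ ENNReal.ofReal (C * t ^ a)) →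
      ∫⁻ x, ENNReal.ofReal (f x) ^ (-θ) ∂μ ≤ ENNReal.ofReal B := by
  set w : ℕ → ℝ := fun n => (t₀ * 2⁻¹ ^ (n + 1)) ^ (-θ) with hw
  set e : ℕ → ℝ := fun n => C * (t₀ * 2⁻¹ ^ n) ^ a with he
  have hw0 : ∀ n, 0 < w n := fun n => by positivity
  have he0 : ∀ n, 0 ≤ e n := fun n => by positivity
  have hterm : ∀ n, w n * e n
      = (t₀ ^ (-θ) * (2⁻¹ : ℝ) ^ (-θ) * C * t₀ ^ a) * ((2⁻¹ : ℝ) ^ (a - θ)) ^ n := by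
    intro n
    have e1 : ∀ (m : ℕ) (b : ℝ), (t₀ * 2⁻¹ ^ m) ^ b = t₀ ^ b * ((2⁻¹ : ℝ) ^ b) ^ m := by
      intro m b
      rw [Real.mul_rpow ht₀.le (by positivity), ← Real.rpow_natCast, ← Real.rpow_mul (by norm_num),
        mul_comm (m : ℝ), Real.rpow_mul (by norm_num), Real.rpow_natCast]
    simp only [hw, he, e1]
    rw [sub_eq_add_neg, Real.rpow_add (by norm_num), mul_pow, pow_succ]
    ring
  have hsum : Summable fun n => w n * e n := by
    simp only [hterm]
    exact (summable_geometric_of_lt_one (by positivity)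
      (Real.rpow_lt_one (by norm_num) (by norm_num) (by linarith))).mul_left _
  refine ⟨t₀ ^ (-θ) + ∑' n, w n * e n, add_pos_of_pos_of_nonneg (by positivity)
    (tsum_nonneg fun n => mul_nonneg (hw0 n).le (he0 n)), ?_⟩
  intro μ _ f hf hf0 hμ
  have hnull : μ {x | f x ≤ 0} = 0 := by
    have h1 : Tendsto (fun n => ENNReal.ofReal (e n)) atTop (𝓝 0) := by
      have h2 : Tendsto e atTop (𝓝 0) := by
        have h3 : e = fun n => C * t₀ ^ a * ((2⁻¹ : ℝ) ^ a) ^ n := by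
          funext n
          simp only [he]
          rw [Real.mul_rpow ht₀.le (by positivity), ← Real.rpow_natCast,
            ← Real.rpow_mul (by norm_num), mul_comm (n : ℝ), Real.rpow_mul (by norm_num),
            Real.rpow_natCast, mul_assoc]
        rw [h3]
        simpa using (tendsto_pow_atTop_nhds_zero_of_lt_one (by positivity)
          (Real.rpow_lt_one (by norm_num) (by norm_num) (by linarith : 0 < a))).const_mul
            (C * t₀ ^ a)
      simpa using ENNReal.tendsto_ofReal h2
    refine le_antisymm (ge_of_tendsto' h1 fun n => ?_) zero_le
    refine (measure_mono fun x hx => ?_).trans (hμ (t₀ * 2⁻¹ ^ n) (by positivity)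
      (mul_le_of_le_one_right ht₀.le (pow_le_one₀ (by norm_num) (by norm_num))))
    exact (show f x ≤ 0 from hx).trans (by positivity)
  have hae : ∀ᵐ x ∂μ, ENNReal.ofReal (f x) ^ (-θ) ≤ ENNReal.ofReal (t₀ ^ (-θ)) +
      ∑' n, ENNReal.ofReal (w n) * {x | f x ≤ t₀ * 2⁻¹ ^ n}.indicator 1 x := by
    have : ∀ᵐ x ∂μ, 0 < f x := by
      rw [ae_iff]; simpa using hnull
    filter_upwards [this] with x hx
    rw [ENNReal.ofReal_rpow_of_pos hx]
    by_cases hxt : t₀ ≤ f x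
    · refine le_add_right (ENNReal.ofReal_le_ofReal ?_)
      exact Real.rpow_le_rpow_of_nonpos ht₀ hxt (by linarith)
    · obtain ⟨n, hn1, hn2⟩ := exists_nat_pow_near_of_lt_one (x := f x / t₀) (by positivity)
        ((div_le_one ht₀).2 (not_le.1 hxt).le) (show (0 : ℝ) < 2⁻¹ by norm_num) (by norm_num)
      rw [lt_div_iff₀' ht₀] at hn1
      rw [div_le_iff₀' ht₀] at hn2
      refine le_add_left ((?_ : _ ≤ _).trans (ENNReal.le_tsum n))
      rw [Set.indicator_of_mem (by exact hn2), Pi.one_apply, mul_one]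
      refine ENNReal.ofReal_le_ofReal ?_
      exact Real.rpow_le_rpow_of_nonpos (by positivity) hn1.le (by linarith)
  have hmeas : ∀ n : ℕ, MeasurableSet {x | f x ≤ t₀ * 2⁻¹ ^ n} := fun n =>
    measurableSet_le hf measurable_const
  refine (lintegral_mono_ae hae).trans ?_
  rw [lintegral_add_left measurable_const, lintegral_const, measure_univ, mul_one,
    lintegral_tsum fun n => ((measurable_one.indicator (hmeas n)).const_mul _).aemeasurable,
    ENNReal.ofReal_add (by positivity) (tsum_nonneg fun n => mul_nonneg (hw0 n).le (he0 n)),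
    ENNReal.ofReal_tsum_of_nonneg (fun n => mul_nonneg (hw0 n).le (he0 n)) hsum]
  refine add_le_add le_rfl (ENNReal.tsum_le_tsum fun n => ?_)
  rw [lintegral_const_mul _ (measurable_one.indicator (hmeas n)), lintegral_indicator_one (hmeas n),
    ENNReal.ofReal_mul (hw0 n).le]
  exact mul_le_mul_right (hμ _ (by positivity)
    (mul_le_of_le_one_right ht₀.le (pow_le_one₀ (by norm_num) (by norm_num)))) _

end NegativeMoments

section Projection

variable {d : ℕ}

/-- The points `x` of a bounded set for which `(1, x)` is nearly orthogonal to an `ℓ`-dimensional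
subspace lie near an affine subspace of dimension `d - ℓ`, namely the set of those `z` for which
`(1, z)` is orthogonal to the given subspace. -/
theorem exists_subset_thickening {ℓ : ℕ}
    (V : Submodule ℝ (EuclideanSpace ℝ (Fin (d + 1)))) (hV : Module.finrank ℝ V = ℓ) {R t : ℝ}
    (ht : 0 < t) (ht2 : t ≤ 1 / 2)
    (hne : ∃ x : EuclideanSpace ℝ (Fin d), ‖x‖ ≤ R ∧ ‖V.starProjection (affLift x)‖ ≤ t) :
    ∃ L : AffineSubspace ℝ (EuclideanSpace ℝ (Fin d)), L ≠ ⊥ ∧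
      Module.finrank ℝ L.direction = d - ℓ ∧
      {x | ‖x‖ ≤ R ∧ ‖V.starProjection (affLift x)‖ ≤ t}
        ⊆ Metric.thickening ((2 * R + 4) * t) (L : Set (EuclideanSpace ℝ (Fin d))) := by
  have key : ∀ x : EuclideanSpace ℝ (Fin d), ‖x‖ ≤ R → ‖V.starProjection (affLift x)‖ ≤ t →
      ∃ z : EuclideanSpace ℝ (Fin d), affLift z ∈ Vᗮ ∧ dist x z < (2 * R + 4) * t := by
    intro x hxR hxt
    have hR0 : 0 ≤ R := (norm_nonneg x).trans hxR
    set y := Vᗮ.starProjection (affLift x) with hy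
    have hyV : y ∈ Vᗮ := Submodule.starProjection_apply_mem _ _
    have hdist : ‖affLift x - y‖ ≤ t := by
      have := Submodule.starProjection_add_starProjection_orthogonal (K := V) (affLift x)
      rw [← hy] at this
      rwa [← eq_sub_iff_add_eq.2 this]
    have hynorm : ‖y‖ ≤ 1 + R := (Submodule.norm_starProjection_apply_le _ _).trans
      ((norm_affLift_le x).trans (by linarith))
    have hy0 : |1 - y 0| ≤ t := by
      have := (PiLp.norm_apply_le (affLift x - y) 0).trans hdist
      simpa using this
    have hy0' : 1 / 2 ≤ y 0 := by
      have := (abs_le.1 hy0).2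
      linarith
    have hy0pos : 0 < y 0 := by linarith
    set z : EuclideanSpace ℝ (Fin d) := WithLp.toLp 2 fun j => (y 0)⁻¹ * y j.succ with hz
    have hlz : affLift z = (y 0)⁻¹ • y := by
      ext i
      refine Fin.cases ?_ (fun i => ?_) i
      · simp [hy0pos.ne']
      · simp [hz]
    refine ⟨z, hlz ▸ Submodule.smul_mem _ _ hyV, ?_⟩
    rw [dist_eq_norm, ← norm_linLift, ← affLift_sub, hlz]
    have h1 : affLift x - (y 0)⁻¹ • y = (affLift x - y) + (1 - (y 0)⁻¹) • y := by
      rw [sub_smul, one_smul]; abel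
    have h2 : |1 - (y 0)⁻¹| ≤ 2 * t := by
      have : 1 - (y 0)⁻¹ = -((1 - y 0) / y 0) := by field_simp; ring
      rw [this, abs_neg, abs_div, abs_of_pos hy0pos, div_le_iff₀ hy0pos]
      nlinarith
    rw [h1]
    refine (norm_add_le _ _).trans_lt ?_
    rw [norm_smul, Real.norm_eq_abs]
    have h3 : |1 - (y 0)⁻¹| * ‖y‖ ≤ 2 * t * (1 + R) :=
      mul_le_mul h2 hynorm (norm_nonneg _) (by linarith)
    nlinarith
  obtain ⟨x₀, hx₀R, hx₀t⟩ := hne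
  obtain ⟨z₀, hz₀, -⟩ := key x₀ hx₀R hx₀t
  set D : Submodule ℝ (EuclideanSpace ℝ (Fin d)) := Vᗮ.comap linLift with hD
  have hlinj : Function.Injective (linLift (d := d)) := by
    intro x y h
    have h1 : ‖x - y‖ = 0 := by rw [← norm_linLift, map_sub, h, sub_self, norm_zero]
    exact sub_eq_zero.1 (norm_eq_zero.1 h1)
  have hdim : Module.finrank ℝ D = d - ℓ := by
    set φ : Module.Dual ℝ Vᗮ :=
      (EuclideanSpace.proj (𝕜 := ℝ) (0 : Fin (d + 1))).toLinearMap ∘ₗ Vᗮ.subtype with hφ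
    have hφne : φ ≠ 0 := by
      intro h
      have h1 : φ ⟨affLift z₀, hz₀⟩ = 1 := by simp [hφ]
      rw [h] at h1
      simp at h1
    have h1 := Module.Dual.finrank_ker_add_one_of_ne_zero hφne
    have h2 := Submodule.finrank_add_finrank_orthogonal V
    rw [hV, finrank_euclideanSpace_fin] at h2
    have h3 : (LinearMap.ker φ).map Vᗮ.subtype = D.map linLift := by
      ext y
      constructor
      · rintro ⟨⟨y, hyV⟩, hy0, rfl⟩
        have hy0' : y 0 = 0 := hy0
        have hy : linLift (WithLp.toLp 2 fun j => y j.succ) = y := by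
          ext i
          refine Fin.cases ?_ (fun i => ?_) i
          · simp [hy0']
          · simp
        exact ⟨WithLp.toLp 2 fun j => y j.succ, by
          change linLift _ ∈ Vᗮ
          rw [hy]; exact hyV, hy⟩
      · rintro ⟨x, hx, rfl⟩
        exact ⟨⟨linLift x, hx⟩, by simp [hφ], rfl⟩
    have h4 := Submodule.finrank_map_subtype_eq Vᗮ (LinearMap.ker φ)
    have h5 := (Submodule.equivMapOfInjective linLift hlinj D).finrank_eq
    rw [h3] at h4
    omega
  refine ⟨AffineSubspace.mk' z₀ D, (AffineSubspace.nonempty_iff_ne_bot _).1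
    ⟨z₀, AffineSubspace.self_mem_mk' _ _⟩, by rw [AffineSubspace.direction_mk', hdim], ?_⟩
  rintro x ⟨hxR, hxt⟩
  obtain ⟨z, hz, hdist⟩ := key x hxR hxt
  refine Metric.mem_thickening_iff.2 ⟨z, ?_, hdist⟩
  rw [SetLike.mem_coe, AffineSubspace.mem_mk', vsub_eq_sub]
  change linLift (z - z₀) ∈ Vᗮ
  rw [← affLift_sub]
  exact Submodule.sub_mem _ hz hz₀

end Projection

namespace SimilarityIFS

variable {d : ℕ} {Λ : Type*} [Fintype Λ] {F : SimilarityIFS d Λ} {p : Λ → ℝ}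
  {μ : Measure (EuclideanSpace ℝ (Fin d))} [IsProbabilityMeasure μ]
  {K : Set (EuclideanSpace ℝ (Fin d))}

/-- Negative moments, below the exponent `α_ℓ(μ)`, of the length of the projection of `(1, x)` to
an `ℓ`-dimensional subspace are bounded uniformly in the subspace. -/
theorem IsSelfSimilar.exists_lintegral_projection_le (hp : ∀ i, 0 < p i)
    (h : F.IsSelfSimilar p μ) (hirr : F.IsIrreducible) (hK : F.IsLimitSet K) (hμK : μ Kᶜ = 0)
    {ℓ : ℕ} (hℓ : 1 ≤ ℓ) (hℓd : ℓ ≤ d) {θ : ℝ} (hθ : 0 < θ) (hθα : θ < decayExponent μ ℓ) :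
    ∃ B : ℝ, 0 < B ∧ ∀ V : Submodule ℝ (EuclideanSpace ℝ (Fin (d + 1))),
      Module.finrank ℝ V = ℓ →
      ∫⁻ x, ENNReal.ofReal ‖V.starProjection (affLift x)‖ ^ (-θ) ∂μ ≤ ENNReal.ofReal B := by
  obtain ⟨a, hθa, haα⟩ := exists_between hθα
  obtain ⟨ε₁, hε₁, hbd⟩ := h.exists_measure_thickening_le_rpow hp hirr hK hμK hℓ hℓd haα
  obtain ⟨R, hR⟩ := hK.2.1.isBounded.exists_norm_le
  have hR0 : 0 ≤ R := by
    obtain ⟨x, hx⟩ := hK.1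
    exact (norm_nonneg x).trans (hR x hx)
  set c := 2 * R + 4 with hc
  have hc0 : 0 < c := by positivity
  obtain ⟨B, hB, hall⟩ := exists_lintegral_rpow_neg_le (α := EuclideanSpace ℝ (Fin d))
    (C := c ^ a) (a := a) (θ := θ) (t₀ := min (1 / 2) (ε₁ / (2 * c))) (by positivity) hθ hθa
    (by positivity)
  refine ⟨B, hB, fun V hV => hall μ _ ?_ (fun x => norm_nonneg _) fun t ht0 ht => ?_⟩
  · exact ((V.starProjection.continuous.comp continuous_affLift).norm).measurable
  have ht1 : t ≤ 1 / 2 := ht.trans (min_le_left _ _)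
  have ht2 : c * t < ε₁ := by
    have := ht.trans (min_le_right _ _)
    rw [le_div_iff₀ (by positivity)] at this
    nlinarith
  rw [← measure_inter_conull hμK, ← Real.mul_rpow hc0.le ht0.le]
  by_cases hne : ∃ x : EuclideanSpace ℝ (Fin d), ‖x‖ ≤ R ∧ ‖V.starProjection (affLift x)‖ ≤ t
  · obtain ⟨L, hL, hdim, hsub⟩ := exists_subset_thickening V hV ht0 ht1 hne
    exact (measure_mono fun x hx => hsub ⟨hR x hx.2, hx.1⟩).trans
      (hbd (c * t) (by positivity) ht2 L hL hdim)
  · have : {x | ‖V.starProjection (affLift x)‖ ≤ t} ∩ K = ∅ := by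
      rw [Set.eq_empty_iff_forall_notMem]
      exact fun x hx => hne ⟨x, hR x hx.2, hx.1⟩
    rw [this, measure_empty]
    exact zero_le

end SimilarityIFS

/-! ### The Margulis function -/

section Exponents

variable {d : ℕ} {μ : Measure (EuclideanSpace ℝ (Fin d))}

theorem varpi_le {ℓ : ℕ} (hℓ : 1 ≤ ℓ) (hℓd : ℓ ≤ d) :
    varpi μ ≤ decayExponent μ ℓ * ((d : ℝ) - ℓ + 1) :=
  ciInf_le (f := fun ℓ : Set.Icc 1 d => decayExponent μ ℓ * ((d : ℝ) - (ℓ : ℕ) + 1))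
    (Set.finite_range _).bddBelow ⟨ℓ, hℓ, hℓd⟩

theorem varpi_pos (hd : 1 ≤ d) (hα : ∀ ℓ, 1 ≤ ℓ → ℓ ≤ d → 0 < decayExponent μ ℓ) :
    0 < varpi μ := by
  have : Nonempty (Set.Icc 1 d) := ⟨⟨1, le_refl 1, hd⟩⟩
  obtain ⟨ℓ, hℓ⟩ := exists_eq_ciInf_of_finite
    (f := fun ℓ : Set.Icc 1 d => decayExponent μ ℓ * ((d : ℝ) - (ℓ : ℕ) + 1))
  rw [varpi, ← hℓ]
  have h1 : ((ℓ : ℕ) : ℝ) ≤ d := by exact_mod_cast ℓ.2.2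
  exact mul_pos (hα _ ℓ.2.1 ℓ.2.2) (by linarith)

theorem betaMin_eq : betaMin μ = varpi μ / ((d : ℝ) + 1) := by
  have h : (0 : ℝ) ≤ ((d : ℝ) + 1)⁻¹ := by positivity
  rw [betaMin, varpi, div_eq_mul_inv, Real.iInf_mul_of_nonneg h]
  simp only [div_eq_mul_inv]

theorem div_betaExp (ϱ : ℝ) (ℓ : ℕ) :
    ϱ / betaExp μ ℓ = ϱ * varpi μ / ((d : ℝ) - ℓ + 1) := by
  rw [betaExp, div_div_eq_mul_div]

theorem div_betaExp_nonneg {ϱ : ℝ} (hϱ : 0 ≤ ϱ) (hϖ : 0 ≤ varpi μ) {ℓ : ℕ} (hℓd : ℓ ≤ d) :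
    0 ≤ ϱ / betaExp μ ℓ := by
  have : (ℓ : ℝ) ≤ d := by exact_mod_cast hℓd
  rw [div_betaExp]
  exact div_nonneg (mul_nonneg hϱ hϖ) (by linarith)

theorem div_betaExp_le_varpi {ϱ : ℝ} (hϱ1 : ϱ ≤ 1) (hϖ : 0 ≤ varpi μ) {ℓ : ℕ} (hℓd : ℓ ≤ d) :
    ϱ / betaExp μ ℓ ≤ varpi μ := by
  have : (ℓ : ℝ) ≤ d := by exact_mod_cast hℓd
  rw [div_betaExp, div_le_iff₀ (by linarith)]
  nlinarith

theorem div_betaExp_le_mul {ϱ : ℝ} (hϱ : 0 ≤ ϱ) {ℓ : ℕ} (hℓ : 1 ≤ ℓ) (hℓd : ℓ ≤ d) :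
    ϱ / betaExp μ ℓ ≤ ϱ * decayExponent μ ℓ := by
  have : (ℓ : ℝ) ≤ d := by exact_mod_cast hℓd
  rw [div_betaExp, div_le_iff₀ (by linarith), mul_assoc]
  exact mul_le_mul_of_nonneg_left (varpi_le hℓ hℓd) hϱ

theorem betaMin_le_varpi (hϖ : 0 ≤ varpi μ) : betaMin μ ≤ varpi μ := by
  rw [betaMin_eq]
  exact div_le_self hϖ (by linarith [(Nat.cast_nonneg d : (0 : ℝ) ≤ d)])

theorem betaMin_pos (hϖ : 0 < varpi μ) : 0 < betaMin μ := by
  rw [betaMin_eq]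
  positivity

end Exponents

section PhiDichotomy

variable {d : ℕ}

theorem phi_pos {ℓ : ℕ} (hℓ : ℓ ≤ d + 1) (x : LatticeSpace d) : 0 < phi ℓ x := by
  induction x using QuotientGroup.induction_on with
  | H g =>
    have h1 : LinearIndependent ℝ
        (slAct g ∘ fun i : Fin ℓ => EuclideanSpace.single (Fin.castLE hℓ i) (1 : ℝ)) :=
      linearIndependent_slAct_comp g
        ((EuclideanSpace.orthonormal_single (𝕜 := ℝ) (ι := Fin (d + 1))).linearIndependent.comp
          (Fin.castLE hℓ) (Fin.castLE_injective hℓ))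
    refine (inv_pos.2 (covol_pos h1)).trans_le (inv_covol_le_phi h1 fun i => ?_)
    refine mem_latticeOf_mk.2 ⟨Pi.single (Fin.castLE hℓ i) 1, ?_⟩
    rw [latticeHom_eq_slAct, Function.comp]
    congr 1
    ext j
    by_cases h : j = Fin.castLE hℓ i <;> simp [intVec, h]

/-- `phi`, extended to the ranks `0` and `d + 1` by the value `1`. -/
def phiExt (j : ℕ) (x : LatticeSpace d) : ℝ := if 1 ≤ j ∧ j ≤ d then phi j x else 1

theorem phiExt_pos (j : ℕ) (x : LatticeSpace d) : 0 < phiExt j x := by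
  rw [phiExt]
  split_ifs with h
  · exact phi_pos (by omega) x
  · exact one_pos

theorem inv_covol_le_phiExt {j : ℕ} (hj : j ≤ d + 1) {x : LatticeSpace d}
    {v : Fin j → EuclideanSpace ℝ (Fin (d + 1))} (hv : LinearIndependent ℝ v)
    (hmem : ∀ i, v i ∈ latticeOf x) : (covol v)⁻¹ ≤ phiExt j x := by
  rw [phiExt]
  split_ifs with h
  · exact inv_covol_le_phi hv hmem
  · rcases Nat.eq_zero_or_pos j with rfl | h0
    · rw [covol_of_isEmpty, inv_one]
    · obtain rfl : j = d + 1 := by omega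
      exact inv_le_one_of_one_le₀ (one_le_covol_of_full_rank hv hmem)

/-- Either a single primitive subgroup controls `phi` along all bounded translates of the lattice,
or `phi ℓ` is dominated by its values at ranks `ℓ - i` and `ℓ + i`, for some `i ≥ 1`. -/
theorem phi_dichotomy (x : LatticeSpace d) {ℓ : ℕ} (hℓd : ℓ ≤ d) {A : ℝ} (hA : 1 ≤ A) :
    (∃ v : Fin ℓ → EuclideanSpace ℝ (Fin (d + 1)), IsPrimitiveBasis x v ∧
      ∀ (h : SLR d) (a : ℝ), 0 ≤ a → a ^ ℓ ≤ A → (∀ y, ‖slAct h y‖ ≤ a * ‖y‖) →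
        (∀ y, ‖slAct h⁻¹ y‖ ≤ a * ‖y‖) → phi ℓ (h • x) ≤ (covol (slAct h ∘ v))⁻¹) ∨
    ∃ i, 1 ≤ i ∧ i ≤ ℓ ∧ ℓ + i ≤ d + 1 ∧
      phi ℓ x ^ 2 ≤ (2 * A) ^ 2 * (phiExt (ℓ - i) x * phiExt (ℓ + i) x) := by
  have hφ : 0 < phi ℓ x := phi_pos (by omega) x
  have hA0 : 0 < A := one_pos.trans_le hA
  obtain ⟨v, hv, hvφ⟩ : ∃ v : Fin ℓ → EuclideanSpace ℝ (Fin (d + 1)), IsPrimitiveBasis x v ∧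
      phi ℓ x / 2 < (covol v)⁻¹ := by
    by_contra! hcon
    have := phi_le (by positivity) hcon
    linarith
  have hvc := covol_pos hv.1
  -- `2 * A ^ 2` is the ratio of covolumes that a matrix with constant `A` cannot reverse
  by_cases hall : ∀ w : Fin ℓ → EuclideanSpace ℝ (Fin (d + 1)), IsPrimitiveBasis x w →
      phi ℓ x / (2 * A ^ 2) ≤ (covol w)⁻¹ →
      Submodule.span ℤ (Set.range v) = Submodule.span ℤ (Set.range w)
  · refine Or.inl ⟨v, hv, fun h a ha haA hb hb' => ?_⟩
    have hhv := linearIndependent_slAct_comp h hv.1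
    refine phi_le (inv_nonneg.2 (covol_nonneg _)) fun w' hw' => ?_
    have hw := hw'.of_slAct
    set w := slAct h⁻¹ ∘ w' with hwdef
    by_cases hbig : phi ℓ x / (2 * A ^ 2) ≤ (covol w)⁻¹
    · have hspan := hall w hw hbig
      refine inv_anti₀ (covol_pos hhv) (covol_le_of_mem_closure (Equiv.refl _) hw'.1 fun i => ?_)
      have h1 : w i ∈ Submodule.span ℤ (Set.range v) := hspan ▸ Submodule.subset_span ⟨i, rfl⟩
      rw [← SetLike.mem_coe, closure_range_eq_span_int]
      have h2 := Submodule.mem_map_of_mem (f := (slAct h).restrictScalars ℤ) h1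
      rw [Submodule.map_span, ← Set.range_comp] at h2
      have h3 : (slAct h).restrictScalars ℤ (w i) = w' i := slAct_slAct_inv h (w' i)
      rw [h3] at h2
      exact h2
    · have hwc := covol_pos hw.1
      have hw'c := covol_pos hw'.1
      have h1 : covol w ≤ A * covol w' := (covol_map_le (slAct h⁻¹) ha hb' w').trans
        (mul_le_mul_of_nonneg_right haA hw'c.le)
      have h2 : covol (slAct h ∘ v) ≤ A * covol v := (covol_map_le (slAct h) ha hb v).trans
        (mul_le_mul_of_nonneg_right haA hvc.le)
      have h3 : (covol w')⁻¹ ≤ A * (covol w)⁻¹ := by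
        rw [← div_eq_mul_inv, le_div_iff₀ hwc, inv_mul_le_iff₀ hw'c, mul_comm]
        exact h1
      have h4 : (A * covol v)⁻¹ ≤ (covol (slAct h ∘ v))⁻¹ := inv_anti₀ (covol_pos hhv) h2
      refine le_trans ?_ h4
      calc (covol w')⁻¹ ≤ A * (phi ℓ x / (2 * A ^ 2)) :=
            h3.trans (mul_le_mul_of_nonneg_left (not_le.1 hbig).le hA0.le)
        _ = A⁻¹ * (phi ℓ x / 2) := by field_simp
        _ ≤ A⁻¹ * (covol v)⁻¹ := mul_le_mul_of_nonneg_left hvφ.le (by positivity)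
        _ = _ := by rw [mul_inv]
  · push Not at hall
    obtain ⟨w, hw, hwφ, hne⟩ := hall
    have hwc := covol_pos hw.1
    obtain ⟨i, hi1, hiℓ, hid, a, b, ha, hb, hamem, hbmem, hle⟩ := hv.exists_inf_sup hw hne
    refine Or.inr ⟨i, hi1, hiℓ, hid, ?_⟩
    have h1 := inv_covol_le_phiExt (by omega) ha hamem
    have h2 := inv_covol_le_phiExt hid hb hbmem
    have h3 : (covol v * covol w)⁻¹ ≤ (covol a * covol b)⁻¹ :=
      inv_anti₀ (mul_pos (covol_pos ha) (covol_pos hb)) hle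
    have h4 : (covol a * covol b)⁻¹ ≤ phiExt (ℓ - i) x * phiExt (ℓ + i) x := by
      rw [mul_inv]
      exact mul_le_mul h1 h2 (inv_nonneg.2 (covol_nonneg _)) (phiExt_pos _ _).le
    have h5 : phi ℓ x / 2 * (phi ℓ x / (2 * A ^ 2)) ≤ (covol v * covol w)⁻¹ := by
      rw [mul_inv]
      exact mul_le_mul hvφ.le hwφ (by positivity) (by positivity)
    have h6 := h5.trans (h3.trans h4)
    calc phi ℓ x ^ 2 = (2 * A) ^ 2 * (phi ℓ x / 2 * (phi ℓ x / (2 * A ^ 2))) := by field_simp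
      _ ≤ _ := mul_le_mul_of_nonneg_left h6 (by positivity)

end PhiDichotomy

section Margulis

variable {d : ℕ} {μ : Measure (EuclideanSpace ℝ (Fin d))}

theorem margulisFun_term_nonneg {ε ϱ : ℝ} (hε : 0 ≤ ε) (ℓ : ℕ) (x : LatticeSpace d) :
    0 ≤ ε ^ ℓ * phi ℓ x ^ (ϱ / betaExp μ ℓ) :=
  mul_nonneg (pow_nonneg hε _) (Real.rpow_nonneg (phi_nonneg _ _) _)

theorem two_le_margulisFun {ε ϱ : ℝ} (hε : 0 ≤ ε) (x : LatticeSpace d) :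
    2 ≤ margulisFun μ ε ϱ x :=
  le_add_of_nonneg_right (Finset.sum_nonneg fun ℓ _ => margulisFun_term_nonneg hε ℓ x)

theorem margulisFun_term_le {ε ϱ : ℝ} (hε : 0 ≤ ε) {ℓ : ℕ} (hℓ : 1 ≤ ℓ) (hℓd : ℓ ≤ d)
    (x : LatticeSpace d) :
    ε ^ ℓ * phi ℓ x ^ (ϱ / betaExp μ ℓ) ≤ margulisFun μ ε ϱ x := by
  have := Finset.single_le_sum (f := fun ℓ => ε ^ ℓ * phi ℓ x ^ (ϱ / betaExp μ ℓ))
    (fun ℓ _ => margulisFun_term_nonneg hε ℓ x) (Finset.mem_Icc.2 ⟨hℓ, hℓd⟩)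
  rw [margulisFun]
  linarith

theorem phi_rpow_smul_le (hϖ : 0 ≤ varpi μ) {ϱ : ℝ} (hϱ : 0 ≤ ϱ) (hϱ1 : ϱ ≤ 1) {h : SLR d} {a : ℝ}
    (ha : 1 ≤ a) (hb : ∀ y, ‖slAct h⁻¹ y‖ ≤ a * ‖y‖) {ℓ : ℕ} (hℓd : ℓ ≤ d) (x : LatticeSpace d) :
    phi ℓ (h • x) ^ (ϱ / betaExp μ ℓ) ≤ (a ^ d) ^ varpi μ * phi ℓ x ^ (ϱ / betaExp μ ℓ) := by
  have ha0 : 0 ≤ a := zero_le_one.trans ha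
  have hκ := div_betaExp_nonneg (μ := μ) hϱ hϖ hℓd
  have h1 : phi ℓ (h • x) ≤ a ^ d * phi ℓ x := (phi_smul_le ℓ x ha0 hb).trans
    (mul_le_mul_of_nonneg_right (pow_le_pow_right₀ ha hℓd) (phi_nonneg _ _))
  refine (Real.rpow_le_rpow (phi_nonneg _ _) h1 hκ).trans ?_
  rw [Real.mul_rpow (by positivity) (phi_nonneg _ _)]
  exact mul_le_mul_of_nonneg_right (Real.rpow_le_rpow_of_exponent_le (one_le_pow₀ ha)
    (div_betaExp_le_varpi hϱ1 hϖ hℓd)) (Real.rpow_nonneg (phi_nonneg _ _) _)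

theorem margulisFun_smul_le (hϖ : 0 ≤ varpi μ) {ε ϱ : ℝ} (hε : 0 ≤ ε) (hϱ : 0 ≤ ϱ) (hϱ1 : ϱ ≤ 1)
    {h : SLR d} {a : ℝ} (ha : 1 ≤ a) (hb : ∀ y, ‖slAct h⁻¹ y‖ ≤ a * ‖y‖) (x : LatticeSpace d) :
    margulisFun μ ε ϱ (h • x) ≤ (a ^ d) ^ varpi μ * margulisFun μ ε ϱ x := by
  have h1 : 1 ≤ (a ^ d) ^ varpi μ := Real.one_le_rpow (one_le_pow₀ ha) hϖ
  rw [margulisFun, margulisFun, mul_add, Finset.mul_sum]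
  refine add_le_add (by linarith) (Finset.sum_le_sum fun ℓ hℓ => ?_)
  rw [mul_left_comm]
  exact mul_le_mul_of_nonneg_left
    (phi_rpow_smul_le hϖ hϱ hϱ1 ha hb (Finset.mem_Icc.1 hℓ).2 x) (pow_nonneg hε _)

theorem phiExt_rpow_le {ε ϱ : ℝ} (hε : 0 < ε) {j : ℕ}
    (hj : j ≤ d + 1) {n : ℝ} (hn : 0 < n) (x : LatticeSpace d) :
    phiExt j x ^ (ϱ * varpi μ / (2 * n))
      ≤ (margulisFun μ ε ϱ x * ε ^ (-(j : ℝ))) ^ (((d : ℝ) + 1 - j) / (2 * n)) := by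
  have hf := two_le_margulisFun (μ := μ) (ϱ := ϱ) hε.le x
  rw [phiExt]
  split_ifs with h
  · have hjd : (j : ℝ) ≤ d := by exact_mod_cast h.2
    have hnj : 0 < (d : ℝ) + 1 - j := by linarith
    have h1 : ϱ * varpi μ / (2 * n) = (ϱ / betaExp μ j) * (((d : ℝ) + 1 - j) / (2 * n)) := by
      rw [div_betaExp, show (d : ℝ) - j + 1 = (d : ℝ) + 1 - j by ring]
      field_simp
    rw [h1, Real.rpow_mul (phi_nonneg _ _)]
    refine Real.rpow_le_rpow (Real.rpow_nonneg (phi_nonneg _ _) _) ?_ (by positivity)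
    have h2 := margulisFun_term_le (μ := μ) (ϱ := ϱ) hε.le h.1 h.2 x
    rw [Real.rpow_neg hε.le, Real.rpow_natCast, ← div_eq_mul_inv, le_div_iff₀ (by positivity),
      mul_comm]
    exact h2
  · rw [Real.one_rpow]
    rcases Nat.eq_zero_or_pos j with rfl | h0
    · simp only [CharP.cast_eq_zero, neg_zero, Real.rpow_zero, mul_one, sub_zero]
      exact Real.one_le_rpow (by linarith) (by positivity)
    · obtain rfl : j = d + 1 := by omega
      simp

/-- In the second case of `phi_dichotomy`, the term of rank `ℓ` of the Margulis function is small
compared with the whole function. The exponents `ϱ / β_ℓ` are such that the weights of the terms of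
ranks `ℓ ± i` add up to one, and a positive power of `ε` is left over. -/
theorem margulisFun_term_le_of_phi_sq_le (hϖ : 0 ≤ varpi μ) {ε ϱ : ℝ} (hε : 0 < ε) (hε1 : ε ≤ 1)
    (hϱ : 0 ≤ ϱ) (hϱ1 : ϱ ≤ 1) {A : ℝ} (hA : 1 ≤ A) {ℓ i : ℕ} (hℓ : 1 ≤ ℓ) (hℓd : ℓ ≤ d)
    (hi1 : 1 ≤ i) (hiℓ : i ≤ ℓ) (hid : ℓ + i ≤ d + 1) {x : LatticeSpace d}
    (h : phi ℓ x ^ 2 ≤ (2 * A) ^ 2 * (phiExt (ℓ - i) x * phiExt (ℓ + i) x)) :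
    ε ^ ℓ * phi ℓ x ^ (ϱ / betaExp μ ℓ)
      ≤ (2 * A) ^ varpi μ * ε ^ (1 / (d : ℝ)) * margulisFun μ ε ϱ x := by
  have hℓd' : (ℓ : ℝ) ≤ d := by exact_mod_cast hℓd
  have hℓ' : (1 : ℝ) ≤ ℓ := by exact_mod_cast hℓ
  have hd0 : (0 : ℝ) < d := by linarith
  have hi1' : (1 : ℝ) ≤ i := by exact_mod_cast hi1
  set n : ℝ := (d : ℝ) + 1 - ℓ with hn
  have hn0 : 0 < n := by linarith
  set f := margulisFun μ ε ϱ x with hf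
  have hf0 : 0 < f := by
    have := two_le_margulisFun (μ := μ) (ϱ := ϱ) hε.le x
    linarith
  set κ := ϱ / betaExp μ ℓ with hκ
  have hκ0 : 0 ≤ κ := div_betaExp_nonneg hϱ hϖ hℓd
  have hκϖ : κ ≤ varpi μ := div_betaExp_le_varpi hϱ1 hϖ hℓd
  have hκ2 : κ / 2 = ϱ * varpi μ / (2 * n) := by
    rw [hκ, div_betaExp, show (d : ℝ) - ℓ + 1 = n by rw [hn]; ring, div_div, mul_comm n]
  have hP := phiExt_pos (ℓ - i) x
  have hQ := phiExt_pos (ℓ + i) x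
  have h1 : phi ℓ x ^ κ
      ≤ (2 * A) ^ κ * (phiExt (ℓ - i) x ^ (κ / 2) * phiExt (ℓ + i) x ^ (κ / 2)) := by
    have e1 : phi ℓ x ^ κ = (phi ℓ x ^ 2) ^ (κ / 2) := by
      rw [← Real.rpow_natCast, ← Real.rpow_mul (phi_nonneg _ _)]; congr 1; push_cast; ring
    have e2 : (2 * A) ^ κ = ((2 * A) ^ 2) ^ (κ / 2) := by
      rw [← Real.rpow_natCast, ← Real.rpow_mul (by linarith)]; congr 1; push_cast; ring
    rw [e1, e2, ← Real.mul_rpow hP.le hQ.le, ← Real.mul_rpow (by positivity) (by positivity)]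
    exact Real.rpow_le_rpow (by positivity) h (by positivity)
  have h2 := phiExt_rpow_le (μ := μ) (ϱ := ϱ) hε (show ℓ - i ≤ d + 1 by omega) hn0 x
  have h3 := phiExt_rpow_le (μ := μ) (ϱ := ϱ) hε hid hn0 x
  rw [← hκ2, Nat.cast_sub hiℓ] at h2
  rw [← hκ2, Nat.cast_add] at h3
  have h4 : (f * ε ^ (-((ℓ : ℝ) - i))) ^ (((d : ℝ) + 1 - ((ℓ : ℝ) - i)) / (2 * n))
      * (f * ε ^ (-((ℓ : ℝ) + i))) ^ (((d : ℝ) + 1 - ((ℓ : ℝ) + i)) / (2 * n))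
      = f * (ε ^ (-(ℓ : ℝ)) * ε ^ ((i : ℝ) ^ 2 / n)) := by
    rw [Real.mul_rpow hf0.le (by positivity), Real.mul_rpow hf0.le (by positivity),
      ← Real.rpow_mul hε.le, ← Real.rpow_mul hε.le, mul_mul_mul_comm, ← Real.rpow_add hf0,
      ← Real.rpow_add hε, ← Real.rpow_add hε]
    have e1 : ((d : ℝ) + 1 - ((ℓ : ℝ) - i)) / (2 * n) + ((d : ℝ) + 1 - ((ℓ : ℝ) + i)) / (2 * n)
        = 1 := by
      rw [← add_div, div_eq_one_iff_eq (by positivity), hn]; ring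
    have e2 : -((ℓ : ℝ) - i) * (((d : ℝ) + 1 - ((ℓ : ℝ) - i)) / (2 * n))
        + -((ℓ : ℝ) + i) * (((d : ℝ) + 1 - ((ℓ : ℝ) + i)) / (2 * n))
          = -(ℓ : ℝ) + (i : ℝ) ^ 2 / n := by
      rw [show (d : ℝ) + 1 - ((ℓ : ℝ) - i) = n + i by rw [hn]; ring,
        show (d : ℝ) + 1 - ((ℓ : ℝ) + i) = n - i by rw [hn]; ring]
      field_simp
      ring
    rw [e1, e2, Real.rpow_one]
  have h5 : ε ^ ((i : ℝ) ^ 2 / n) ≤ ε ^ (1 / (d : ℝ)) := by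
    refine Real.rpow_le_rpow_of_exponent_ge hε hε1 ?_
    rw [div_le_div_iff₀ hd0 hn0]
    have h5 : n ≤ d := by rw [hn]; linarith
    have h6 : (1 : ℝ) ≤ (i : ℝ) ^ 2 := one_le_pow₀ hi1'
    exact (mul_le_mul_of_nonneg_left h5 zero_le_one).trans
      (mul_le_mul_of_nonneg_right h6 hd0.le)
  have h6 : (2 * A) ^ κ ≤ (2 * A) ^ varpi μ :=
    Real.rpow_le_rpow_of_exponent_le (by linarith) hκϖ
  have h7 : phiExt (ℓ - i) x ^ (κ / 2) * phiExt (ℓ + i) x ^ (κ / 2)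
      ≤ f * (ε ^ (-(ℓ : ℝ)) * ε ^ (1 / (d : ℝ))) := by
    refine (mul_le_mul h2 h3 (by positivity) (by positivity)).trans ?_
    rw [h4]
    gcongr
  have h8 : ε ^ ℓ * ε ^ (-(ℓ : ℝ)) = 1 := by
    rw [Real.rpow_neg hε.le, Real.rpow_natCast, mul_inv_cancel₀ (by positivity)]
  calc ε ^ ℓ * phi ℓ x ^ κ
      ≤ ε ^ ℓ * ((2 * A) ^ varpi μ * (f * (ε ^ (-(ℓ : ℝ)) * ε ^ (1 / (d : ℝ))))) := by
        refine mul_le_mul_of_nonneg_left (h1.trans ?_) (by positivity)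
        exact mul_le_mul h6 h7 (by positivity) (by positivity)
    _ = (ε ^ ℓ * ε ^ (-(ℓ : ℝ))) * ((2 * A) ^ varpi μ * ε ^ (1 / (d : ℝ)) * f) := by ring
    _ = _ := by rw [h8, one_mul]

end Margulis

/-! ### The cocycle and measurability -/

namespace SimilarityIFS

variable {d : ℕ} {Λ : Type*} [Fintype Λ] [LinearOrder Λ] {F : SimilarityIFS d Λ}
  {K : Set (EuclideanSpace ℝ (Fin d))}

theorem measurableSet_hatPiece (hK : F.IsLimitSet K) {k : ℕ} (ω : Fin k → Λ) :
    MeasurableSet (F.hatPiece K ω) := by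
  have h : ∀ α : Fin k → Λ, MeasurableSet (F.simWord k α '' K) := fun α =>
    (hK.2.1.image (F.continuous_simWord α)).measurableSet
  exact (h ω).diff (.iUnion fun α => .iUnion fun _ => (h ω).inter (h α))

theorem cocycle_eq (hK : F.IsLimitSet K) {k : ℕ} {ω : Fin k → Λ} {x : EuclideanSpace ℝ (Fin d)}
    (hx : x ∈ F.hatPiece K ω) : F.cocycle K k x = F.ratioWord ω := by
  have hxK : x ∈ K := by
    obtain ⟨y, hy, rfl⟩ := hx.1
    exact F.simWord_mapsTo hK ω hy
  have h : ∃ ω : Fin k → Λ, x ∈ F.hatPiece K ω := ⟨ω, hx⟩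
  rw [cocycle, dif_pos h, (F.existsUnique_hatPiece hK k hxK).unique h.choose_spec hx]

theorem cocycle_mem (F : SimilarityIFS d Λ) (K : Set (EuclideanSpace ℝ (Fin d))) (k : ℕ)
    (x : EuclideanSpace ℝ (Fin d)) :
    F.cocycle K k x ∈ insert 1 (Set.range fun ω : Fin k → Λ => F.ratioWord ω) := by
  rw [cocycle]
  split_ifs with h
  · exact Or.inr ⟨_, rfl⟩
  · exact Or.inl rfl

theorem exists_le_cocycle (F : SimilarityIFS d Λ) (K : Set (EuclideanSpace ℝ (Fin d))) (k : ℕ) :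
    ∃ r : ℝ, 0 < r ∧ r ≤ 1 ∧ ∀ x, r ≤ F.cocycle K k x := by
  obtain ⟨r, hr, hmin⟩ := Set.exists_min_image
    (insert 1 (Set.range fun ω : Fin k → Λ => F.ratioWord ω)) id
    ((Set.finite_range _).insert 1) ⟨1, Or.inl rfl⟩
  refine ⟨r, ?_, hmin 1 (Or.inl rfl), fun x => hmin _ (F.cocycle_mem K k x)⟩
  rcases hr with rfl | ⟨ω, rfl⟩
  · exact one_pos
  · exact F.ratioWord_pos ω

theorem cocycle_le_one (F : SimilarityIFS d Λ) (K : Set (EuclideanSpace ℝ (Fin d))) (k : ℕ)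
    (x : EuclideanSpace ℝ (Fin d)) : F.cocycle K k x ≤ 1 := by
  rcases F.cocycle_mem K k x with h | ⟨ω, h⟩
  · exact h.le
  · rw [← h]; exact F.ratioWord_le_one ω

theorem cocycle_pos (F : SimilarityIFS d Λ) (K : Set (EuclideanSpace ℝ (Fin d))) (k : ℕ)
    (x : EuclideanSpace ℝ (Fin d)) : 0 < F.cocycle K k x := by
  obtain ⟨r, hr, -, h⟩ := F.exists_le_cocycle K k
  exact hr.trans_le (h x)

theorem measurable_cocycle (hK : F.IsLimitSet K) (k : ℕ) : Measurable (F.cocycle K k) := by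
  have h : F.cocycle K k = fun x => 1 + ∑ ω : Fin k → Λ,
      (F.hatPiece K ω).indicator (fun _ => F.ratioWord ω - 1) x := by
    funext x
    by_cases hx : ∃ ω : Fin k → Λ, x ∈ F.hatPiece K ω
    · obtain ⟨ω, hω⟩ := hx
      have hxK : x ∈ K := by
        obtain ⟨y, hy, rfl⟩ := hω.1
        exact F.simWord_mapsTo hK ω hy
      rw [cocycle_eq hK hω, Finset.sum_eq_single ω, Set.indicator_of_mem hω]
      · ring
      · intro ω' _ hne
        exact Set.indicator_of_notMem
          (fun h' => hne ((F.existsUnique_hatPiece hK k hxK).unique h' hω)) _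
      · simp
    · rw [cocycle, dif_neg hx, Finset.sum_eq_zero, add_zero]
      exact fun ω _ => Set.indicator_of_notMem (fun h' => hx ⟨ω, h'⟩) _
  rw [h]
  exact measurable_const.add (Finset.measurable_sum _ fun ω _ =>
    measurable_const.indicator (measurableSet_hatPiece hK ω))

/-- A function of `x` and of `ρ(x, k)` is measurable if it is so for each fixed value of the
latter, since `ρ(·, k)` is measurable with finitely many values. -/
theorem measurable_comp_cocycle (hK : F.IsLimitSet K) (k : ℕ)
    {G : ℝ → EuclideanSpace ℝ (Fin d) → ℝ} (hG : ∀ r, 0 < r → Measurable (G r)) :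
    Measurable fun x => G (F.cocycle K k x) x := by
  intro S hS
  have h : (fun x => G (F.cocycle K k x) x) ⁻¹' S
      = ⋃ r ∈ (insert 1 (Set.range fun ω : Fin k → Λ => F.ratioWord ω)) ∩ {r : ℝ | 0 < r},
        (F.cocycle K k ⁻¹' {r} ∩ G r ⁻¹' S) := by
    ext x
    simp only [Set.mem_preimage, Set.mem_iUnion, Set.mem_inter_iff, Set.mem_singleton_iff]
    constructor
    · intro hx
      exact ⟨_, ⟨F.cocycle_mem K k x, F.cocycle_pos K k x⟩, rfl, hx⟩
    · rintro ⟨r, -, rfl, hx⟩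
      exact hx
  rw [h]
  refine MeasurableSet.biUnion
    ((((Set.finite_range _).insert 1).inter_of_left _).countable) fun r hr => ?_
  exact (measurable_cocycle hK k (measurableSet_singleton r)).inter (hG r hr.2 hS)

end SimilarityIFS

section Continuity

variable {d : ℕ}

theorem continuous_of_le_one_add_mul_pow {E : Type*} [SeminormedAddCommGroup E] {f : E → ℝ}
    {M : ℝ} {n : ℕ} (hM : 0 ≤ M) (h : ∀ x y, f y ≤ (1 + M * ‖y - x‖) ^ n * f x) : Continuous f := by
  rw [continuous_iff_continuousAt]
  intro x
  have e : Tendsto (fun y => (1 + M * ‖y - x‖) ^ n) (𝓝 x) (𝓝 1) := by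
    have : Continuous fun y => (1 + M * ‖y - x‖) ^ n := by fun_prop
    simpa using this.tendsto x
  have e1 : Tendsto (fun y => (1 + M * ‖y - x‖) ^ n * f x) (𝓝 x) (𝓝 (f x)) := by
    simpa using e.mul_const (f x)
  have e2 : Tendsto (fun y => ((1 + M * ‖y - x‖) ^ n)⁻¹ * f x) (𝓝 x) (𝓝 (f x)) := by
    simpa using (e.inv₀ one_ne_zero).mul_const (f x)
  refine tendsto_of_tendsto_of_tendsto_of_le_of_le e2 e1 (fun y => ?_) fun y => h x y
  have h1 := h y x
  rw [norm_sub_rev] at h1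
  change ((1 + M * ‖y - x‖) ^ n)⁻¹ * f x ≤ f y
  rw [inv_mul_le_iff₀ (by positivity)]
  exact h1

theorem uElt_mul_inv (x y : EuclideanSpace ℝ (Fin d)) (z : EuclideanSpace ℝ (Fin (d + 1))) :
    slAct (uElt x) (slAct (uElt y)⁻¹ z)
      = z + inner ℝ (linLift (x - y)) z • EuclideanSpace.single 0 (1 : ℝ) := by
  rw [uElt_inv, slAct_uElt, slAct_uElt, inner_add_right, inner_smul_right,
    EuclideanSpace.inner_single_right, map_neg, map_sub, inner_neg_left, inner_sub_left]
  simp only [linLift_zero, map_zero, mul_zero, add_zero]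
  module

theorem continuous_phi_gFlow_uElt (ℓ : ℕ) (t : ℝ) (x₀ : LatticeSpace d) :
    Continuous fun x => phi ℓ ((gFlow d t * uElt x) • x₀) := by
  set g := gFlow d t with hg
  obtain ⟨c, hc, hcb⟩ := exists_norm_slAct_le g
  obtain ⟨c', hc', hcb'⟩ := exists_norm_slAct_le g⁻¹
  refine continuous_of_le_one_add_mul_pow (M := c * c') (n := ℓ) (by positivity) fun x y => ?_
  set h : SLR d := (g * uElt y) * (g * uElt x)⁻¹ with hh
  have h1 : (g * uElt y) • x₀ = h • ((g * uElt x) • x₀) := by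
    rw [hh, smul_smul, inv_mul_cancel_right]
  rw [h1]
  refine phi_smul_le ℓ _ (by positivity) fun z => ?_
  have h2 : h⁻¹ = g * (uElt x * (uElt y)⁻¹ * g⁻¹) := by rw [hh]; group
  rw [h2, slAct_mul, slAct_mul, slAct_mul, uElt_mul_inv, map_add, slAct_slAct_inv, map_smul]
  refine (norm_add_le _ _).trans ?_
  rw [norm_smul, add_mul, one_mul]
  refine add_le_add le_rfl ?_
  have h3 : ‖inner ℝ (linLift (x - y)) (slAct g⁻¹ z)‖ ≤ ‖y - x‖ * (c' * ‖z‖) := by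
    refine (norm_inner_le_norm _ _).trans ?_
    rw [norm_linLift, norm_sub_rev]
    exact mul_le_mul_of_nonneg_left (hcb' z) (norm_nonneg _)
  have h4 : ‖slAct g (EuclideanSpace.single 0 (1 : ℝ))‖ ≤ c := by
    have := hcb (EuclideanSpace.single 0 (1 : ℝ))
    rwa [PiLp.norm_single, norm_one, mul_one] at this
  calc _ ≤ ‖y - x‖ * (c' * ‖z‖) * c := mul_le_mul h3 h4 (norm_nonneg _) (by positivity)
    _ = _ := by ring

end Continuity

/-! ### Expansion in average -/

section Expansion

/-- The pointwise estimate behind the expansion in average: `q'` is a covolume after applying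
`g_t u(x)`, `q` the one before and `τ` the length of a projection of `(1, x)`. -/
theorem rpow_neg_mul_inv_rpow_le {c t τ q q' κ θ γ p ϖ e : ℝ} {m n : ℕ} (hc : 1 ≤ c) (ht : 0 < t)
    (hτ : 0 < τ) (hτc : τ ≤ c) (hq : 0 < q) (hθ : 0 ≤ θ) (hκ : 0 ≤ κ) (hκϖ : κ ≤ ϖ) (hmn : m ≤ n)
    (hp : 0 ≤ p) (hκp : κ ≤ θ * (1 - p)) (hpγ : p = e * κ - γ)
    (hq' : (c ^ m)⁻¹ * t ^ (-e) * τ * q ≤ q') :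
    t ^ (-γ) * q'⁻¹ ^ κ ≤ c ^ (n * ϖ + θ) * q⁻¹ ^ κ * (t ^ p * (τ ^ (-θ)) ^ (1 - p)) := by
  have hc0 : 0 < c := one_pos.trans_le hc
  have hlow : 0 < (c ^ m)⁻¹ * t ^ (-e) * τ * q := by positivity
  have h1 : q'⁻¹ ^ κ ≤ (c ^ m) ^ κ * t ^ (e * κ) * τ⁻¹ ^ κ * q⁻¹ ^ κ := by
    refine (Real.rpow_le_rpow (inv_nonneg.2 (hlow.le.trans hq'))
      (inv_anti₀ hlow hq') hκ).trans_eq ?_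
    rw [mul_inv, mul_inv, mul_inv, inv_inv, Real.rpow_neg ht.le, inv_inv,
      Real.mul_rpow (by positivity) (by positivity), Real.mul_rpow (by positivity) (by positivity),
      Real.mul_rpow (by positivity) (by positivity), ← Real.rpow_mul ht.le]
  have h2 : (c ^ m) ^ κ ≤ c ^ (n * ϖ) := by
    rw [← Real.rpow_natCast, ← Real.rpow_mul hc0.le]
    refine Real.rpow_le_rpow_of_exponent_le hc ?_
    exact mul_le_mul (by exact_mod_cast hmn) hκϖ hκ (by positivity)
  have h3 : τ⁻¹ ^ κ ≤ c ^ θ * (τ ^ (-θ)) ^ (1 - p) := by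
    have e1 : τ⁻¹ ^ κ ≤ (c * τ⁻¹) ^ κ :=
      Real.rpow_le_rpow (by positivity) (le_mul_of_one_le_left (by positivity) hc) hκ
    have e2 : (c * τ⁻¹) ^ κ ≤ (c * τ⁻¹) ^ (θ * (1 - p)) := by
      refine Real.rpow_le_rpow_of_exponent_le ?_ hκp
      rw [← div_eq_mul_inv, one_le_div hτ]
      exact hτc
    have e3 : (c * τ⁻¹) ^ (θ * (1 - p)) = c ^ (θ * (1 - p)) * (τ ^ (-θ)) ^ (1 - p) := by
      rw [Real.mul_rpow hc0.le (by positivity), Real.inv_rpow hτ.le, ← Real.rpow_neg hτ.le,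
        ← Real.rpow_mul hτ.le, neg_mul]
    refine (e1.trans e2).trans (e3.trans_le ?_)
    refine mul_le_mul_of_nonneg_right (Real.rpow_le_rpow_of_exponent_le hc ?_) (by positivity)
    nlinarith
  have h4 : t ^ (-γ) * t ^ (e * κ) = t ^ p := by
    rw [← Real.rpow_add ht, hpγ]; ring_nf
  calc t ^ (-γ) * q'⁻¹ ^ κ
      ≤ t ^ (-γ) * (c ^ (n * ϖ) * t ^ (e * κ) * (c ^ θ * (τ ^ (-θ)) ^ (1 - p)) * q⁻¹ ^ κ) := by
        refine mul_le_mul_of_nonneg_left (h1.trans ?_) (by positivity)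
        gcongr
    _ = c ^ (n * ϖ) * c ^ θ * q⁻¹ ^ κ * ((t ^ (-γ) * t ^ (e * κ)) * (τ ^ (-θ)) ^ (1 - p)) := by ring
    _ = _ := by rw [h4, Real.rpow_add hc0]

end Expansion

namespace SimilarityIFS

variable {d : ℕ} {Λ : Type*} [Fintype Λ] [LinearOrder Λ] {F : SimilarityIFS d Λ} {p : Λ → ℝ}
  {μ : Measure (EuclideanSpace ℝ (Fin d))} [IsProbabilityMeasure μ]
  {K : Set (EuclideanSpace ℝ (Fin d))}

theorem integrable_cocycle (hK : F.IsLimitSet K) (k : ℕ) : Integrable (F.cocycle K k) μ :=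
  .of_bound (measurable_cocycle hK k).aestronglyMeasurable 1 (.of_forall fun x => by
    rw [Real.norm_of_nonneg (F.cocycle_pos K k x).le]; exact F.cocycle_le_one K k x)

theorem le_integral_cocycle (hK : F.IsLimitSet K) {k : ℕ} {r : ℝ}
    (hr : ∀ x, r ≤ F.cocycle K k x) : r ≤ ∫ x, F.cocycle K k x ∂μ := by
  have := integral_mono (integrable_const (μ := μ) r) (integrable_cocycle hK k) hr
  simpa using this

theorem integral_cocycle_le_one (hK : F.IsLimitSet K) (k : ℕ) : ∫ x, F.cocycle K k x ∂μ ≤ 1 := by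
  have := integral_mono (integrable_cocycle (μ := μ) hK k) (integrable_const 1)
    (F.cocycle_le_one K k)
  simpa using this

/-- The covolume of a fixed parallelepiped expands in average under `g_{ρ(x, k)} u(x)`. Hölder's
inequality separates the factor `ρ(x, k)` from the negative moment of the projection, and only the
first of the two carries the exponent `ϱ β - γ`; the constant is independent of `k`. -/
theorem IsSelfSimilar.exists_lintegral_covol_le (hp : ∀ i, 0 < p i) (h : F.IsSelfSimilar p μ)
    (hirr : F.IsIrreducible) (hK : F.IsLimitSet K) (hμK : μ Kᶜ = 0) {ϱ : ℝ} (hϱ : 0 < ϱ)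
    (hϱ1 : ϱ < 1) {ℓ : ℕ} (hℓ : 1 ≤ ℓ) (hℓd : ℓ ≤ d) :
    ∃ C : ℝ, 0 < C ∧ ∀ (k : ℕ) (γ : ℝ), ϱ * betaMin μ - (1 - ϱ) / (1 + ϱ) ≤ γ →
      γ ≤ ϱ * betaMin μ → ∀ v : Fin ℓ → EuclideanSpace ℝ (Fin (d + 1)), LinearIndependent ℝ v →
      ∫⁻ x, ENNReal.ofReal (F.cocycle K k x ^ (-γ) *
          (covol (slAct (gFlow d (F.cocycle K k x) * uElt x) ∘ v))⁻¹ ^ (ϱ / betaExp μ ℓ)) ∂μ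
        ≤ ENNReal.ofReal (C * (∫ x, F.cocycle K k x ∂μ) ^ (ϱ * betaMin μ - γ) *
            (covol v)⁻¹ ^ (ϱ / betaExp μ ℓ)) := by
  have hα : 0 < decayExponent μ ℓ := h.decayExponent_pos hp hirr hK hμK hℓ hℓd
  have hϖ : 0 < varpi μ := varpi_pos (hℓ.trans hℓd) fun j hj hjd =>
    h.decayExponent_pos hp hirr hK hμK hj hjd
  set θ := decayExponent μ ℓ * ((1 + ϱ) / 2) with hθdef
  have hθ : 0 < θ := by positivity
  have hθα : θ < decayExponent μ ℓ := mul_lt_of_lt_one_right hα (by linarith)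
  obtain ⟨B, hB, hproj⟩ := h.exists_lintegral_projection_le hp hirr hK hμK hℓ hℓd hθ hθα
  obtain ⟨R, hR⟩ := hK.2.1.isBounded.exists_norm_le
  have hR0 : 0 ≤ R := by
    obtain ⟨x, hx⟩ := hK.1
    exact (norm_nonneg x).trans (hR x hx)
  obtain ⟨m, rfl⟩ : ∃ m, ℓ = m + 1 := ⟨ℓ - 1, by omega⟩
  set κ := ϱ / betaExp μ (m + 1) with hκdef
  have hκ : 0 ≤ κ := div_betaExp_nonneg hϱ.le hϖ.le hℓd
  have hκϖ : κ ≤ varpi μ := div_betaExp_le_varpi hϱ1.le hϖ.le hℓd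
  have hmd : (m : ℝ) + 1 ≤ d := by exact_mod_cast hℓd
  have hκβ : ((d : ℝ) - m) / (d + 1) * κ = ϱ * betaMin μ := by
    have : (d : ℝ) - m ≠ 0 := by linarith
    rw [hκdef, div_betaExp, betaMin_eq, Nat.cast_add, Nat.cast_one,
      show (d : ℝ) - (m + 1) + 1 = d - m by ring]
    field_simp
  set D := (1 + R) ^ ((d : ℝ) * varpi μ + θ) with hD
  have hD0 : 0 < D := by positivity
  refine ⟨D * max 1 B, by positivity, fun k γ hγ1 hγ2 v hv => ?_⟩
  set q := ϱ * betaMin μ - γ with hq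
  have hq0 : 0 ≤ q := by linarith
  have hq1 : q ≤ (1 - ϱ) / (1 + ϱ) := by linarith
  have hq2 : 2 * ϱ / (1 + ϱ) ≤ 1 - q := by
    have : (1 - ϱ) / (1 + ϱ) + 2 * ϱ / (1 + ϱ) = 1 := by field_simp; ring
    linarith
  have hq3 : 0 ≤ 1 - q := le_trans (by positivity) hq2
  -- the moment `θ` is chosen so that Hölder's inequality still reaches the exponent `ϱ α_ℓ`
  have hκq : κ ≤ θ * (1 - q) := by
    refine (div_betaExp_le_mul hϱ.le hℓ hℓd).trans ?_
    have : ϱ * decayExponent μ (m + 1) = θ * (2 * ϱ / (1 + ϱ)) := by rw [hθdef]; field_simp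
    rw [this]
    exact mul_le_mul_of_nonneg_left hq2 hθ.le
  set V := Submodule.span ℝ (Set.range v) with hV
  have hVr : Module.finrank ℝ V = m + 1 := by
    rw [hV, finrank_span_eq_card hv, Fintype.card_fin]
  have hmoment := hproj V hVr
  set τ : EuclideanSpace ℝ (Fin d) → ℝ := fun x => ‖V.starProjection (affLift x)‖ with hτ
  have hτm : Measurable τ := (V.starProjection.continuous.comp continuous_affLift).norm.measurable
  have hτae : ∀ᵐ x ∂μ, 0 < τ x := by
    have h1 := ae_lt_top (hτm.ennreal_ofReal.pow_const (-θ)) (hmoment.trans_lt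
      ENNReal.ofReal_lt_top).ne
    filter_upwards [h1] with x hx
    by_contra hcon
    rw [ENNReal.ofReal_of_nonpos (not_lt.1 hcon), ENNReal.zero_rpow_of_neg (by linarith)] at hx
    exact lt_irrefl _ hx
  have hKae : ∀ᵐ x ∂μ, x ∈ K := mem_ae_iff.2 hμK
  set I := ∫ x, F.cocycle K k x ∂μ with hI
  have hI0 : 0 < I := by
    obtain ⟨r, hr, -, hrle⟩ := F.exists_le_cocycle K k
    exact hr.trans_le (le_integral_cocycle hK hrle)
  have hIeq : ∫⁻ x, ENNReal.ofReal (F.cocycle K k x) ∂μ = ENNReal.ofReal I :=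
    (ofReal_integral_eq_lintegral_ofReal (integrable_cocycle hK k)
      (.of_forall fun x => (F.cocycle_pos K k x).le)).symm
  have hcv : 0 < covol v := covol_pos hv
  calc _ ≤ ∫⁻ x, ENNReal.ofReal (D * (covol v)⁻¹ ^ κ) *
          (ENNReal.ofReal (F.cocycle K k x) ^ q * (ENNReal.ofReal (τ x) ^ (-θ)) ^ (1 - q)) ∂μ := by
        refine lintegral_mono_ae ?_
        filter_upwards [hτae, hKae] with x hτx hxK
        have hρ := F.cocycle_pos K k x
        rw [ENNReal.ofReal_rpow_of_pos hρ, ENNReal.ofReal_rpow_of_pos hτx,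
          ENNReal.ofReal_rpow_of_pos (Real.rpow_pos_of_pos hτx _),
          ← ENNReal.ofReal_mul (by positivity), ← ENNReal.ofReal_mul (by positivity)]
        refine ENNReal.ofReal_le_ofReal ?_
        have hxR : 1 + ‖x‖ ≤ 1 + R := by linarith [hR x hxK]
        refine rpow_neg_mul_inv_rpow_le (m := m) (e := ((d : ℝ) - m) / (d + 1)) (by linarith) hρ
          hτx ?_ hcv hθ.le hκ hκϖ (by omega) hq0 hκq (by rw [hκβ]) ?_
        · exact (V.norm_starProjection_apply_le _).trans ((norm_affLift_le x).trans hxR)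
        · refine le_trans ?_ (covol_gFlow_uElt_ge hρ x hv)
          rw [show -(((d : ℝ) - m) / (d + 1)) = ((m : ℝ) - d) / (d + 1) by ring]
          gcongr
    _ = ENNReal.ofReal (D * (covol v)⁻¹ ^ κ) * ∫⁻ x,
          ENNReal.ofReal (F.cocycle K k x) ^ q * (ENNReal.ofReal (τ x) ^ (-θ)) ^ (1 - q) ∂μ :=
        lintegral_const_mul' _ _ ENNReal.ofReal_ne_top
    _ ≤ ENNReal.ofReal (D * (covol v)⁻¹ ^ κ) *
          (ENNReal.ofReal (I ^ q) * ENNReal.ofReal (max 1 B)) := by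
        gcongr
        refine (ENNReal.lintegral_mul_norm_pow_le
          (measurable_cocycle hK k).ennreal_ofReal.aemeasurable
          (hτm.ennreal_ofReal.pow_const (-θ)).aemeasurable hq0 hq3 (by ring)).trans ?_
        rw [hIeq, ENNReal.ofReal_rpow_of_pos hI0]
        gcongr
        refine (ENNReal.rpow_le_rpow (hmoment.trans (ENNReal.ofReal_le_ofReal
          (le_max_right 1 B))) hq3).trans ?_
        rw [ENNReal.ofReal_rpow_of_pos (by positivity)]
        refine ENNReal.ofReal_le_ofReal ?_
        exact (Real.rpow_le_rpow_of_exponent_le (le_max_left 1 B) (by linarith)).trans_eq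
          (Real.rpow_one _)
    _ = _ := by
        rw [← ENNReal.ofReal_mul (by positivity), ← ENNReal.ofReal_mul (by positivity)]
        congr 1
        ring

end SimilarityIFS

/-! ### Averages of the Margulis function -/

namespace SimilarityIFS

variable {d : ℕ} {Λ : Type*} [Fintype Λ] [LinearOrder Λ] {F : SimilarityIFS d Λ}
  {μ : Measure (EuclideanSpace ℝ (Fin d))}
  {K : Set (EuclideanSpace ℝ (Fin d))}

theorem exists_norm_slAct_cocycle_le (hK : F.IsLimitSet K) (k : ℕ) :
    ∃ a : ℝ, 1 ≤ a ∧ ∀ x ∈ K, ∀ y,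
      ‖slAct (gFlow d (F.cocycle K k x) * uElt x) y‖ ≤ a * ‖y‖ ∧
      ‖slAct (gFlow d (F.cocycle K k x) * uElt x)⁻¹ y‖ ≤ a * ‖y‖ := by
  obtain ⟨R, hR⟩ := hK.2.1.isBounded.exists_norm_le
  have hR0 : 0 ≤ R := by
    obtain ⟨x, hx⟩ := hK.1
    exact (norm_nonneg x).trans (hR x hx)
  obtain ⟨r, hr, hr1, hrle⟩ := F.exists_le_cocycle K k
  have hrinv : 1 ≤ r⁻¹ := (one_le_inv₀ hr).2 hr1
  refine ⟨r⁻¹ * (1 + R), one_le_mul_of_one_le_of_one_le hrinv (by linarith), fun x hx y => ?_⟩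
  have hρ := F.cocycle_pos K k x
  have hρr : (F.cocycle K k x)⁻¹ ≤ r⁻¹ := inv_anti₀ hr (hrle x)
  have hxR : 1 + ‖x‖ ≤ 1 + R := by linarith [hR x hx]
  constructor
  · rw [slAct_mul]
    refine (norm_slAct_gFlow_le_inv hρ (F.cocycle_le_one K k x) _).1.trans ?_
    rw [mul_assoc]
    refine mul_le_mul hρr ((norm_slAct_uElt_le x y).trans ?_) (norm_nonneg _) (by positivity)
    exact mul_le_mul_of_nonneg_right hxR (norm_nonneg _)
  · rw [mul_inv_rev, slAct_mul]
    refine (norm_slAct_uElt_inv_le x _).trans ?_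
    rw [mul_comm r⁻¹, mul_assoc]
    refine mul_le_mul hxR
      ((norm_slAct_gFlow_le_inv hρ (F.cocycle_le_one K k x) y).2.trans ?_)
      (norm_nonneg _) (by positivity)
    exact mul_le_mul_of_nonneg_right hρr (norm_nonneg _)

/-- For a suitable `ε`, depending on `k` only, the term of rank `ℓ` of the Margulis function is
controlled by a single primitive subgroup along the translates of `x₀` by `g_{ρ(x, k)} u(x)`, or it
is negligible there. -/
theorem exists_eps_dichotomy [IsProbabilityMeasure μ] (hK : F.IsLimitSet K) (hϖ : 0 ≤ varpi μ)
    (k : ℕ) :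
    ∃ b ε : ℝ, 1 ≤ b ∧ 0 < ε ∧ ε < 1 ∧
      (∀ γ ≤ varpi μ, ∀ x, 2 * F.cocycle K k x ^ (-γ) ≤ b) ∧
      ∀ (ϱ γ : ℝ) (ℓ : ℕ) (x₀ : LatticeSpace d), 0 ≤ ϱ → ϱ ≤ 1 → γ ≤ varpi μ → 1 ≤ ℓ → ℓ ≤ d →
        (∃ v : Fin ℓ → EuclideanSpace ℝ (Fin (d + 1)), IsPrimitiveBasis x₀ v ∧ ∀ x ∈ K,
          phi ℓ ((gFlow d (F.cocycle K k x) * uElt x) • x₀)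
            ≤ (covol (slAct (gFlow d (F.cocycle K k x) * uElt x) ∘ v))⁻¹) ∨
        ∀ x ∈ K, F.cocycle K k x ^ (-γ) * (ε ^ ℓ *
            phi ℓ ((gFlow d (F.cocycle K k x) * uElt x) • x₀) ^ (ϱ / betaExp μ ℓ))
          ≤ (∫ x, F.cocycle K k x ∂μ) * margulisFun μ ε ϱ x₀ := by
  obtain ⟨a, ha, hab⟩ := exists_norm_slAct_cocycle_le hK k
  obtain ⟨r, hr, hr1, hrle⟩ := F.exists_le_cocycle K k
  have ha0 : 0 < a := one_pos.trans_le ha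
  set A := a ^ d with hA
  have hA1 : 1 ≤ A := one_le_pow₀ ha
  have hA0 : 0 < A := one_pos.trans_le hA1
  set δ := r * r ^ varpi μ / (A ^ varpi μ * (2 * A) ^ varpi μ) with hδ
  have hδ0 : 0 < δ := by positivity
  have hργ : ∀ γ ≤ varpi μ, ∀ x, F.cocycle K k x ^ (-γ) ≤ r ^ (-varpi μ) := fun γ hγ x =>
    (Real.rpow_le_rpow_of_exponent_ge (F.cocycle_pos K k x) (F.cocycle_le_one K k x)
      (neg_le_neg hγ)).trans (Real.rpow_le_rpow_of_nonpos hr (hrle x) (by linarith))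
  -- this makes `ε ^ (1 / d) ≤ δ`, so that the term is at most `r` times the Margulis function
  set ε := min (1 / 2) (δ ^ d) with hε
  have hε0 : 0 < ε := lt_min (by norm_num) (by positivity)
  have hε1 : ε < 1 := (min_le_left _ _).trans_lt (by norm_num)
  refine ⟨2 * r ^ (-varpi μ), ε, ?_, hε0, hε1,
    fun γ hγ x => mul_le_mul_of_nonneg_left (hργ γ hγ x) two_pos.le, ?_⟩
  · have : 1 ≤ r ^ (-varpi μ) := Real.one_le_rpow_of_pos_of_le_one_of_nonpos hr hr1 (by linarith)
    linarith
  intro ϱ γ ℓ x₀ hϱ hϱ1 hγ hℓ hℓd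
  rcases phi_dichotomy x₀ hℓd hA1 with ⟨v, hv, hall⟩ | ⟨i, hi1, hiℓ, hid, hle⟩
  · exact Or.inl ⟨v, hv, fun x hx => hall _ a ha0.le (pow_le_pow_right₀ ha hℓd)
      (fun y => (hab x hx y).1) fun y => (hab x hx y).2⟩
  refine Or.inr fun x hx => ?_
  have h1 := margulisFun_term_le_of_phi_sq_le hϖ hε0 hε1.le hϱ hϱ1 hA1 hℓ hℓd hi1 hiℓ hid hle
  have h2 := phi_rpow_smul_le hϖ hϱ hϱ1 ha (fun y => (hab x hx y).2) hℓd x₀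
  have h3 := two_le_margulisFun (μ := μ) (ϱ := ϱ) hε0.le x₀
  have h4 : ε ^ (1 / (d : ℝ)) ≤ δ := by
    have hd : d ≠ 0 := by omega
    rw [one_div, Real.rpow_inv_le_iff_of_pos hε0.le hδ0.le (by positivity), Real.rpow_natCast]
    exact min_le_right _ _
  set f := margulisFun μ ε ϱ x₀ with hf
  calc _ ≤ r ^ (-varpi μ) * (A ^ varpi μ * ((2 * A) ^ varpi μ * δ * f)) := by
        refine mul_le_mul (hργ γ hγ x) ?_
          (margulisFun_term_nonneg hε0.le ℓ _) (by positivity)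
        refine (mul_le_mul_of_nonneg_left h2 (by positivity)).trans ?_
        rw [mul_left_comm]
        refine mul_le_mul_of_nonneg_left (h1.trans ?_) (by positivity)
        gcongr
    _ = r * f := by
        rw [hδ, Real.rpow_neg hr.le]
        have : r ^ varpi μ ≠ 0 := (Real.rpow_pos_of_pos hr _).ne'
        have : A ^ varpi μ ≠ 0 := (Real.rpow_pos_of_pos hA0 _).ne'
        have : (2 * A) ^ varpi μ ≠ 0 := (Real.rpow_pos_of_pos (by positivity) _).ne'
        field_simp
    _ ≤ _ := mul_le_mul_of_nonneg_right (le_integral_cocycle hK hrle) (by linarith)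

theorem measurable_cocycle_rpow_mul_phi (hK : F.IsLimitSet K) (k ℓ : ℕ) (γ c κ : ℝ)
    (x₀ : LatticeSpace d) :
    Measurable fun x => F.cocycle K k x ^ (-γ) *
      (c * phi ℓ ((gFlow d (F.cocycle K k x) * uElt x) • x₀) ^ κ) :=
  measurable_comp_cocycle hK k
    (G := fun t x => t ^ (-γ) * (c * phi ℓ ((gFlow d t * uElt x) • x₀) ^ κ))
    fun t _ => (((continuous_phi_gFlow_uElt ℓ t x₀).measurable.pow_const κ).const_mul c).const_mul _

theorem measurable_cocycle_rpow_mul_margulisFun (hK : F.IsLimitSet K) (k : ℕ) (γ ε ϱ : ℝ)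
    (x₀ : LatticeSpace d) :
    Measurable fun x => F.cocycle K k x ^ (-γ) *
      margulisFun μ ε ϱ ((gFlow d (F.cocycle K k x) * uElt x) • x₀) :=
  measurable_comp_cocycle hK k
    (G := fun t x => t ^ (-γ) * margulisFun μ ε ϱ ((gFlow d t * uElt x) • x₀))
    fun t _ => (measurable_const.add (Finset.measurable_sum _ fun ℓ _ =>
      ((continuous_phi_gFlow_uElt ℓ t x₀).measurable.pow_const _).const_mul _)).const_mul _

variable {p : Λ → ℝ} [IsProbabilityMeasure μ]

/-- The average of one term of the Margulis function, in either case of `exists_eps_dichotomy`. The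
constant does not depend on `k`. -/
theorem IsSelfSimilar.exists_lintegral_phi_le (hp : ∀ i, 0 < p i) (h : F.IsSelfSimilar p μ)
    (hirr : F.IsIrreducible) (hK : F.IsLimitSet K) (hμK : μ Kᶜ = 0) {ϱ : ℝ} (hϱ : 0 < ϱ)
    (hϱ1 : ϱ < 1) {ℓ : ℕ} (hℓ : 1 ≤ ℓ) (hℓd : ℓ ≤ d) :
    ∃ C : ℝ, 0 < C ∧ ∀ (k : ℕ) (γ ε : ℝ) (x₀ : LatticeSpace d), 0 ≤ ε →
      ϱ * betaMin μ - (1 - ϱ) / (1 + ϱ) ≤ γ → γ ≤ ϱ * betaMin μ →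
      ((∃ v : Fin ℓ → EuclideanSpace ℝ (Fin (d + 1)), IsPrimitiveBasis x₀ v ∧ ∀ x ∈ K,
          phi ℓ ((gFlow d (F.cocycle K k x) * uElt x) • x₀)
            ≤ (covol (slAct (gFlow d (F.cocycle K k x) * uElt x) ∘ v))⁻¹) ∨
        ∀ x ∈ K, F.cocycle K k x ^ (-γ) * (ε ^ ℓ *
            phi ℓ ((gFlow d (F.cocycle K k x) * uElt x) • x₀) ^ (ϱ / betaExp μ ℓ))
          ≤ (∫ x, F.cocycle K k x ∂μ) * margulisFun μ ε ϱ x₀) →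
      ∫⁻ x, ENNReal.ofReal (F.cocycle K k x ^ (-γ) * (ε ^ ℓ *
          phi ℓ ((gFlow d (F.cocycle K k x) * uElt x) • x₀) ^ (ϱ / betaExp μ ℓ))) ∂μ
        ≤ ENNReal.ofReal (C * ((∫ x, F.cocycle K k x ∂μ) ^ (ϱ * betaMin μ - γ) *
            margulisFun μ ε ϱ x₀)) := by
  have hϖ : 0 < varpi μ := varpi_pos (hℓ.trans hℓd) fun j hj hjd =>
    h.decayExponent_pos hp hirr hK hμK hj hjd
  have hκ : 0 ≤ ϱ / betaExp μ ℓ := div_betaExp_nonneg hϱ.le hϖ.le hℓd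
  obtain ⟨C, hC, hall⟩ := h.exists_lintegral_covol_le hp hirr hK hμK hϱ hϱ1 hℓ hℓd
  refine ⟨max C 1, by positivity, fun k γ ε x₀ hε hγ1 hγ2 hdich => ?_⟩
  have hKae : ∀ᵐ x ∂μ, x ∈ K := mem_ae_iff.2 hμK
  have hf := two_le_margulisFun (μ := μ) (ϱ := ϱ) hε x₀
  set I := ∫ x, F.cocycle K k x ∂μ with hI
  have hI0 : 0 < I := by
    obtain ⟨r, hr, -, hrle⟩ := F.exists_le_cocycle K k
    exact hr.trans_le (le_integral_cocycle hK hrle)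
  have hI1 : I ≤ 1 := integral_cocycle_le_one hK k
  rcases hdich with ⟨v, hv, hvle⟩ | hle
  · calc _ ≤ ∫⁻ x, ENNReal.ofReal (ε ^ ℓ) * ENNReal.ofReal (F.cocycle K k x ^ (-γ) *
            (covol (slAct (gFlow d (F.cocycle K k x) * uElt x) ∘ v))⁻¹ ^ (ϱ / betaExp μ ℓ)) ∂μ := by
          refine lintegral_mono_ae ?_
          filter_upwards [hKae] with x hx
          have hρ := F.cocycle_pos K k x
          rw [← ENNReal.ofReal_mul (by positivity), mul_left_comm]
          refine ENNReal.ofReal_le_ofReal (mul_le_mul_of_nonneg_left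
            (mul_le_mul_of_nonneg_left ?_ (by positivity)) (by positivity))
          exact Real.rpow_le_rpow (phi_nonneg _ _) (hvle x hx) hκ
      _ = ENNReal.ofReal (ε ^ ℓ) * ∫⁻ x, ENNReal.ofReal (F.cocycle K k x ^ (-γ) *
            (covol (slAct (gFlow d (F.cocycle K k x) * uElt x) ∘ v))⁻¹ ^ (ϱ / betaExp μ ℓ)) ∂μ :=
          lintegral_const_mul' _ _ ENNReal.ofReal_ne_top
      _ ≤ ENNReal.ofReal (ε ^ ℓ) * ENNReal.ofReal (C * I ^ (ϱ * betaMin μ - γ) *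
            (covol v)⁻¹ ^ (ϱ / betaExp μ ℓ)) := by
          gcongr
          exact hall k γ hγ1 hγ2 v hv.1
      _ ≤ _ := by
          rw [← ENNReal.ofReal_mul (by positivity)]
          refine ENNReal.ofReal_le_ofReal ?_
          calc ε ^ ℓ * (C * I ^ (ϱ * betaMin μ - γ) * (covol v)⁻¹ ^ (ϱ / betaExp μ ℓ))
              = C * (I ^ (ϱ * betaMin μ - γ) * (ε ^ ℓ * (covol v)⁻¹ ^ (ϱ / betaExp μ ℓ))) := by ring
            _ ≤ max C 1 * (I ^ (ϱ * betaMin μ - γ) * margulisFun μ ε ϱ x₀) := by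
                have h1 : (covol v)⁻¹ ^ (ϱ / betaExp μ ℓ) ≤ phi ℓ x₀ ^ (ϱ / betaExp μ ℓ) :=
                  Real.rpow_le_rpow (inv_nonneg.2 (covol_nonneg _))
                    (inv_covol_le_phi hv.1 hv.mem) hκ
                have h2 := margulisFun_term_le (μ := μ) (ϱ := ϱ) hε hℓ hℓd x₀
                have h3 := (mul_le_mul_of_nonneg_left h1 (pow_nonneg hε ℓ)).trans h2
                have h4 : 0 ≤ (covol v)⁻¹ ^ (ϱ / betaExp μ ℓ) :=
                  Real.rpow_nonneg (inv_nonneg.2 (covol_nonneg _)) _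
                exact mul_le_mul (le_max_left _ _) (mul_le_mul_of_nonneg_left h3 (by positivity))
                  (by positivity) (by positivity)
  · calc _ ≤ ∫⁻ _, ENNReal.ofReal (I * margulisFun μ ε ϱ x₀) ∂μ := by
          refine lintegral_mono_ae ?_
          filter_upwards [hKae] with x hx
          exact ENNReal.ofReal_le_ofReal (hle x hx)
      _ = ENNReal.ofReal (I * margulisFun μ ε ϱ x₀) := by
          rw [lintegral_const, measure_univ, mul_one]
      _ ≤ _ := by
          refine ENNReal.ofReal_le_ofReal ?_
          have h1 : I ≤ I ^ (ϱ * betaMin μ - γ) := by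
            have h2 : (1 - ϱ) / (1 + ϱ) ≤ 1 := by
              rw [div_le_one (by linarith)]; linarith
            have h3 := Real.rpow_le_rpow_of_exponent_ge hI0 hI1
              (show ϱ * betaMin μ - γ ≤ 1 by linarith)
            rwa [Real.rpow_one] at h3
          rw [← one_mul (I * _)]
          exact mul_le_mul (le_max_right _ _) (mul_le_mul_of_nonneg_right h1 (by linarith))
            (mul_nonneg hI0.le (by linarith)) (by positivity)

/-- The average of the Margulis function along `g_{ρ(x, k)} u(x) x₀`, with values in `[0, ∞]`. -/
theorem IsSelfSimilar.exists_lintegral_margulisFun_le (hp : ∀ i, 0 < p i)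
    (h : F.IsSelfSimilar p μ) (hirr : F.IsIrreducible) (hK : F.IsLimitSet K) (hμK : μ Kᶜ = 0)
    (hd : 1 ≤ d) :
    ∃ b ε₀ : ℕ → ℝ, (∀ k, 1 ≤ b k ∧ 0 < ε₀ k ∧ ε₀ k < 1) ∧ ∀ ϱ : ℝ, 0 < ϱ → ϱ < 1 →
      ∃ C : ℝ, 0 < C ∧ ∀ (k : ℕ) (x₀ : LatticeSpace d) (γ : ℝ),
        ϱ * betaMin μ - (1 - ϱ) / (1 + ϱ) ≤ γ → γ ≤ ϱ * betaMin μ →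
        ∫⁻ x, ENNReal.ofReal (F.cocycle K k x ^ (-γ) *
            margulisFun μ (ε₀ k) ϱ ((gFlow d (F.cocycle K k x) * uElt x) • x₀)) ∂μ
          ≤ ENNReal.ofReal (C * (∫ x, F.cocycle K k x ∂μ) ^ (ϱ * betaMin μ - γ) *
              margulisFun μ (ε₀ k) ϱ x₀ + b k) := by
  have hϖ : 0 < varpi μ := varpi_pos hd fun j hj hjd =>
    h.decayExponent_pos hp hirr hK hμK hj hjd
  choose b ε hb hε hε1 hbρ hdich using fun k => exists_eps_dichotomy (μ := μ) hK hϖ.le k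
  refine ⟨b, ε, fun k => ⟨hb k, hε k, hε1 k⟩, fun ϱ hϱ hϱ1 => ?_⟩
  have hterm : ∀ ℓ : Set.Icc 1 d, _ := fun ℓ =>
    h.exists_lintegral_phi_le hp hirr hK hμK hϱ hϱ1 ℓ.2.1 ℓ.2.2
  choose C hC hCall using hterm
  have hne : Nonempty (Set.Icc 1 d) := ⟨⟨1, le_refl 1, hd⟩⟩
  refine ⟨∑ ℓ, C ℓ, Finset.sum_pos (fun ℓ _ => hC ℓ) Finset.univ_nonempty,
    fun k x₀ γ hγ1 hγ2 => ?_⟩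
  have hγϖ : γ ≤ varpi μ := by
    have h1 := betaMin_le_varpi hϖ.le
    have h2 := betaMin_pos hϖ
    nlinarith
  have hf := two_le_margulisFun (μ := μ) (ϱ := ϱ) (hε k).le x₀
  set I := ∫ x, F.cocycle K k x ∂μ with hI
  have hI0 : 0 < I := by
    obtain ⟨r, hr, -, hrle⟩ := F.exists_le_cocycle K k
    exact hr.trans_le (le_integral_cocycle hK hrle)
  set T : Set.Icc 1 d → EuclideanSpace ℝ (Fin d) → ℝ := fun ℓ x => F.cocycle K k x ^ (-γ) *
    (ε k ^ (ℓ : ℕ) * phi (ℓ : ℕ) ((gFlow d (F.cocycle K k x) * uElt x) • x₀)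
      ^ (ϱ / betaExp μ (ℓ : ℕ))) with hT
  have hT0 : ∀ ℓ x, 0 ≤ T ℓ x := fun ℓ x => mul_nonneg
    (Real.rpow_nonneg (F.cocycle_pos K k x).le _) (margulisFun_term_nonneg (hε k).le _ _)
  have hTm : ∀ ℓ, Measurable (T ℓ) := fun ℓ =>
    measurable_cocycle_rpow_mul_phi hK k ℓ γ _ _ x₀
  have hsplit : ∀ x, F.cocycle K k x ^ (-γ) *
      margulisFun μ (ε k) ϱ ((gFlow d (F.cocycle K k x) * uElt x) • x₀)
        = 2 * F.cocycle K k x ^ (-γ) + ∑ ℓ, T ℓ x := by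
    intro x
    rw [margulisFun, mul_add, Finset.mul_sum, mul_comm _ (2 : ℝ)]
    congr 1
    exact (Finset.sum_subtype (Finset.Icc 1 d) (p := (· ∈ Set.Icc 1 d)) (fun ℓ => by simp)
      fun ℓ => F.cocycle K k x ^ (-γ) * (ε k ^ ℓ *
        phi ℓ ((gFlow d (F.cocycle K k x) * uElt x) • x₀) ^ (ϱ / betaExp μ ℓ)))
  calc _ ≤ ∫⁻ x, (ENNReal.ofReal (b k) + ∑ ℓ, ENNReal.ofReal (T ℓ x)) ∂μ := by
        refine lintegral_mono fun x => ?_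
        rw [hsplit, ← ENNReal.ofReal_sum_of_nonneg fun ℓ _ => hT0 ℓ x]
        exact ENNReal.ofReal_add_le.trans
          (add_le_add (ENNReal.ofReal_le_ofReal (hbρ k γ hγϖ x)) le_rfl)
    _ = ENNReal.ofReal (b k) + ∑ ℓ, ∫⁻ x, ENNReal.ofReal (T ℓ x) ∂μ := by
        rw [lintegral_add_left measurable_const, lintegral_const, measure_univ, mul_one,
          lintegral_finsetSum _ fun ℓ _ => (hTm ℓ).ennreal_ofReal]
    _ ≤ ENNReal.ofReal (b k) + ∑ ℓ, ENNReal.ofReal (C ℓ * (I ^ (ϱ * betaMin μ - γ) *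
          margulisFun μ (ε k) ϱ x₀)) := by
        gcongr with ℓ
        exact hCall ℓ k γ (ε k) x₀ (hε k).le hγ1 hγ2
          (hdich k ϱ γ ℓ x₀ hϱ.le hϱ1.le hγϖ ℓ.2.1 ℓ.2.2)
    _ = _ := by
        have hnn : 0 ≤ I ^ (ϱ * betaMin μ - γ) * margulisFun μ (ε k) ϱ x₀ :=
          mul_nonneg (by positivity) (by linarith)
        rw [← ENNReal.ofReal_sum_of_nonneg fun ℓ _ => mul_nonneg (hC ℓ).le hnn, ← Finset.sum_mul,
          ← ENNReal.ofReal_add (by linarith [hb k])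
            (mul_nonneg (Finset.sum_nonneg fun ℓ _ => (hC ℓ).le) hnn), add_comm, mul_assoc]

end SimilarityIFS

section Bounded

variable {d : ℕ}

theorem norm_slAct_of_mem_specialOrthogonalGroup {h : SLR d}
    (hh : (h : Matrix (Fin (d + 1)) (Fin (d + 1)) ℝ)
      ∈ Matrix.specialOrthogonalGroup (Fin (d + 1)) ℝ) (y : EuclideanSpace ℝ (Fin (d + 1))) :
    ‖slAct h y‖ = ‖y‖ := by
  have h1 : (h : Matrix (Fin (d + 1)) (Fin (d + 1)) ℝ).transpose
      * (h : Matrix (Fin (d + 1)) (Fin (d + 1)) ℝ) = 1 :=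
    (Matrix.mem_orthogonalGroup_iff' _ ℝ).1 (Matrix.mem_specialOrthogonalGroup_iff.1 hh).1
  have h2 : inner ℝ (slAct h y) (slAct h y) = inner ℝ y y := by
    simp only [slAct_apply, EuclideanSpace.inner_eq_star_dotProduct, star_trivial]
    rw [Matrix.dotProduct_mulVec, Matrix.vecMul_mulVec, h1, Matrix.vecMul_one]
  rw [real_inner_self_eq_norm_sq, real_inner_self_eq_norm_sq] at h2
  exact (sq_eq_sq₀ (norm_nonneg _) (norm_nonneg _)).1 h2

theorem norm_slAct_le_of_abs_le {h : SLR d} {R : ℝ} (hR : ∀ i j, |h i j| ≤ R)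
    (y : EuclideanSpace ℝ (Fin (d + 1))) :
    ‖slAct h y‖ ≤ (((d : ℝ) + 1) * (((d : ℝ) + 1) * R)) * ‖y‖ := by
  have hR0 : 0 ≤ R := (abs_nonneg _).trans (hR 0 0)
  have hcoord : ∀ i, |slAct h y i| ≤ ((d : ℝ) + 1) * R * ‖y‖ := by
    intro i
    change |∑ j, h i j * y j| ≤ _
    refine (Finset.abs_sum_le_sum_abs _ _).trans ?_
    refine (Finset.sum_le_card_nsmul _ _ (R * ‖y‖) fun j _ => ?_).trans_eq ?_
    · rw [abs_mul]
      exact mul_le_mul (hR i j) (PiLp.norm_apply_le y j) (abs_nonneg _) hR0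
    · rw [Finset.card_univ, Fintype.card_fin, nsmul_eq_mul]
      push_cast
      ring
  have hsum : slAct h y = ∑ i, EuclideanSpace.single i (slAct h y i) := by
    ext j
    simp [Finset.sum_apply, Pi.single_apply]
  rw [hsum]
  refine (norm_sum_le _ _).trans ?_
  refine (Finset.sum_le_card_nsmul _ _ (((d : ℝ) + 1) * R * ‖y‖) fun i _ => ?_).trans_eq ?_
  · rw [PiLp.norm_single]
    exact hcoord i
  · rw [Finset.card_univ, Fintype.card_fin, nsmul_eq_mul]
    push_cast
    ring

/-- The entries of the inverse are minors, hence bounded in terms of the entries. -/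
theorem abs_inv_apply_le {h : SLR d} {R : ℝ} (hR : ∀ i j, |h i j| ≤ R) (i j : Fin (d + 1)) :
    |(h⁻¹ : SLR d) i j| ≤ (d + 1).factorial * (max R 1) ^ (d + 1) := by
  rw [Matrix.SpecialLinearGroup.coe_inv, Matrix.adjugate_apply]
  have := Matrix.det_le (A := (h : Matrix (Fin (d + 1)) (Fin (d + 1)) ℝ).updateRow j
    (Pi.single i 1)) (abv := AbsoluteValue.abs) (x := max R 1) fun a b => by
      change |_| ≤ _
      rw [Matrix.updateRow_apply]
      split_ifs with hab
      · rw [Pi.single_apply]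
        split_ifs <;> simp
      · exact (hR a b).trans (le_max_left _ _)
  rw [Fintype.card_fin, nsmul_eq_mul] at this
  exact this

theorem exists_norm_slAct_le_of_bounded {R : ℝ} :
    ∃ a : ℝ, 1 ≤ a ∧ ∀ h : SLR d, (∀ i j, |h i j| ≤ R) →
      (∀ y, ‖slAct h y‖ ≤ a * ‖y‖) ∧ ∀ y, ‖slAct h⁻¹ y‖ ≤ a * ‖y‖ := by
  set a₁ := ((d : ℝ) + 1) * (((d : ℝ) + 1) * R) with h1
  set a₂ := ((d : ℝ) + 1) * (((d : ℝ) + 1) * ((d + 1).factorial * (max R 1) ^ (d + 1))) with h2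
  refine ⟨max 1 (max a₁ a₂), le_max_left _ _, fun h hR => ⟨fun y => ?_, fun y => ?_⟩⟩
  · refine (norm_slAct_le_of_abs_le hR y).trans (mul_le_mul_of_nonneg_right ?_ (norm_nonneg _))
    exact (le_max_left _ _).trans (le_max_right _ _)
  · refine (norm_slAct_le_of_abs_le (abs_inv_apply_le hR) y).trans
      (mul_le_mul_of_nonneg_right ?_ (norm_nonneg _))
    exact (le_max_right _ _).trans (le_max_right _ _)

variable {μ : Measure (EuclideanSpace ℝ (Fin d))}

theorem margulisFun_smul_of_mem_specialOrthogonalGroup (hϖ : 0 ≤ varpi μ) {ε ϱ : ℝ} (hε : 0 ≤ ε)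
    (hϱ : 0 ≤ ϱ) (hϱ1 : ϱ ≤ 1) {h : SLR d}
    (hh : (h : Matrix (Fin (d + 1)) (Fin (d + 1)) ℝ)
      ∈ Matrix.specialOrthogonalGroup (Fin (d + 1)) ℝ) (x : LatticeSpace d) :
    margulisFun μ ε ϱ (h • x) = margulisFun μ ε ϱ x := by
  have h1 := norm_slAct_of_mem_specialOrthogonalGroup hh
  have h2 : ∀ y, ‖slAct h⁻¹ y‖ ≤ 1 * ‖y‖ := fun y => by
    rw [one_mul, ← h1 (slAct h⁻¹ y), slAct_slAct_inv]
  refine le_antisymm ?_ ?_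
  · have := margulisFun_smul_le hϖ hε hϱ hϱ1 le_rfl h2 x
    rwa [one_pow, Real.one_rpow, one_mul] at this
  · have := margulisFun_smul_le hϖ hε hϱ hϱ1 (h := h⁻¹) le_rfl
      (fun y => by rw [inv_inv, one_mul, h1 y]) (h • x)
    rwa [one_pow, Real.one_rpow, one_mul, inv_smul_smul] at this

end Bounded

/-! ### The contraction hypothesis -/

/-- The bound for averages implies the contraction hypothesis: where the Margulis function is large,
the additive constant is dominated by the main term. The remaining conditions hold because bounded
elements of the group change covolumes by bounded factors, and rotations not at all. -/
theorem contractionHypothesis_margulisFun {d : ℕ} {Λ : Type*} [Fintype Λ] [LinearOrder Λ]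
    {F : SimilarityIFS d Λ} {K : Set (EuclideanSpace ℝ (Fin d))} (hK : F.IsLimitSet K)
    {μ : Measure (EuclideanSpace ℝ (Fin d))} [IsProbabilityMeasure μ]
    (hμK : μ Kᶜ = 0) (hϖ : 0 < varpi μ) {b ε : ℕ → ℝ} (hb : ∀ k, 1 ≤ b k) (hε : ∀ k, 0 < ε k)
    {ϱ C : ℝ} (hϱ : 0 < ϱ) (hϱ1 : ϱ < 1) (hC : 0 < C)
    (hint : ∀ (k : ℕ) (x₀ : LatticeSpace d) (γ : ℝ),
      ϱ * betaMin μ - (1 - ϱ) / (1 + ϱ) ≤ γ → γ ≤ ϱ * betaMin μ →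
      ∫⁻ x, ENNReal.ofReal (F.cocycle K k x ^ (-γ) *
          margulisFun μ (ε k) ϱ ((gFlow d (F.cocycle K k x) * uElt x) • x₀)) ∂μ
        ≤ ENNReal.ofReal (C * (∫ x, F.cocycle K k x ∂μ) ^ (ϱ * betaMin μ - γ) *
            margulisFun μ (ε k) ϱ x₀ + b k)) :
    ContractionHypothesis F K μ
      (fun k (x : LatticeSpace d) => ENNReal.ofReal (margulisFun μ (ε k) ϱ x))
      (ϱ * betaMin μ) (max 0 (ϱ * betaMin μ - (1 - ϱ) / (1 + ϱ))) := by
  have hf : ∀ k x, 2 ≤ margulisFun μ (ε k) ϱ x := fun k x => two_le_margulisFun (hε k).le x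
  refine ⟨⟨le_max_left _ _, max_lt (mul_pos hϱ (betaMin_pos hϖ)) ?_⟩, fun k y => ?_,
    fun _ _ _ => by simp, fun _ _ _ => by simp, fun k g y hg => ?_, fun O _ ⟨R, hR⟩ => ?_,
    C + 1, by linarith, fun k γ hγ1 hγ2 => ?_⟩
  · have : 0 < (1 - ϱ) / (1 + ϱ) := div_pos (by linarith) (by linarith)
    linarith
  · exact ENNReal.ofReal_pos.2 (by linarith [hf k y])
  · exact congrArg ENNReal.ofReal
      (margulisFun_smul_of_mem_specialOrthogonalGroup hϖ.le (hε k).le hϱ.le hϱ1.le hg y)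
  · obtain ⟨a, ha, hab⟩ := exists_norm_slAct_le_of_bounded (d := d) (R := R)
    have ha1 : 1 ≤ (a ^ d) ^ varpi μ := Real.one_le_rpow (one_le_pow₀ ha) hϖ.le
    have ha0 : 0 < (a ^ d) ^ varpi μ := one_pos.trans_le ha1
    refine ⟨(a ^ d) ^ varpi μ, ha1, fun g hg y k => ?_⟩
    obtain ⟨h1, h2⟩ := hab g (hR g hg)
    have h3 := margulisFun_smul_le hϖ.le (hε k).le hϱ.le hϱ1.le ha h2 y
    have h4 := margulisFun_smul_le hϖ.le (hε k).le hϱ.le hϱ1.le (h := g⁻¹) ha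
      (fun z => by rw [inv_inv]; exact h1 z) (g • y)
    rw [inv_smul_smul] at h4
    rw [← ENNReal.ofReal_mul (by positivity), ← ENNReal.ofReal_mul (by positivity)]
    exact ⟨ENNReal.ofReal_le_ofReal ((inv_mul_le_iff₀ ha0).2 h4), ENNReal.ofReal_le_ofReal h3⟩
  · have hres : μ.restrict K = μ := Measure.restrict_eq_self_of_ae_mem (mem_ae_iff.2 hμK)
    rw [hres]
    set I := ∫ x, F.cocycle K k x ∂μ with hI
    have hI0 : 0 < I := by
      obtain ⟨r, hr, -, hrle⟩ := F.exists_le_cocycle K k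
      exact hr.trans_le (SimilarityIFS.le_integral_cocycle hK hrle)
    have hq0 : 0 < I ^ (ϱ * betaMin μ - γ) := Real.rpow_pos_of_pos hI0 _
    -- beyond this threshold, the additive constant is absorbed
    refine ⟨b k / I ^ (ϱ * betaMin μ - γ), div_pos (by linarith [hb k]) hq0, fun y hy => ?_⟩
    have hfy : b k / I ^ (ϱ * betaMin μ - γ) < margulisFun μ (ε k) ϱ y :=
      (ENNReal.ofReal_lt_ofReal_iff_of_nonneg (div_nonneg (by linarith [hb k]) hq0.le)).1 hy
    rw [div_lt_iff₀ hq0] at hfy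
    rw [← ENNReal.ofReal_mul (by linarith), ← ENNReal.ofReal_mul
      (mul_nonneg (by linarith) (by linarith [hf k y]))]
    refine le_trans (le_of_eq ?_)
      ((hint k y γ ((le_max_right _ _).trans hγ1) hγ2).trans (ENNReal.ofReal_le_ofReal ?_))
    · refine lintegral_congr fun x => ?_
      rw [ENNReal.ofReal_mul (Real.rpow_nonneg (F.cocycle_pos K k x).le _)]
    · linear_combination hfy

end

theorem mainTheorem10 {d : ℕ} (hd : 1 ≤ d) {Λ : Type*} [Fintype Λ] [LinearOrder Λ]
    (F : SimilarityIFS d Λ) (hirr : F.IsIrreducible) (hosc : F.OpenSetCondition)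
    (K : Set (EuclideanSpace ℝ (Fin d))) (hK : F.IsLimitSet K)
    (μ : Measure (EuclideanSpace ℝ (Fin d))) [IsProbabilityMeasure μ]
    (hμK : μ Kᶜ = 0) (hμ : F.IsSelfSimilar (fun i => F.ratio i ^ (dimH K).toReal) μ) :
    ∃ b ε₀ : ℕ → ℝ, (∀ k, 1 ≤ b k ∧ 0 < ε₀ k ∧ ε₀ k < 1) ∧
      ∀ ϱ : ℝ, 0 < ϱ → ϱ < 1 →
        (∃ C₁ : ℝ, 0 < C₁ ∧ ∀ (k : ℕ) (x₀ : LatticeSpace d) (γ : ℝ),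
          ϱ * betaMin μ - (1 - ϱ) / (1 + ϱ) ≤ γ → γ ≤ ϱ * betaMin μ →
            Integrable (fun x => F.cocycle K k x ^ (-γ) *
              margulisFun μ (ε₀ k) ϱ ((gFlow d (F.cocycle K k x) * uElt x) • x₀)) μ ∧
            ∫ x, F.cocycle K k x ^ (-γ) *
                margulisFun μ (ε₀ k) ϱ ((gFlow d (F.cocycle K k x) * uElt x) • x₀) ∂μ
              ≤ C₁ * (∫ x, F.cocycle K k x ∂μ) ^ (ϱ * betaMin μ - γ) *
                  margulisFun μ (ε₀ k) ϱ x₀ + b k) ∧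
        ContractionHypothesis F K μ
          (fun k (x : LatticeSpace d) => ENNReal.ofReal (margulisFun μ (ε₀ k) ϱ x))
          (ϱ * betaMin μ) (max 0 (ϱ * betaMin μ - (1 - ϱ) / (1 + ϱ))) := by
  have hp : ∀ i, 0 < F.ratio i ^ (dimH K).toReal := fun i => Real.rpow_pos_of_pos (F.ratio_pos i) _
  have hϖ : 0 < varpi μ := varpi_pos hd fun j hj hjd =>
    hμ.decayExponent_pos hp hirr hK hμK hj hjd
  obtain ⟨b, ε, hbε, hall⟩ := hμ.exists_lintegral_margulisFun_le hp hirr hK hμK hd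
  refine ⟨b, ε, hbε, fun ϱ hϱ hϱ1 => ?_⟩
  obtain ⟨C, hC, hint⟩ := hall ϱ hϱ hϱ1
  refine ⟨⟨C, hC, fun k x₀ γ hγ1 hγ2 => ?_⟩, contractionHypothesis_margulisFun hK hμK hϖ
    (fun k => (hbε k).1) (fun k => (hbε k).2.1) hϱ hϱ1 hC hint⟩
  have hle := hint k x₀ γ hγ1 hγ2
  have hm := (F.measurable_cocycle_rpow_mul_margulisFun (μ := μ) hK k γ (ε k) ϱ
    x₀).aestronglyMeasurable (μ := μ)
  have hf : ∀ x, 0 ≤ margulisFun μ (ε k) ϱ x := fun x =>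
    two_pos.le.trans (two_le_margulisFun (hbε k).2.1.le x)
  have hnn : ∀ x, 0 ≤ F.cocycle K k x ^ (-γ) *
      margulisFun μ (ε k) ϱ ((gFlow d (F.cocycle K k x) * uElt x) • x₀) := fun x =>
    mul_nonneg (Real.rpow_nonneg (F.cocycle_pos K k x).le _) (hf _)
  have hI0 : 0 ≤ ∫ x, F.cocycle K k x ∂μ := integral_nonneg fun x => (F.cocycle_pos K k x).le
  refine ⟨⟨hm, ?_⟩, ?_⟩
  · rw [hasFiniteIntegral_iff_ofReal (.of_forall hnn)]
    exact hle.trans_lt ENNReal.ofReal_lt_top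
  · rw [integral_eq_lintegral_of_nonneg_ae (.of_forall hnn) hm]
    refine ENNReal.toReal_le_of_le_ofReal ?_ hle
    exact add_nonneg (mul_nonneg (mul_nonneg hC.le (Real.rpow_nonneg hI0 _)) (hf _))
      (zero_le_one.trans (hbε k).1)
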